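/- Let $T>0$ and let $U\subset\mathbb R^m$, $V\subset\mathbb R^l$ be compact. Let $g_0:\mathbb R^n\times U\times V\to\mathbb R^n$ be continuous, with $(x,u)\mapsto g_0(x,u,v)$ locally Lipschitz uniformly in $v\in V$, let $g_1,\dots,g_m:\mathbb R^n\times U\to\mathbb R^n$ be locally Lipschitz, and assume that for some $M>0$, $|(g_0(x,u,v),g_1(x,u),\dots,g_m(x,u))|\le M(1+|(x,u)|)$ on $\mathbb R^n\times U\times V$. Fix $\bar x_0\in\mathbb R^n$, $\bar u_0\in U$ and consider $$\dot x=g_0(x,u,v)+\sum_{i=1}^m g_i(x,u)\,\dot u_i \ \text{ on } [0,T],\qquad x(0)=\bar x_0,\quad u(0)=\bar u_0. \tag{E}$$ Assume that $U$ has the Whitney property: for some $C\ge 1$, any $u_1,u_2\in U$ are joined by an absolutely continuous path in $U$ of variation at most $C|u_1-u_2|$. Let $u:[0,T]\to U$ have bounded variation on $[0,t]$ for every $t<T$, with $u(0)=\bar u_0$, and let $v\in L^1([0,T],V)$ (with a Borel representative fixed). **Graph completion solutions.** A feasible space-time control is a tuple $(\varphi_0,\varphi,\psi,S)$ with $0<S\le+\infty$,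 $(\varphi_0,\varphi):[0,S[\to\mathbb R_+\times U$ $1$-Lipschitz, $\psi:[0,S[\to V$ Borel measurable, $\varphi_0'\ge0$ and $\varphi_0'+|\varphi'|=1$ a.e., $(\varphi_0,\varphi)(0)=(0,\bar u_0)$, $\lim_{s\to S}\varphi_0(s)=T$. It is a $BV_{loc}$ graph completion of $(u,v)$ if every $t\in[0,T[$ admits $s\in[0,S[$ with $(\varphi_0,\varphi,\psi)(s)=(t,u(t),v(t))$, and $\lim_{s\to S}\varphi(s)=u(T)$ if $S<+\infty$, respectively $\lim_j\varphi(s_j)=u(T)$ for some $s_j\nearrow+\infty$ if $S=+\infty$. A clock is an increasing $\sigma:[0,T]\to[0,S]$ with $\sigma(0)=0$, $\sigma(T)=S$ and $(\varphi_0,\varphi)(\sigma(t))=(t,u(t))$ for all $t$ (at $t=T$, if $S=+\infty$, in the preceding sense). Let $\xi$ be the solution on $[0,S[$ of $\xi'=g_0(\xi,\varphi,\psi)\varphi_0'+\sum_i g_i(\xi,\varphi)\varphi_i'$, $\xi(0)=\bar x_0$. A map $x:[0,T]\to\mathbb R^n$ is a $BV_{loc}$ graph completion solution if, for some such graph completion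 and clock, $x=\xi\circ\sigma$ on $[0,T[$ and: if $S<+\infty$, $x(T)=\lim_{s\to S}\xi(s)$; if $S=+\infty$, $\xi$ is bounded and $(x(T),u(T))=\lim_j(\xi,\varphi)(s_j)$ for some $s_j\nearrow+\infty$. **$BV_{loc}S$ limit solutions.** A map $x:[0,T]\to\mathbb R^n$ is a $BV_{loc}S$ limit solution on $[0,T[$ if there are absolutely continuous $u_k:[0,T]\to U$ with $u_k(0)=\bar u_0$, $u_k\to u$ pointwise on $[0,T]$, with equibounded variation on $[0,t]$ for each $t\in\,]0,T[$, such that the Carathéodory solutions $x_k$ of (E) for $(u_k,v)$ are equibounded on $[0,T]$ and converge to $x$ pointwise on $[0,T]$. It is a $BV_{loc}S$ limit solution on $[0,T]$ if, moreover (for the same sequence), $x$ is bounded and there are a positive decreasing map $\tilde\varepsilon$ with $\lim_{s\to+\infty}\tilde\varepsilon(s)=0$ and strictly increasing diverging sequences $(\tilde s_j)\subset\mathbb R_+$, $(k_j)\subset\mathbb N$, $k_j\ge j$, such that for every $j$ and every $k>k_j$ there is $\tau_k^j\in[0,T[$ with $$\tau_k^j+\mathrm{Var}_{[0,\tau_k^j]}(u_k)=\tilde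 s_j,\qquad |(x_k,u_k)(\tau_k^j)-(x_k,u_k)(T)|\le\tilde\varepsilon(j).$$ **Theorem.** (i) (Well-posedness) Every $BV_{loc}$ graph completion solution $x$ associated to $(u,v)$ is a $BV_{loc}S$ limit solution on $[0,T[$ and, provided $U$ has at least two points, on $[0,T]$. (ii) (Characterization) Conversely, every $BV_{loc}S$ limit solution on $[0,T]$ is a $BV_{loc}$ graph completion solution. -/

import Mathlib

open Set Filter Topology MeasureTheory

namespace Impulsive

/-- The Euclidean space `ℝⁿ`. -/
abbrev E (n : ℕ) : Type := EuclideanSpace ℝ (Fin n)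

/-- The Euclidean norm `|(a, b)|` of a pair of vectors. -/
noncomputable def pairNorm {F G : Type*} [Norm F] [Norm G] (a : F) (b : G) : ℝ :=
  Real.sqrt (‖a‖ ^ 2 + ‖b‖ ^ 2)

/-- The data of the control system
`x' = g₀(x, u, v) + ∑ i, gᵢ(x, u) uᵢ'`, with `u` in `U ⊆ ℝᵐ` and `v` in `V ⊆ ℝˡ`.
The values of `g₀`, `gᵢ` at arguments `u ∉ U`, `v ∉ V` are irrelevant. -/
structure System (n m l : ℕ) where
  U : Set (E m)
  V : Set (E l)
  g₀ : E n → E m → E l → E n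
  g : Fin m → E n → E m → E n

/-- The hypotheses on the system: compact control sets; `g₀` continuous, and locally Lipschitz in
`(x, u)` uniformly in `v`; each `gᵢ` locally Lipschitz; linear growth. -/
structure System.Assumptions {n m l : ℕ} (sys : System n m l) : Prop where
  isCompact_U : IsCompact sys.U
  isCompact_V : IsCompact sys.V
  continuousOn_g₀ :
    ContinuousOn (fun p : E n × E m × E l => sys.g₀ p.1 p.2.1 p.2.2) (univ ×ˢ sys.U ×ˢ sys.V)
  lipschitz_g₀ : ∀ p ∈ (univ ×ˢ sys.U : Set (E n × E m)),
    ∃ K, ∃ N ∈ 𝓝[univ ×ˢ sys.U] p, ∀ v ∈ sys.V,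
      LipschitzOnWith K (fun q : E n × E m => sys.g₀ q.1 q.2 v) N
  lipschitz_g : ∀ i, LocallyLipschitzOn (univ ×ˢ sys.U) (fun q : E n × E m => sys.g i q.1 q.2)
  growth : ∃ M : ℝ, 0 < M ∧ ∀ x : E n, ∀ u ∈ sys.U, ∀ v ∈ sys.V,
    Real.sqrt (‖sys.g₀ x u v‖ ^ 2 + ∑ i, ‖sys.g i x u‖ ^ 2) ≤ M * (1 + pairNorm x u)

/-- Whitney property: any two points `u₁`, `u₂` of `U` are joined by an absolutely continuous path
in `U` of variation at most `C |u₁ - u₂|`. -/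
def WhitneyProperty {m : ℕ} (U : Set (E m)) : Prop :=
  ∃ C : ℝ, 1 ≤ C ∧ ∀ u₁ ∈ U, ∀ u₂ ∈ U, ∃ p : ℝ → E m,
    AbsolutelyContinuousOnInterval p 0 1 ∧ (∀ r ∈ Icc (0 : ℝ) 1, p r ∈ U) ∧
    p 0 = u₁ ∧ p 1 = u₂ ∧ eVariationOn p (Icc 0 1) ≤ ENNReal.ofReal (C * ‖u₁ - u₂‖)

/-- Controls `u : [0,T] → U` of bounded variation on `[0,t]` for every `t < T`; no condition links
`u(T)` to the values on `[0,T[`. -/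
def IsBVLocControl {m : ℕ} (U : Set (E m)) (T : ℝ) (u : ℝ → E m) : Prop :=
  (∀ t ∈ Icc 0 T, u t ∈ U) ∧ ∀ t ∈ Ico 0 T, BoundedVariationOn u (Icc 0 t)

/-- Ordinary controls: Borel measurable `v : [0,T] → V`. As `V` is bounded, these are the Borel
representatives of the elements of `L¹([0,T], V)`. -/
def IsOrdinaryControl {l : ℕ} (V : Set (E l)) (T : ℝ) (v : ℝ → E l) : Prop :=
  Measurable ((Icc 0 T).domRestrict v) ∧ ∀ t ∈ Icc 0 T, v t ∈ V

/-- Controls in `AC([0,T], U)`. -/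
def IsACControl {m : ℕ} (U : Set (E m)) (T : ℝ) (u : ℝ → E m) : Prop :=
  AbsolutelyContinuousOnInterval u 0 T ∧ ∀ t ∈ Icc 0 T, u t ∈ U

/-- `x` is the Carathéodory solution on `[0,T]`, with `x(0) = x₀`, for the absolutely continuous
control `u` and the ordinary control `v`. -/
def System.IsCaratheodorySolution {n m l : ℕ} (sys : System n m l) (x₀ : E n) (T : ℝ)
    (u : ℝ → E m) (v : ℝ → E l) (x : ℝ → E n) : Prop :=
  x 0 = x₀ ∧ AbsolutelyContinuousOnInterval x 0 T ∧
  ∀ᵐ t : ℝ, t ∈ Ioo 0 T →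
    HasDerivAt x (sys.g₀ (x t) (u t) (v t) + ∑ i, (deriv u t) i • sys.g i (x t) (u t)) t

/-! ### Space-time controls and graph completions -/

/-- The interval `[0,S[`, where `S ≤ +∞`. -/
def pseudoTime (S : EReal) : Set ℝ := {s : ℝ | 0 ≤ s ∧ (s : EReal) < S}

/-- The filter `s → S`, `s < S`, on the real line, where `S ≤ +∞`. -/
noncomputable def toEnd (S : EReal) : Filter ℝ := comap Real.toEReal (𝓝[<] S)

theorem toEnd_top : toEnd ⊤ = atTop := by
  rw [toEnd, Iio_top, EReal.nhdsWithin_top, comap_map EReal.coe_injective]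

theorem toEnd_coe (r : ℝ) : toEnd (r : EReal) = 𝓝[<] r := by
  have h : Real.toEReal ⁻¹' (Iio (r : EReal)) = Iio r := by
    ext s; simp
  rw [toEnd, nhdsWithin, comap_inf, comap_principal, h, nhdsWithin,
    ← EReal.isEmbedding_coe.nhds_eq_comap]

/-- The data `(φ₀, φ, ψ, S)` of a space-time control; only the restrictions of `φ₀`, `φ`, `ψ` to
`[0,S[` are relevant. -/
structure SpaceTimeControl (m l : ℕ) where
  φ₀ : ℝ → ℝ
  φ : ℝ → E m
  ψ : ℝ → E l
  S : EReal

/-- `(φ₀, φ, ψ, S)` is a space-time control with Lipschitz constant `L`: `0 < S ≤ +∞`, the map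
`(φ₀, φ) : [0,S[ → ℝ₊ × U` is `L`-Lipschitz with `φ₀(0) = 0`, and `φ₀' ≥ 0`,
`φ₀' + |φ'| ≤ L` a.e., and `ψ : [0,S[ → V` is (Borel) measurable. -/
structure SpaceTimeControl.IsControl {m l : ℕ} (c : SpaceTimeControl m l)
    (U : Set (E m)) (V : Set (E l)) (L : ℝ) : Prop where
  pos_S : 0 < c.S
  nonneg_φ₀ : ∀ s ∈ pseudoTime c.S, 0 ≤ c.φ₀ s
  mem_U : ∀ s ∈ pseudoTime c.S, c.φ s ∈ U
  lipschitz : ∀ s ∈ pseudoTime c.S, ∀ r ∈ pseudoTime c.S,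
    pairNorm (c.φ₀ s - c.φ₀ r) (c.φ s - c.φ r) ≤ L * |s - r|
  φ₀_zero : c.φ₀ 0 = 0
  deriv_nonneg : ∀ᵐ s : ℝ, s ∈ pseudoTime c.S → 0 ≤ deriv c.φ₀ s
  deriv_le : ∀ᵐ s : ℝ, s ∈ pseudoTime c.S → deriv c.φ₀ s + ‖deriv c.φ s‖ ≤ L
  measurable_ψ : Measurable ((pseudoTime c.S).domRestrict c.ψ)
  mem_V : ∀ s ∈ pseudoTime c.S, c.ψ s ∈ V

/-- The set `Γ(T; u₀)` of feasible space-time controls: Lipschitz constant `1`, arc-length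
parametrized, starting at `φ(0) = u₀`, and with `φ₀(s) → T` as `s → S`. -/
structure SpaceTimeControl.IsFeasible {m l : ℕ} (c : SpaceTimeControl m l)
    (U : Set (E m)) (V : Set (E l)) (T : ℝ) (u₀ : E m) : Prop where
  isControl : c.IsControl U V 1
  arcLength : ∀ᵐ s : ℝ, s ∈ pseudoTime c.S → deriv c.φ₀ s + ‖deriv c.φ s‖ = 1
  φ_zero : c.φ 0 = u₀
  tendsto_φ₀ : Tendsto c.φ₀ (toEnd c.S) (𝓝 T)

/-- `ξ` is the (Carathéodory) solution on `[0,S[` of the space-time system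
`ξ' = g₀(ξ, φ, ψ) φ₀' + ∑ i, gᵢ(ξ, φ) φᵢ'`, `ξ(0) = x₀`. -/
def System.IsSpaceTimeSolution {n m l : ℕ} (sys : System n m l) (x₀ : E n)
    (c : SpaceTimeControl m l) (ξ : ℝ → E n) : Prop :=
  ξ 0 = x₀ ∧ (∀ s ∈ pseudoTime c.S, AbsolutelyContinuousOnInterval ξ 0 s) ∧
  ∀ᵐ s : ℝ, s ∈ pseudoTime c.S →
    HasDerivAt ξ (deriv c.φ₀ s • sys.g₀ (ξ s) (c.φ s) (c.ψ s)
      + ∑ i, (deriv c.φ s) i • sys.g i (ξ s) (c.φ s)) s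

/-- The feasible space-time control `c` is a BV_loc graph completion of `(u, v)`.
For `S < +∞`, `φ(S)` is the extension of `φ` by continuity (and `φ₀(S) = T` by feasibility). -/
structure SpaceTimeControl.IsGraphCompletion {m l : ℕ} (c : SpaceTimeControl m l)
    (U : Set (E m)) (V : Set (E l)) (T : ℝ) (u₀ : E m) (u : ℝ → E m) (v : ℝ → E l) : Prop where
  isFeasible : c.IsFeasible U V T u₀
  covers : ∀ t ∈ Ico 0 T, ∃ s ∈ pseudoTime c.S, c.φ₀ s = t ∧ c.φ s = u t ∧ c.ψ s = v t
  final_of_finite : c.S < ⊤ → Tendsto c.φ (toEnd c.S) (𝓝 (u T))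
  final_of_infinite : c.S = ⊤ → ∃ s : ℕ → ℝ, StrictMono s ∧ (∀ j, 0 ≤ s j) ∧
    Tendsto s atTop atTop ∧ Tendsto (fun j => c.φ (s j)) atTop (𝓝 (u T))

/-- `σ` is a clock for the graph completion `c` of `(u, v)`. Only the restriction of `σ` to `[0,T[`
is recorded, which necessarily takes values in `[0,S[`: the remaining condition `σ(T) = S` just
means that `(φ₀, φ)(S) = (T, u(T))`, in the sense of the previous definition. -/
structure SpaceTimeControl.IsClock {m l : ℕ} (c : SpaceTimeControl m l)
    (T : ℝ) (u : ℝ → E m) (σ : ℝ → ℝ) : Prop where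
  monotone : MonotoneOn σ (Ico 0 T)
  zero : σ 0 = 0
  mem : ∀ t ∈ Ico 0 T, σ t ∈ pseudoTime c.S
  graph : ∀ t ∈ Ico 0 T, c.φ₀ (σ t) = t ∧ c.φ (σ t) = u t

/-- `x` is a BV_loc graph completion solution on `[0,T]` associated to the control `(u, v)`:
`x = ξ ∘ σ` on `[0,T[` for some graph completion and clock, where `ξ` is bounded if `S = +∞`, and
`x(T) = ξ(S)` (extension by continuity) if `S < +∞`, while `(x(T), u(T))` is the limit of `(ξ, φ)`
along some sequence `s_j ↗ +∞` if `S = +∞`. -/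
def System.IsGraphCompletionSolution {n m l : ℕ} (sys : System n m l) (x₀ : E n) (u₀ : E m)
    (T : ℝ) (u : ℝ → E m) (v : ℝ → E l) (x : ℝ → E n) : Prop :=
  ∃ (c : SpaceTimeControl m l) (σ : ℝ → ℝ) (ξ : ℝ → E n),
    c.IsGraphCompletion sys.U sys.V T u₀ u v ∧ c.IsClock T u σ ∧
    sys.IsSpaceTimeSolution x₀ c ξ ∧
    (∀ t ∈ Ico 0 T, x t = ξ (σ t)) ∧
    (c.S < ⊤ → Tendsto ξ (toEnd c.S) (𝓝 (x T))) ∧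
    (c.S = ⊤ → (∃ R : ℝ, ∀ s ∈ pseudoTime c.S, ‖ξ s‖ ≤ R) ∧
      ∃ s : ℕ → ℝ, StrictMono s ∧ (∀ j, 0 ≤ s j) ∧ Tendsto s atTop atTop ∧
        Tendsto (fun j => (ξ (s j), c.φ (s j))) atTop (𝓝 (x T, u T)))

/-! ### Simple limit solutions -/

/-- The sequence `(u_k, x_k)` exhibits `x` as a simple limit solution for the control `(u, v)`:
`u_k ∈ AC([0,T], U)`, `u_k(0) = u₀`, `u_k → u` pointwise on `[0,T]`, the Carathéodory solutions
`x_k` for `(u_k, v)` are equibounded, and `x_k → x` pointwise on `[0,T]`. -/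
structure System.IsSimpleApproximation {n m l : ℕ} (sys : System n m l) (x₀ : E n) (u₀ : E m)
    (T : ℝ) (u : ℝ → E m) (v : ℝ → E l) (x : ℝ → E n)
    (uk : ℕ → ℝ → E m) (xk : ℕ → ℝ → E n) : Prop where
  isAC : ∀ k, IsACControl sys.U T (uk k)
  init : ∀ k, uk k 0 = u₀
  tendsto_u : ∀ t ∈ Icc 0 T, Tendsto (fun k => uk k t) atTop (𝓝 (u t))
  isSolution : ∀ k, sys.IsCaratheodorySolution x₀ T (uk k) v (xk k)
  equibounded : ∃ R : ℝ, ∀ k, ∀ t ∈ Icc 0 T, ‖xk k t‖ ≤ R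
  tendsto_x : ∀ t ∈ Icc 0 T, Tendsto (fun k => xk k t) atTop (𝓝 (x t))

/-- Equibounded variation on `[0,t]`, for each `t < T`. -/
def LocallyEquiboundedVariation {m : ℕ} (T : ℝ) (uk : ℕ → ℝ → E m) : Prop :=
  ∀ t ∈ Ioo 0 T, ∃ C : NNReal, ∀ k, eVariationOn (uk k) (Icc 0 t) ≤ C

/-- The endpoint condition: there are a positive decreasing `ε` on `[0,+∞[` vanishing at infinity
and strictly increasing diverging sequences `s_j ≥ 0`, `κ_j ≥ j`, such that for all `k > κ_j` there
is `τ < T` with `τ + Var_{[0,τ]}(u_k) = s_j` and `|(x_k, u_k)(τ) - (x_k, u_k)(T)| ≤ ε(j)`.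
(The variation is finite, the `u_k` being absolutely continuous.) -/
def EndpointCondition {n m : ℕ} (T : ℝ) (uk : ℕ → ℝ → E m) (xk : ℕ → ℝ → E n) : Prop :=
  ∃ (ε : ℝ → ℝ) (s : ℕ → ℝ) (κ : ℕ → ℕ),
    (∀ r, 0 ≤ r → 0 < ε r) ∧ AntitoneOn ε (Ici 0) ∧ Tendsto ε atTop (𝓝 0) ∧
    StrictMono s ∧ (∀ j, 0 ≤ s j) ∧ Tendsto s atTop atTop ∧
    StrictMono κ ∧ (∀ j, j ≤ κ j) ∧
    ∀ j, ∀ k, κ j < k → ∃ τ ∈ Ico 0 T,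
      τ + (eVariationOn (uk k) (Icc 0 τ)).toReal = s j ∧
      pairNorm (xk k τ - xk k T) (uk k τ - uk k T) ≤ ε j

/-- `x` is a BV_loc S limit solution on `[0,T[`. -/
def System.IsBVLocSLimitSolutionOpen {n m l : ℕ} (sys : System n m l) (x₀ : E n) (u₀ : E m)
    (T : ℝ) (u : ℝ → E m) (v : ℝ → E l) (x : ℝ → E n) : Prop :=
  ∃ (uk : ℕ → ℝ → E m) (xk : ℕ → ℝ → E n),
    sys.IsSimpleApproximation x₀ u₀ T u v x uk xk ∧ LocallyEquiboundedVariation T uk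

/-- `x` is a BV_loc S limit solution on `[0,T]`. -/
def System.IsBVLocSLimitSolution {n m l : ℕ} (sys : System n m l) (x₀ : E n) (u₀ : E m)
    (T : ℝ) (u : ℝ → E m) (v : ℝ → E l) (x : ℝ → E n) : Prop :=
  ∃ (uk : ℕ → ℝ → E m) (xk : ℕ → ℝ → E n),
    sys.IsSimpleApproximation x₀ u₀ T u v x uk xk ∧ LocallyEquiboundedVariation T uk ∧
    (∃ R : ℝ, ∀ t ∈ Icc 0 T, ‖x t‖ ≤ R) ∧ EndpointCondition T uk xk

end Impulsive

/-! The controls converge only pointwise, so `u_k'` cannot be passed to the limit, and `v` is merely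
measurable. The proof therefore trades the differential equation for the derivative-free condition
`FollowsOn`: between a and b the state moves by the integral over [θ(a), θ(b)] of the drift with
state and control frozen at a, plus the coupling applied to φ(b) - φ(a), up to a constant times the
squared gauge increment. Solutions satisfy it (`IsField.followsOn_of_integral`), the substitution t
= θ(s) taking care of `v`. It survives reparametrization (`FollowsOn.comp`) and pointwise limits
(`IsField.followsOn_of_tendsto`). For a Lipschitz control it gives back the integral equation
(`IsField.integral_of_followsOn`), since a defect with quadratic increments has zero derivative. All
trajectories involved are bounded, so the fields may be truncated to be globally bounded and
Lipschitz.

From limit solutions to graph completions: each `(u_k, x_k)` is reparametrized by the inverse of its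
gauge t + Var(u_k), which makes the curves (time, control) 1-Lipschitz. A pointwise ultrafilter
limit of these curves solves the space-time system, the limit of the gauges is a clock, and the
endpoint condition supplies pseudo-times along which the limit approaches (x(T), u(T)). Speed may be
lost in the limit; `System.IsLimitCurve.exists_completionWitness` restores it by arc length.

From graph completions to limit solutions: the clock σ is replaced by increasing Lipschitz
interpolants κ_k, eventually exact at each jump of σ, and u_k = φ ∘ κ_k. The curves x_k and ξ ∘ κ_k
follow the same control with uniformly close times, so a discrete Grönwall estimate
(`IsField.norm_sub_le_of_followsOn`) makes them close. Up to a small error the gauge of u_k is κ_k,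
which yields the endpoint condition when S = +∞. If S is finite, the completion is first prolonged
by an endless loop at frozen time T (`System.IsCompletionWitness.exists_infinite`); this is where
the Whitney property and a second point of U enter. -/

namespace Impulsive

/-! ### Calculus of absolutely continuous curves -/

section Calculus

variable {d : ℕ}

theorem ac_comp_of_dist_le {X Y : Type*} [PseudoMetricSpace X] [PseudoMetricSpace Y]
    {f : ℝ → X} {g : ℝ → Y} {a b : ℝ}
    (hf : AbsolutelyContinuousOnInterval f a b) (h : ∀ s t, dist (g s) (g t) ≤ dist (f s) (f t)) :
    AbsolutelyContinuousOnInterval g a b := by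
  refine squeeze_zero (fun E => Finset.sum_nonneg fun i _ => dist_nonneg) (fun E => ?_) hf
  exact Finset.sum_le_sum fun i _ => h _ _

theorem ac_coord {f : ℝ → E d} {a b : ℝ} (hf : AbsolutelyContinuousOnInterval f a b) (i : Fin d) :
    AbsolutelyContinuousOnInterval (fun s => f s i) a b := by
  refine ac_comp_of_dist_le hf fun s t => ?_
  rw [dist_eq_norm, dist_eq_norm]
  exact PiLp.norm_apply_le (f s - f t) i

theorem ac_ae_differentiableAt {f : ℝ → E d} {a b : ℝ}
    (hf : AbsolutelyContinuousOnInterval f a b) :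
    ∀ᵐ s, s ∈ uIcc a b → DifferentiableAt ℝ f s :=
  hf.boundedVariationOn.ae_differentiableAt_of_mem_uIcc

theorem hasDerivAt_coord {f : ℝ → E d} {f' : E d} {s : ℝ} (h : HasDerivAt f f' s) (i : Fin d) :
    HasDerivAt (fun r => f r i) (f' i) s :=
  ((EuclideanSpace.proj i : E d →L[ℝ] ℝ).hasFDerivAt.comp_hasDerivAt s h)

theorem intervalIntegrable_of_coord {f : ℝ → E d} {a b : ℝ}
    (h : ∀ i, IntervalIntegrable (fun s => f s i) volume a b) :
    IntervalIntegrable f volume a b := by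
  have : f = fun s => ∑ i, (f s i) • (EuclideanSpace.single i (1 : ℝ) : E d) := by
    funext s
    ext j
    simp [Finset.sum_apply, Pi.single_apply]
  rw [this]
  have h2 : ∀ i ∈ (Finset.univ : Finset (Fin d)), IntervalIntegrable
      (fun s => (f s i) • (EuclideanSpace.single i (1 : ℝ) : E d)) volume a b :=
    fun i _ => ⟨(h i).1.smul_const _, (h i).2.smul_const _⟩
  simpa [Finset.sum_fn] using IntervalIntegrable.sum _ h2

theorem ac_intervalIntegrable_deriv {f : ℝ → E d} {a b : ℝ}
    (hf : AbsolutelyContinuousOnInterval f a b) : IntervalIntegrable (deriv f) volume a b := by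
  refine intervalIntegrable_of_coord fun i => ?_
  refine (ac_coord hf i).intervalIntegrable_deriv.congr_ae ?_
  rw [Filter.EventuallyEq, ae_restrict_iff' measurableSet_uIoc]
  filter_upwards [ac_ae_differentiableAt hf] with s hs hs'
  exact (hasDerivAt_coord (hs (uIoc_subset_uIcc hs')).hasDerivAt i).deriv

theorem integral_coord {f : ℝ → E d} {a b : ℝ} (h : IntervalIntegrable f volume a b) (i : Fin d) :
    (∫ s in a..b, f s) i = ∫ s in a..b, f s i :=
  ((EuclideanSpace.proj i : E d →L[ℝ] ℝ).intervalIntegral_comp_comm h).symm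

/-- The scalar fundamental theorem of calculus is applied to each coordinate; almost everywhere the
derivative of a coordinate is the coordinate of the derivative. -/
theorem ac_integral_deriv {f : ℝ → E d} {a b : ℝ}
    (hf : AbsolutelyContinuousOnInterval f a b) : ∫ s in a..b, deriv f s = f b - f a := by
  ext i
  rw [integral_coord (ac_intervalIntegrable_deriv hf), PiLp.sub_apply,
    ← (ac_coord hf i).integral_deriv_eq_sub]
  refine intervalIntegral.integral_congr_ae ?_
  filter_upwards [ac_ae_differentiableAt hf] with s hs hs'
  exact (hasDerivAt_coord (hs (uIoc_subset_uIcc hs')).hasDerivAt i).deriv.symm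

/-- The variation of an absolutely continuous curve is at most the integral of its speed. -/
theorem ac_eVariationOn_le {f : ℝ → E d} {a b : ℝ} (hab : a ≤ b)
    (hf : AbsolutelyContinuousOnInterval f a b) :
    eVariationOn f (Icc a b) ≤ ENNReal.ofReal (∫ s in a..b, ‖deriv f s‖) := by
  have hint := (ac_intervalIntegrable_deriv hf).norm
  have hsub : ∀ x ∈ Icc a b, ∀ y ∈ Icc a b, uIcc x y ⊆ uIcc a b := fun x hx y hy => by
    rw [uIcc_of_le hab]; exact uIcc_subset_Icc hx hy
  have key : ∀ x ∈ Icc a b, ∀ y ∈ Icc a b, x ≤ y →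
      dist (f x) (f y) ≤ (∫ s in a..y, ‖deriv f s‖) - ∫ s in a..x, ‖deriv f s‖ := by
    intro x hx y hy hxy
    rw [intervalIntegral.integral_interval_sub_left
      (hint.mono_set (hsub a ⟨le_rfl, hab⟩ y hy)) (hint.mono_set (hsub a ⟨le_rfl, hab⟩ x hx)),
      dist_comm, dist_eq_norm, ← ac_integral_deriv (hf.mono (hsub x hx y hy))]
    exact intervalIntegral.norm_integral_le_integral_norm hxy
  refine iSup_le ?_
  rintro ⟨n, w, hw, hmem⟩
  simp only
  have h0 : ∀ i, edist (f (w (i + 1))) (f (w i)) = ENNReal.ofReal (dist (f (w i)) (f (w (i + 1)))) :=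
    fun i => by rw [edist_dist, dist_comm]
  simp only [h0]
  rw [← ENNReal.ofReal_sum_of_nonneg fun i _ => dist_nonneg]
  refine ENNReal.ofReal_le_ofReal ?_
  calc ∑ i ∈ Finset.range n, dist (f (w i)) (f (w (i + 1)))
      ≤ ∑ i ∈ Finset.range n, ((∫ s in a..w (i + 1), ‖deriv f s‖) - ∫ s in a..w i, ‖deriv f s‖) :=
        Finset.sum_le_sum fun i _ => key _ (hmem i) _ (hmem (i + 1)) (hw (Nat.le_succ i))
    _ = (∫ s in a..w n, ‖deriv f s‖) - ∫ s in a..w 0, ‖deriv f s‖ :=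
        Finset.sum_range_sub (fun i => ∫ s in a..w i, ‖deriv f s‖) n
    _ ≤ ∫ s in a..b, ‖deriv f s‖ := by
        have h1 : 0 ≤ ∫ s in a..w 0, ‖deriv f s‖ :=
          intervalIntegral.integral_nonneg (hmem 0).1 fun _ _ => norm_nonneg _
        have h2 : ∫ s in a..w n, ‖deriv f s‖ ≤ ∫ s in a..b, ‖deriv f s‖ :=
          intervalIntegral.integral_mono_interval le_rfl (hmem n).1 (hmem n).2
            (Eventually.of_forall fun _ => norm_nonneg _) hint
        linarith

/-- The variation function V dominates the increments of f, so its derivative dominates the speed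
almost everywhere; and the integral of the derivative of a monotone function never exceeds its
increment. -/
theorem ac_le_eVariationOn {f : ℝ → E d} {a b : ℝ} (hab : a ≤ b)
    (hf : AbsolutelyContinuousOnInterval f a b) :
    ∫ s in a..b, ‖deriv f s‖ ≤ (eVariationOn f (Icc a b)).toReal := by
  have hbv : BoundedVariationOn f (Icc a b) := by
    simpa [uIcc_of_le hab] using hf.boundedVariationOn
  set V : ℝ → ℝ := variationOnFromTo f (Icc a b) a with hV
  have hmono : MonotoneOn V (Icc a b) :=
    variationOnFromTo.monotoneOn hbv.locallyBoundedVariationOn ⟨le_rfl, hab⟩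
  have hVb : V b - V a = (eVariationOn f (Icc a b)).toReal := by
    rw [hV, variationOnFromTo.self, variationOnFromTo.eq_of_le _ _ hab]
    simp
  have hm : MonotoneOn V (uIcc a b) := by rwa [uIcc_of_le hab]
  have h1 := hm.intervalIntegral_deriv_mem_uIcc
  have hVab : V a ≤ V b := hmono ⟨le_rfl, hab⟩ ⟨hab, le_rfl⟩ hab
  rw [uIcc_of_le (by linarith)] at h1
  rw [← hVb]
  refine le_trans ?_ h1.2
  refine intervalIntegral.integral_mono_ae_restrict hab (ac_intervalIntegrable_deriv hf).norm
    hm.intervalIntegrable_deriv ?_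
  have hd : ∀ᵐ s, s ∈ uIcc a b → DifferentiableAt ℝ V s := by
    have : BoundedVariationOn V (uIcc a b) := by
      rw [uIcc_of_le hab]
      refine hmono.boundedVariationOn (C := max |V a| |V b|) fun x hx => ?_
      exact abs_le_max_abs_abs (hmono ⟨le_rfl, hab⟩ hx hx.1) (hmono hx ⟨hab, le_rfl⟩ hx.2)
    exact this.ae_differentiableAt_of_mem_uIcc
  rw [Filter.EventuallyLE, ae_restrict_iff' measurableSet_Icc]
  have ha : ∀ᵐ s : ℝ, s ≠ a := by simp [ae_iff, measure_singleton]
  have hb : ∀ᵐ s : ℝ, s ≠ b := by simp [ae_iff, measure_singleton]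
  filter_upwards [hd, ac_ae_differentiableAt hf, ha, hb] with s hs1 hs2 hsa hsb hs
  have hs' : s ∈ uIcc a b := by rwa [uIcc_of_le hab]
  have hso : s < b := lt_of_le_of_ne hs.2 hsb
  have hfd := (hs2 hs').hasDerivAt.tendsto_slope.mono_left (nhdsGT_le_nhdsNE s)
  have hVd := (hs1 hs').hasDerivAt.tendsto_slope.mono_left (nhdsGT_le_nhdsNE s)
  refine le_of_tendsto_of_tendsto hfd.norm hVd ?_
  filter_upwards [Ioo_mem_nhdsGT hso] with r hr
  have hr' : r ∈ Icc a b := ⟨hs.1.trans hr.1.le, hr.2.le⟩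
  rw [slope_def_module, slope_def_field, norm_smul, norm_inv, Real.norm_eq_abs,
    abs_of_pos (sub_pos.2 hr.1), div_eq_inv_mul]
  refine mul_le_mul_of_nonneg_left ?_ (inv_nonneg.2 (sub_pos.2 hr.1).le)
  have h2 : V r - V s = (eVariationOn f (Icc a b ∩ Icc s r)).toReal := by
    have h3 := variationOnFromTo.add hbv.locallyBoundedVariationOn (a := a) (b := s) (c := r)
      ⟨le_rfl, hab⟩ hs hr'
    rw [hV, ← h3, variationOnFromTo.eq_of_le _ _ hr.1.le]
    ring
  rw [h2, ← dist_eq_norm]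
  exact (hbv.mono inter_subset_left).dist_le ⟨hr', hr.1.le, le_rfl⟩ ⟨hs, le_rfl, hr.1.le⟩

theorem ac_eVariationOn_eq {f : ℝ → E d} {a b : ℝ} (hab : a ≤ b)
    (hf : AbsolutelyContinuousOnInterval f a b) :
    (eVariationOn f (Icc a b)).toReal = ∫ s in a..b, ‖deriv f s‖ :=
  le_antisymm (ENNReal.toReal_le_of_le_ofReal
    (intervalIntegral.integral_nonneg hab fun _ _ => norm_nonneg _) (ac_eVariationOn_le hab hf))
    (ac_le_eVariationOn hab hf)

theorem lipschitz_ac {X : Type*} [PseudoMetricSpace X] {f : ℝ → X} {K : NNReal}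
    (hf : LipschitzWith K f) (a b : ℝ) : AbsolutelyContinuousOnInterval f a b :=
  (hf.lipschitzOnWith).absolutelyContinuousOnInterval

theorem volume_image_eq_zero_of_lipschitz {θ : ℝ → ℝ} {K : NNReal} (hL : LipschitzWith K θ)
    {s : Set ℝ} (hs : volume s = 0) : volume (θ '' s) = 0 := by
  have := (hL.lipschitzOnWith (s := s)).hausdorffMeasure_image_le (d := 1) zero_le_one
  rw [hausdorffMeasure_real, hs, mul_zero] at this
  exact le_antisymm this zero_le

/-- Change of variables along a monotone Lipschitz function. -/
theorem integral_deriv_smul_comp {F : Type*} [NormedAddCommGroup F] [NormedSpace ℝ F]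
    {θ : ℝ → ℝ} {K : NNReal} (hm : Monotone θ) (hL : LipschitzWith K θ) (g : ℝ → F) (a b : ℝ) :
    ∫ s in a..b, deriv θ s • g (θ s) = ∫ t in θ a..θ b, g t := by
  wlog hab : a ≤ b generalizing a b
  · rw [intervalIntegral.integral_symm, this b a (by linarith), ← intervalIntegral.integral_symm]
  rw [intervalIntegral.integral_of_le hab, intervalIntegral.integral_of_le (hm hab),
    ← integral_Icc_eq_integral_Ioc, ← integral_Icc_eq_integral_Ioc]
  -- The area formula needs differentiability at every point of the set. Discarding the null set
  -- `Dᶜ` is harmless on both sides, as its image under the Lipschitz map θ is null too.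
  set D : Set ℝ := {s | DifferentiableAt ℝ θ s} with hD
  have hDm : MeasurableSet D := measurableSet_of_differentiableAt ℝ θ
  have hDn : volume (Dᶜ) = 0 := by
    have := hL.ae_differentiableAt_real
    rwa [ae_iff] at this
  have h1 : ∫ s in Icc a b, deriv θ s • g (θ s) = ∫ s in Icc a b ∩ D, deriv θ s • g (θ s) := by
    refine setIntegral_congr_set ?_
    refine (inter_ae_eq_left_of_ae_eq_univ ?_).symm
    exact ae_eq_univ.2 hDn
  have h2 : ∫ t in Icc (θ a) (θ b), g t = ∫ t in θ '' (Icc a b ∩ D), g t := by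
    refine setIntegral_congr_set ?_
    refine ae_eq_set.2 ⟨?_, ?_⟩
    · refine measure_mono_null ?_ (volume_image_eq_zero_of_lipschitz hL hDn)
      rw [← hL.continuous.continuousOn.image_Icc_of_monotoneOn hab (hm.monotoneOn _)]
      rintro _ ⟨⟨s, hs, rfl⟩, hn⟩
      exact ⟨s, fun hsD => hn ⟨s, ⟨hs, hsD⟩, rfl⟩, rfl⟩
    · rw [sdiff_eq_empty.2, measure_empty]
      rintro _ ⟨s, hs, rfl⟩
      exact ⟨hm hs.1.1, hm hs.1.2⟩
  rw [h1, h2]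
  exact (integral_image_eq_integral_deriv_smul_of_monotoneOn (measurableSet_Icc.inter hDm)
    (fun s hs => hs.2.hasDerivAt.hasDerivWithinAt) (hm.monotoneOn _) g).symm

/-- A fibre of a monotone function is order connected, hence its interior up to a null set, and on
the interior the function is locally constant. It serves to ignore the plateaus of `φ₀`. -/
theorem ae_deriv_eq_zero_of_mem_countable {θ : ℝ → ℝ} (hm : Monotone θ) {N : Set ℝ}
    (hN : N.Countable) : ∀ᵐ s, θ s ∈ N → deriv θ s = 0 := by
  have h : ∀ t ∈ N, ∀ᵐ s, θ s = t → deriv θ s = 0 := by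
    intro t _
    have hoc : (θ ⁻¹' {t}).OrdConnected := ordConnected_singleton.preimage_mono hm
    have hnull : volume (θ ⁻¹' {t} \ interior (θ ⁻¹' {t})) = 0 :=
      measure_mono_null (sdiff_subset_sdiff_left subset_closure) (hoc.convex.addHaar_frontier volume)
    filter_upwards [measure_eq_zero_iff_ae_notMem.1 hnull] with s hs hst
    have hsi : s ∈ interior (θ ⁻¹' {t}) := by
      by_contra hc
      exact hs ⟨hst, hc⟩
    have : θ =ᶠ[𝓝 s] fun _ => t := by
      filter_upwards [mem_interior_iff_mem_nhds.1 hsi] with r hr using hr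
    rw [this.deriv_eq, deriv_const]
  have := (ae_ball_iff hN).2 h
  filter_upwards [this] with s hs hsN using hs _ hsN rfl

theorem norm_deriv_le_of_dist_le {F : Type*} [NormedAddCommGroup F] [NormedSpace ℝ F]
    {f : ℝ → F} {C : ℝ} (hC : 0 ≤ C) (h : ∀ a b, ‖f a - f b‖ ≤ C * |a - b|) (s : ℝ) :
    ‖deriv f s‖ ≤ C := by
  refine norm_deriv_le_of_lip' hC (Eventually.of_forall fun r => ?_)
  simpa [Real.norm_eq_abs] using h r s

theorem lipschitzWith_of_norm_sub_le {F : Type*} [NormedAddCommGroup F]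
    {f : ℝ → F} {C : ℝ} (hC : 0 ≤ C) (h : ∀ a b, ‖f a - f b‖ ≤ C * |a - b|) :
    LipschitzWith ⟨C, hC⟩ f := by
  refine LipschitzWith.of_dist_le_mul fun a b => ?_
  rw [dist_eq_norm, Real.dist_eq]
  exact h a b

end Calculus

/-! ### Bounded Lipschitz fields and curves following a control -/

section Field

variable {n m : ℕ}

/-- A drift `f` and a control-linear term `G` that are bounded, Lipschitz in the state and the
control, and measurable along continuous curves. -/
structure IsField (U : Set (E m)) (f : E n → E m → ℝ → E n) (G : E n → E m → E m →L[ℝ] E n)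
    (B K : ℝ) : Prop where
  nonneg_B : 0 ≤ B
  nonneg_K : 0 ≤ K
  norm_f : ∀ x, ∀ u ∈ U, ∀ t, ‖f x u t‖ ≤ B
  norm_G : ∀ x, ∀ u ∈ U, ∀ w, ‖G x u w‖ ≤ B * ‖w‖
  lip_f : ∀ x y, ∀ u ∈ U, ∀ w ∈ U, ∀ t, ‖f x u t - f y w t‖ ≤ K * (‖x - y‖ + ‖u - w‖)
  lip_G : ∀ x y, ∀ u ∈ U, ∀ w ∈ U, ∀ z,
    ‖G x u z - G y w z‖ ≤ K * (‖x - y‖ + ‖u - w‖) * ‖z‖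
  -- Measurability is required only along curves with values in U, because the fields are arbitrary
  -- for controls outside U.
  meas_f : ∀ (ξ : ℝ → E n) (φ : ℝ → E m) (θ : ℝ → ℝ), Continuous ξ → Continuous φ →
    (∀ s, φ s ∈ U) → Measurable θ → Measurable fun s => f (ξ s) (φ s) (θ s)
  meas_G : ∀ (ξ : ℝ → E n) (φ w : ℝ → E m), Continuous ξ → Continuous φ →
    (∀ s, φ s ∈ U) → Measurable w → Measurable fun s => G (ξ s) (φ s) (w s)

/-- The increment over `[a,b]` predicted from the state `x` at `a`. -/
noncomputable def increment (f : E n → E m → ℝ → E n) (G : E n → E m → E m →L[ℝ] E n)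
    (θ : ℝ → ℝ) (φ : ℝ → E m) (x : E n) (a b : ℝ) : E n :=
  (∫ t in θ a..θ b, f x (φ a) t) + G x (φ a) (φ b - φ a)

/-- The right-hand side of the space-time system. -/
noncomputable def velocity (f : E n → E m → ℝ → E n) (G : E n → E m → E m →L[ℝ] E n)
    (θ : ℝ → ℝ) (φ : ℝ → E m) (ξ : ℝ → E n) (s : ℝ) : E n :=
  deriv θ s • f (ξ s) (φ s) (θ s) + G (ξ s) (φ s) (deriv φ s)

/-- The increments of `ξ` are the predicted ones, up to an error quadratic in the gauge `ℓ`. -/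
def FollowsOn (f : E n → E m → ℝ → E n) (G : E n → E m → E m →L[ℝ] E n) (I : Set ℝ)
    (θ : ℝ → ℝ) (φ : ℝ → E m) (ξ : ℝ → E n) (ℓ : ℝ → ℝ) (C : ℝ) : Prop :=
  ∀ a ∈ I, ∀ b ∈ I, ‖ξ b - ξ a - increment f G θ φ (ξ a) a b‖ ≤ C * (ℓ b - ℓ a) ^ 2

variable {U : Set (E m)} {f : E n → E m → ℝ → E n} {G : E n → E m → E m →L[ℝ] E n} {B K : ℝ}

theorem IsField.intervalIntegrable_f (hF : IsField U f G B K) (x : E n) {u : E m} (hu : u ∈ U)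
    (a b : ℝ) : IntervalIntegrable (fun t => f x u t) volume a b := by
  have hm : Measurable fun t => f x u t :=
    hF.meas_f (fun _ => x) (fun _ => u) id continuous_const continuous_const (fun _ => hu)
      measurable_id
  refine IntervalIntegrable.mono_fun' (g := fun _ => B) intervalIntegrable_const
    hm.aestronglyMeasurable (Eventually.of_forall fun t => hF.norm_f x u hu t)

theorem IsField.norm_integral_f_le (hF : IsField U f G B K) (x : E n) {u : E m} (hu : u ∈ U)
    (a b : ℝ) : ‖∫ t in a..b, f x u t‖ ≤ B * |b - a| :=
  intervalIntegral.norm_integral_le_of_norm_le_const fun t _ => hF.norm_f x u hu t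

theorem IsField.norm_increment_le (hF : IsField U f G B K) {θ : ℝ → ℝ} {φ : ℝ → E m}
    (x : E n) {a : ℝ} (ha : φ a ∈ U) (b : ℝ) :
    ‖increment f G θ φ x a b‖ ≤ B * (|θ b - θ a| + ‖φ b - φ a‖) := by
  rw [mul_add]
  exact (norm_add_le _ _).trans
    (add_le_add (hF.norm_integral_f_le x ha _ _) (hF.norm_G x _ ha _))

/-- Dependence of the drift integral on all its data. -/
theorem IsField.norm_integral_f_sub_le (hF : IsField U f G B K) (x y : E n) {u w : E m}
    (hu : u ∈ U) (hw : w ∈ U) (a b c d : ℝ) :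
    ‖(∫ t in a..b, f x u t) - ∫ t in c..d, f y w t‖
      ≤ K * (‖x - y‖ + ‖u - w‖) * |b - a| + B * (|a - c| + |b - d|) := by
  have h1 : (∫ t in a..b, f x u t) - ∫ t in c..d, f y w t
      = (∫ t in a..b, (f x u t - f y w t)) + ((∫ t in a..c, f y w t) - ∫ t in b..d, f y w t) := by
    have i := hF.intervalIntegrable_f y hw
    rw [intervalIntegral.integral_sub (hF.intervalIntegrable_f x hu a b) (i a b)]
    have e1 := intervalIntegral.integral_add_adjacent_intervals (i a b) (i b d)
    have e2 := intervalIntegral.integral_add_adjacent_intervals (i a c) (i c d)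
    rw [← e1] at e2
    rw [sub_add_eq_add_sub, sub_eq_sub_iff_add_eq_add]
    have e3 : (∫ t in a..c, f y w t) = (∫ t in a..b, f y w t) + (∫ t in b..d, f y w t)
        - ∫ t in c..d, f y w t := by rw [← e2]; abel
    rw [e3]; abel
  rw [h1]
  refine (norm_add_le _ _).trans (add_le_add ?_ ((norm_sub_le _ _).trans ?_))
  · exact intervalIntegral.norm_integral_le_of_norm_le_const fun t _ => hF.lip_f x y u hu w hw t
  · rw [mul_add]
    have h2 := hF.norm_integral_f_le y hw a c
    have h3 := hF.norm_integral_f_le y hw b d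
    rw [abs_sub_comm a c, abs_sub_comm b d]
    linarith

theorem IsField.norm_G_sub_le (hF : IsField U f G B K) (x y : E n) {u w : E m}
    (hu : u ∈ U) (hw : w ∈ U) (z z' : E m) :
    ‖G x u z - G y w z'‖ ≤ K * (‖x - y‖ + ‖u - w‖) * ‖z‖ + B * ‖z - z'‖ := by
  have : G x u z - G y w z' = (G x u z - G y w z) + G y w (z - z') := by
    rw [map_sub]; abel
  rw [this]
  exact (norm_add_le _ _).trans
    (add_le_add (hF.lip_G x y u hu w hw z) (hF.norm_G y w hw _))

theorem IsField.measurable_velocity (hF : IsField U f G B K) {θ : ℝ → ℝ} {φ : ℝ → E m}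
    {ξ : ℝ → E n} (hθ : Measurable θ) (hφ : Continuous φ) (hφU : ∀ s, φ s ∈ U)
    (hξ : Continuous ξ) : Measurable (velocity f G θ φ ξ) :=
  ((measurable_deriv θ).smul (hF.meas_f ξ φ θ hξ hφ hφU hθ)).add
    (hF.meas_G ξ φ _ hξ hφ hφU (measurable_deriv φ))

theorem IsField.norm_velocity_le (hF : IsField U f G B K) {θ : ℝ → ℝ} {φ : ℝ → E m}
    {ξ : ℝ → E n} {s : ℝ} (hφU : φ s ∈ U) :
    ‖velocity f G θ φ ξ s‖ ≤ B * (|deriv θ s| + ‖deriv φ s‖) := by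
  rw [mul_add]
  refine (norm_add_le _ _).trans (add_le_add ?_ (hF.norm_G _ _ hφU _))
  rw [norm_smul, Real.norm_eq_abs, mul_comm]
  exact mul_le_mul_of_nonneg_right (hF.norm_f _ _ hφU _) (abs_nonneg _)

theorem intervalIntegrable_deriv_lipschitz {θ : ℝ → ℝ} {Kθ : NNReal}
    (hL : LipschitzWith Kθ θ) (a b : ℝ) : IntervalIntegrable (deriv θ) volume a b :=
  (lipschitz_ac hL a b).intervalIntegrable_deriv

theorem IsField.intervalIntegrable_velocity (hF : IsField U f G B K) {θ : ℝ → ℝ} {φ : ℝ → E m}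
    {ξ : ℝ → E n} {Kθ : NNReal} (hL : LipschitzWith Kθ θ) (hφ : Continuous φ)
    (hφU : ∀ s, φ s ∈ U) (hξ : Continuous ξ) {a b : ℝ}
    (hac : AbsolutelyContinuousOnInterval φ a b) :
    IntervalIntegrable (velocity f G θ φ ξ) volume a b := by
  refine IntervalIntegrable.mono_fun' (g := fun s => B * (|deriv θ s| + ‖deriv φ s‖))
    (((intervalIntegrable_deriv_lipschitz hL a b).abs.add
      (ac_intervalIntegrable_deriv hac).norm).const_mul B)
    (hF.measurable_velocity hL.continuous.measurable hφ hφU hξ).aestronglyMeasurable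
    (Eventually.of_forall fun s => hF.norm_velocity_le (hφU s))

/-- The integral of the velocity is close to the predicted increment. -/
theorem IsField.norm_integral_velocity_sub_increment_le (hF : IsField U f G B K) {θ : ℝ → ℝ}
    {φ : ℝ → E m} {ξ : ℝ → E n} {Kθ : NNReal} (hm : Monotone θ) (hL : LipschitzWith Kθ θ)
    (hφ : Continuous φ) (hφU : ∀ s, φ s ∈ U) (hξ : Continuous ξ) {a b : ℝ}
    (hac : AbsolutelyContinuousOnInterval φ a b) {L M : ℝ}
    (hbd : ∀ s ∈ uIcc a b, ‖ξ s - ξ a‖ + ‖φ s - φ a‖ ≤ L)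
    (hM : |∫ s in a..b, (|deriv θ s| + ‖deriv φ s‖)| ≤ M) :
    ‖(∫ s in a..b, velocity f G θ φ ξ s) - increment f G θ φ (ξ a) a b‖ ≤ K * L * M := by
  have hiθ := (intervalIntegrable_deriv_lipschitz hL a b)
  have hiφ := ac_intervalIntegrable_deriv hac
  have hL0 : 0 ≤ L := le_trans (by positivity) (hbd a left_mem_uIcc)
  -- State and control are frozen at a while time keeps running: no continuity in time is available,
  -- but the change of variables θ(s) = t evaluates this part exactly.
  set c : ℝ → E n := fun s => deriv θ s • f (ξ a) (φ a) (θ s)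
  set e : ℝ → E n := fun s => G (ξ a) (φ a) (deriv φ s)
  have hc : IntervalIntegrable c volume a b := by
    refine IntervalIntegrable.mono_fun' (g := fun s => B * |deriv θ s|) (hiθ.abs.const_mul B)
      ((measurable_deriv θ).smul (hF.meas_f (fun _ => ξ a) (fun _ => φ a) θ continuous_const
        continuous_const (fun _ => hφU a) hL.continuous.measurable)).aestronglyMeasurable
      (Eventually.of_forall fun s => ?_)
    simp only [c, norm_smul, Real.norm_eq_abs]
    rw [mul_comm]
    exact mul_le_mul_of_nonneg_right (hF.norm_f _ _ (hφU a) _) (abs_nonneg _)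
  have he : IntervalIntegrable e volume a b :=
    ⟨(G (ξ a) (φ a)).integrable_comp hiφ.1, (G (ξ a) (φ a)).integrable_comp hiφ.2⟩
  have hincr : increment f G θ φ (ξ a) a b = ∫ s in a..b, (c s + e s) := by
    rw [intervalIntegral.integral_add hc he, increment,
      integral_deriv_smul_comp hm hL (fun t => f (ξ a) (φ a) t) a b,
      ContinuousLinearMap.intervalIntegral_comp_comm _ hiφ, ac_integral_deriv hac]
  rw [hincr, ← intervalIntegral.integral_sub
    (hF.intervalIntegrable_velocity hL hφ hφU hξ hac) (hc.add he)]
  have hI : IntervalIntegrable (fun s => |deriv θ s| + ‖deriv φ s‖) volume a b :=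
    hiθ.abs.add hiφ.norm
  calc ‖∫ s in a..b, (velocity f G θ φ ξ s - (c s + e s))‖
      ≤ |∫ s in a..b, K * L * (|deriv θ s| + ‖deriv φ s‖)| := by
        refine intervalIntegral.norm_integral_le_abs_of_norm_le ?_ (hI.const_mul _)
        refine (ae_restrict_iff' measurableSet_uIoc).2 (Eventually.of_forall fun s hs => ?_)
        have hs' := hbd s (uIoc_subset_uIcc hs)
        have e1 : velocity f G θ φ ξ s - (c s + e s)
            = deriv θ s • (f (ξ s) (φ s) (θ s) - f (ξ a) (φ a) (θ s))
              + (G (ξ s) (φ s) (deriv φ s) - G (ξ a) (φ a) (deriv φ s)) := by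
          simp only [velocity, c, e, smul_sub]; abel
        rw [e1, mul_add]
        have hKL : K * (‖ξ s - ξ a‖ + ‖φ s - φ a‖) ≤ K * L :=
          mul_le_mul_of_nonneg_left hs' hF.nonneg_K
        refine (norm_add_le _ _).trans (add_le_add ?_ ?_)
        · rw [norm_smul, Real.norm_eq_abs, mul_comm]
          exact mul_le_mul_of_nonneg_right
            ((hF.lip_f _ _ _ (hφU s) _ (hφU a) _).trans hKL) (abs_nonneg _)
        · exact (hF.lip_G _ _ _ (hφU s) _ (hφU a) _).trans
            (mul_le_mul_of_nonneg_right hKL (norm_nonneg _))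
    _ = K * L * |∫ s in a..b, (|deriv θ s| + ‖deriv φ s‖)| := by
        rw [intervalIntegral.integral_const_mul, abs_mul,
          abs_of_nonneg (mul_nonneg hF.nonneg_K hL0)]
    _ ≤ K * L * M := mul_le_mul_of_nonneg_left hM (mul_nonneg hF.nonneg_K hL0)

/-- Solutions of the space-time system follow the control. -/
theorem IsField.followsOn_of_integral (hF : IsField U f G B K) {θ : ℝ → ℝ}
    {φ : ℝ → E m} {ξ ℓ : ℝ → _} {Kθ : NNReal} (hm : Monotone θ) (hL : LipschitzWith Kθ θ)
    (hφ : Continuous φ) (hφU : ∀ s, φ s ∈ U) (hξ : Continuous ξ) {I : Set ℝ}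
    (hI : I.OrdConnected)
    (hac : ∀ a ∈ I, ∀ b ∈ I, AbsolutelyContinuousOnInterval φ a b)
    (hint : ∀ a ∈ I, ∀ b ∈ I, ξ b - ξ a = ∫ s in a..b, velocity f G θ φ ξ s)
    (hℓ : ∀ a ∈ I, ∀ b ∈ I, a ≤ b → ∫ s in a..b, (|deriv θ s| + ‖deriv φ s‖) ≤ ℓ b - ℓ a) :
    FollowsOn f G I θ φ ξ ℓ (K * (B + 1)) := by
  have habs : ∀ a ∈ I, ∀ b ∈ I, |∫ s in a..b, (|deriv θ s| + ‖deriv φ s‖)| ≤ |ℓ b - ℓ a| := by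
    intro a ha b hb
    rcases le_total a b with h | h
    · rw [abs_of_nonneg (intervalIntegral.integral_nonneg h fun _ _ => by positivity)]
      exact (hℓ a ha b hb h).trans (le_abs_self _)
    · rw [intervalIntegral.integral_symm, abs_neg,
        abs_of_nonneg (intervalIntegral.integral_nonneg h fun _ _ => by positivity), abs_sub_comm]
      exact (hℓ b hb a ha h).trans (le_abs_self _)
  have hmono : ∀ a ∈ I, ∀ b ∈ I, a ≤ b → ℓ a ≤ ℓ b := fun a ha b hb h => by
    have h1 : 0 ≤ ∫ s in a..b, (|deriv θ s| + ‖deriv φ s‖) :=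
      intervalIntegral.integral_nonneg h fun _ _ => by positivity
    linarith [hℓ a ha b hb h]
  have hinc : ∀ a ∈ I, ∀ s ∈ I, ‖ξ s - ξ a‖ + ‖φ s - φ a‖ ≤ (B + 1) * |ℓ s - ℓ a| := by
    intro a ha s hs
    have hac' := hac a ha s hs
    have hiθ := (intervalIntegrable_deriv_lipschitz hL a s).abs
    have hiφ := (ac_intervalIntegrable_deriv hac').norm
    have h1 : ‖ξ s - ξ a‖ ≤ B * |ℓ s - ℓ a| := by
      rw [hint a ha s hs]
      refine (intervalIntegral.norm_integral_le_abs_of_norm_le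
        (Eventually.of_forall fun r => hF.norm_velocity_le (hφU r))
        ((hiθ.add hiφ).const_mul B)).trans ?_
      rw [intervalIntegral.integral_const_mul, abs_mul, abs_of_nonneg hF.nonneg_B]
      exact mul_le_mul_of_nonneg_left (habs a ha s hs) hF.nonneg_B
    have h2 : ‖φ s - φ a‖ ≤ |ℓ s - ℓ a| := by
      rw [← ac_integral_deriv hac']
      refine (intervalIntegral.norm_integral_le_abs_of_norm_le (Eventually.of_forall fun r => ?_)
        (hiθ.add hiφ)).trans (habs a ha s hs)
      simp
    linarith
  intro a ha b hb
  rw [hint a ha b hb]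
  refine (hF.norm_integral_velocity_sub_increment_le (L := (B + 1) * |ℓ b - ℓ a|) hm hL hφ hφU hξ
    (hac a ha b hb) (fun s hs => ?_) (habs a ha b hb)).trans (le_of_eq ?_)
  · have hsI : s ∈ I := hI.uIcc_subset ha hb hs
    refine (hinc a ha s hsI).trans
      (mul_le_mul_of_nonneg_left ?_ (by linarith [hF.nonneg_B]))
    rcases le_total a b with h | h
    · rw [uIcc_of_le h] at hs
      have := hmono a ha s hsI hs.1
      have := hmono s hsI b hb hs.2
      rw [abs_of_nonneg, abs_of_nonneg] <;> linarith
    · rw [uIcc_of_ge h] at hs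
      have := hmono b hb s hsI hs.1
      have := hmono s hsI a ha hs.2
      rw [abs_of_nonpos, abs_of_nonpos] <;> linarith
  · rw [← sq_abs (ℓ b - ℓ a)]; ring

theorem FollowsOn.comp {I J : Set ℝ} {θ : ℝ → ℝ} {φ : ℝ → E m} {ξ : ℝ → E n} {ℓ ℓ' : ℝ → ℝ}
    {C : ℝ} (h : FollowsOn f G I θ φ ξ ℓ C) (hC : 0 ≤ C) {τ : ℝ → ℝ} (hτ : ∀ s ∈ J, τ s ∈ I)
    (hℓ : ∀ a ∈ J, ∀ b ∈ J, |ℓ (τ b) - ℓ (τ a)| ≤ |ℓ' b - ℓ' a|) :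
    FollowsOn f G J (fun s => θ (τ s)) (fun s => φ (τ s)) (fun s => ξ (τ s)) ℓ' C := by
  intro a ha b hb
  exact (h (τ a) (hτ a ha) (τ b) (hτ b hb)).trans
    (mul_le_mul_of_nonneg_left (sq_le_sq.2 (hℓ a ha b hb)) hC)

/-- Pointwise limits of curves following controls follow the limit control. -/
theorem IsField.followsOn_of_tendsto (hF : IsField U f G B K) {ι : Type*} {F : Filter ι} [F.NeBot]
    {I : Set ℝ} {θk : ι → ℝ → ℝ} {φk : ι → ℝ → E m} {ξk : ι → ℝ → E n} {θ : ℝ → ℝ} {φ : ℝ → E m}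
    {ξ : ℝ → E n} {ℓ : ℝ → ℝ} {C : ℝ}
    (hθ : ∀ s ∈ I, Tendsto (fun k => θk k s) F (𝓝 (θ s)))
    (hφ : ∀ s ∈ I, Tendsto (fun k => φk k s) F (𝓝 (φ s)))
    (hξ : ∀ s ∈ I, Tendsto (fun k => ξk k s) F (𝓝 (ξ s)))
    (hφkU : ∀ k, ∀ s ∈ I, φk k s ∈ U) (hφU : ∀ s ∈ I, φ s ∈ U)
    (h : ∀ k, FollowsOn f G I (θk k) (φk k) (ξk k) ℓ C) : FollowsOn f G I θ φ ξ ℓ C := by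
  intro a ha b hb
  -- The predicted increment involves only the values of the curves at a and b, so pointwise
  -- convergence there is enough; no derivative has to converge.
  have hlim : Tendsto (fun k => increment f G (θk k) (φk k) (ξk k a) a b) F
      (𝓝 (increment f G θ φ (ξ a) a b)) := by
    have z1 : Tendsto (fun k => ‖ξk k a - ξ a‖) F (𝓝 0) :=
      tendsto_iff_norm_sub_tendsto_zero.1 (hξ a ha)
    have z2 : Tendsto (fun k => ‖φk k a - φ a‖) F (𝓝 0) :=
      tendsto_iff_norm_sub_tendsto_zero.1 (hφ a ha)
    have z3 : ∀ s ∈ I, Tendsto (fun k => |θk k s - θ s|) F (𝓝 0) := fun s hs => by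
      simpa using tendsto_iff_norm_sub_tendsto_zero.1 (hθ s hs)
    have z4 : Tendsto (fun k => ‖φk k b - φk k a‖) F (𝓝 ‖φ b - φ a‖) :=
      ((hφ b hb).sub (hφ a ha)).norm
    have z5 : Tendsto (fun k => ‖(φk k b - φk k a) - (φ b - φ a)‖) F (𝓝 0) :=
      tendsto_iff_norm_sub_tendsto_zero.1 ((hφ b hb).sub (hφ a ha))
    have z6 : Tendsto (fun k => |θk k b - θk k a|) F (𝓝 |θ b - θ a|) :=
      ((hθ b hb).sub (hθ a ha)).abs
    refine Tendsto.add ?_ ?_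
    · rw [tendsto_iff_norm_sub_tendsto_zero]
      refine squeeze_zero (fun _ => norm_nonneg _) (fun k => hF.norm_integral_f_sub_le _ _
        (hφkU k a ha) (hφU a ha) _ _ _ _) ?_
      simpa using (((z1.add z2).const_mul K).mul z6).add
        (((z3 a ha).add (z3 b hb)).const_mul B)
    · rw [tendsto_iff_norm_sub_tendsto_zero]
      refine squeeze_zero (fun _ => norm_nonneg _) (fun k => hF.norm_G_sub_le _ _
        (hφkU k a ha) (hφU a ha) _ _) ?_
      simpa using (((z1.add z2).const_mul K).mul z4).add (z5.const_mul B)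
  refine le_of_tendsto (((hξ b hb).sub (hξ a ha)).sub hlim).norm
    (Eventually.of_forall fun k => h k a ha b hb)

/-- A curve that follows a Lipschitz control solves the space-time system in integral form. -/
theorem IsField.integral_of_followsOn (hF : IsField U f G B K) {θ : ℝ → ℝ}
    {φ : ℝ → E m} {ξ : ℝ → E n} (hm : Monotone θ)
    (hlip : ∀ a b, |θ a - θ b| + ‖φ a - φ b‖ ≤ |a - b|) (hφU : ∀ s, φ s ∈ U) {C : ℝ}
    (hC : 0 ≤ C) (h : FollowsOn f G univ θ φ ξ id C) :
    Continuous ξ ∧ ∀ a b, ξ b - ξ a = ∫ s in a..b, velocity f G θ φ ξ s := by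
  have hθ1 : ∀ a b, ‖θ a - θ b‖ ≤ 1 * |a - b| := fun a b => by
    have := hlip a b; have := norm_nonneg (φ a - φ b); rw [Real.norm_eq_abs]; linarith
  have hφ1 : ∀ a b, ‖φ a - φ b‖ ≤ 1 * |a - b| := fun a b => by
    have := hlip a b; have := abs_nonneg (θ a - θ b); linarith
  have hθL := lipschitzWith_of_norm_sub_le zero_le_one hθ1
  have hφL := lipschitzWith_of_norm_sub_le zero_le_one hφ1
  have hloc : ∀ a b, ‖ξ b - ξ a‖ ≤ B * |b - a| + C * (b - a) ^ 2 := by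
    intro a b
    have h1 := h a trivial b trivial
    have h2 := hF.norm_increment_le (θ := θ) (ξ a) (hφU a) b
    have h3 := mul_le_mul_of_nonneg_left (hlip b a) hF.nonneg_B
    have h4 := norm_add_le (ξ b - ξ a - increment f G θ φ (ξ a) a b)
      (increment f G θ φ (ξ a) a b)
    rw [sub_add_cancel] at h4
    simp only [id] at h1
    linarith
  have hξc : Continuous ξ := by
    refine continuous_iff_continuousAt.2 fun a => ?_
    rw [ContinuousAt, tendsto_iff_norm_sub_tendsto_zero]
    refine squeeze_zero (fun _ => norm_nonneg _) (fun b => hloc a b) ?_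
    have : Continuous fun b => B * |b - a| + C * (b - a) ^ 2 := by fun_prop
    simpa using this.tendsto a
  have hiv : ∀ a b, IntervalIntegrable (velocity f G θ φ ξ) volume a b := fun a b =>
    hF.intervalIntegrable_velocity hθL hφL.continuous hφU hξc (lipschitz_ac hφL a b)
  refine ⟨hξc, fun a b => ?_⟩
  -- D is the defect in the integral equation. Its increments are quadratic, so its derivative
  -- vanishes everywhere and D is constant.
  set D : ℝ → E n := fun s => ξ s - ∫ r in a..s, velocity f G θ φ ξ r with hD
  -- C is the error in following. The rest is the error of the frozen velocity: for |q - p| ≤ 1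
  -- state and control vary by at most (B + C + 1)|q - p|, and the factor 2 bounds the speed |θ'| +
  -- ‖φ'‖.
  set M : ℝ := C + K * (B + C + 1) * 2 with hMdef
  have hloc2 : ∀ p q, |q - p| ≤ 1 → ‖D q - D p‖ ≤ M * |q - p| ^ 2 := by
    intro p q hpq
    have e1 : D q - D p = (ξ q - ξ p - increment f G θ φ (ξ p) p q)
        - ((∫ s in p..q, velocity f G θ φ ξ s) - increment f G θ φ (ξ p) p q) := by
      have := intervalIntegral.integral_add_adjacent_intervals (hiv a p) (hiv p q)
      simp only [hD]
      rw [← this]; abel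
    have h1 := h p trivial q trivial
    have h2 := hF.norm_integral_velocity_sub_increment_le (L := (B + C + 1) * |q - p|)
      (M := 2 * |q - p|) (a := p) (b := q) hm hθL
      hφL.continuous hφU hξc (lipschitz_ac hφL p q) (fun s hs => by
        have hsp : |s - p| ≤ |q - p| := by
          have := abs_sub_left_of_mem_uIcc hs
          simpa [abs_sub_comm] using this
        have h3 := hloc p s
        have h4 := hφ1 s p
        have h5 : (s - p) ^ 2 ≤ |q - p| := by
          rw [← sq_abs]
          nlinarith [abs_nonneg (s - p)]
        have h6 := mul_le_mul_of_nonneg_left h5 hC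
        have h7 := mul_le_mul_of_nonneg_left hsp hF.nonneg_B
        linarith) (by
        have := intervalIntegral.norm_integral_le_of_norm_le_const (a := p) (b := q)
          (f := fun s => |deriv θ s| + ‖deriv φ s‖) (C := 2) (fun s _ => by
            have h1 := norm_deriv_le_of_dist_le zero_le_one hθ1 s
            have h2 := norm_deriv_le_of_dist_le zero_le_one hφ1 s
            rw [Real.norm_eq_abs] at h1
            rw [Real.norm_of_nonneg (by positivity)]
            linarith)
        simpa using this)
    rw [e1]
    refine (norm_sub_le _ _).trans ((add_le_add h1 h2).trans (le_of_eq ?_))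
    simp only [id, hMdef]
    rw [← sq_abs (q - p)]
    ring
  have hder : ∀ p, HasDerivAt D 0 p := by
    intro p
    rw [hasDerivAt_iff_isLittleO]
    simp only [smul_zero, sub_zero]
    have : (fun q => D q - D p) =O[𝓝 p] fun q => |q - p| ^ 2 := by
      refine Asymptotics.IsBigO.of_bound M ?_
      filter_upwards [Metric.ball_mem_nhds p one_pos] with q hq
      rw [Metric.mem_ball, Real.dist_eq] at hq
      refine (hloc2 p q hq.le).trans (le_of_eq ?_)
      rw [Real.norm_of_nonneg (by positivity)]
    refine this.trans_isLittleO ?_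
    have h2 : (fun q : ℝ => |q - p| ^ 2) = fun q => |q - p| * |q - p| := by
      funext q; ring
    rw [h2]
    have h3 : Tendsto (fun q : ℝ => |q - p|) (𝓝 p) (𝓝 0) := by
      have : Continuous fun q : ℝ => |q - p| := by fun_prop
      simpa using this.tendsto p
    have h4 : (fun q : ℝ => |q - p| * |q - p|) =o[𝓝 p] fun q => 1 * |q - p| :=
      ((Asymptotics.isLittleO_one_iff ℝ).2 h3).mul_isBigO (Asymptotics.isBigO_refl _ _)
    refine h4.trans_isBigO ?_
    simp only [one_mul]
    exact (Asymptotics.isBigO_refl _ _).abs_left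
  have hconst := is_const_of_deriv_eq_zero (fun p => (hder p).differentiableAt)
    (fun p => (hder p).deriv) a b
  simp only [hD, intervalIntegral.integral_same, sub_zero] at hconst
  rw [hconst]; abel

end Field

/-! ### Existence, stability, and differentiability of solutions -/

section Existence

variable {n m : ℕ}

/-- Global existence for a bounded, Lipschitz Carathéodory right-hand side. -/
theorem exists_integral_solution {F : ℝ → E n → E n} {M K A : ℝ} (hK : 0 ≤ K) (hA : 0 ≤ A)
    (hmeas : ∀ y : ℝ → E n, Continuous y → Measurable fun s => F s (y s))
    (hbd : ∀ s x, ‖F s x‖ ≤ M) (hlip : ∀ s x y, ‖F s x - F s y‖ ≤ K * ‖x - y‖) (x₀ : E n) :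
    ∃ ξ : ℝ → E n, Continuous ξ ∧ ∀ s ∈ Icc 0 A, ξ s = x₀ + ∫ r in (0 : ℝ)..s, F r (ξ r) := by
  -- With the exponential weight of rate `lam`, the Picard map contracts by K / lam ≤ 1/2 on the
  -- whole of [0,A], so no gluing of local solutions is needed.
  set lam : ℝ := 2 * K + 1 with hlam
  have hlam0 : 0 < lam := by positivity
  have hint : ∀ y : ℝ → E n, Continuous y → ∀ a b,
      IntervalIntegrable (fun s => F s (y s)) volume a b := fun y hy a b =>
    IntervalIntegrable.mono_fun' (g := fun _ => M) intervalIntegrable_const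
      (hmeas y hy).aestronglyMeasurable (Eventually.of_forall fun s => hbd s _)
  -- The unknown z is the solution divided by the weight; `lift` puts the weight back.
  let lift : C(Icc (0 : ℝ) A, E n) → ℝ → E n := fun z r => Real.exp (lam * r) • IccExtend hA z r
  have hlift : ∀ z, Continuous (lift z) := fun z =>
    (by fun_prop : Continuous fun r : ℝ => Real.exp (lam * r)).smul (z.continuous.Icc_extend')
  have hprim : ∀ z, Continuous fun s => ∫ r in (0 : ℝ)..s, F r (lift z r) := fun z =>
    intervalIntegral.continuous_primitive (fun a b => hint _ (hlift z) a b) 0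
  let P : C(Icc (0 : ℝ) A, E n) → C(Icc (0 : ℝ) A, E n) := fun z =>
    ⟨fun s => Real.exp (-(lam * s)) • (x₀ + ∫ r in (0 : ℝ)..s, F r (lift z r)), by
      have := hprim z
      have h2 : Continuous fun s : ℝ =>
        Real.exp (-(lam * s)) • (x₀ + ∫ r in (0 : ℝ)..s, F r (lift z r)) := by fun_prop
      exact h2.comp continuous_subtype_val⟩
  have hP : ContractingWith (1 / 2) P := by
    refine ⟨by norm_num, LipschitzWith.of_dist_le_mul fun z z' => ?_⟩
    rw [ContinuousMap.dist_le (by positivity)]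
    rintro ⟨s, hs⟩
    rw [dist_eq_norm]
    have e1 : P z ⟨s, hs⟩ - P z' ⟨s, hs⟩ = Real.exp (-(lam * s)) •
        ∫ r in (0 : ℝ)..s, (F r (lift z r) - F r (lift z' r)) := by
      rw [intervalIntegral.integral_sub (hint _ (hlift z) _ _) (hint _ (hlift z') _ _), smul_sub]
      simp only [P, ContinuousMap.coe_mk, smul_add]
      abel
    have e2 : ‖∫ r in (0 : ℝ)..s, (F r (lift z r) - F r (lift z' r))‖
        ≤ ∫ r in (0 : ℝ)..s, K * dist z z' * Real.exp (lam * r) := by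
      refine intervalIntegral.norm_integral_le_of_norm_le hs.1 (Eventually.of_forall fun r _ => ?_)
        (by apply Continuous.intervalIntegrable; fun_prop)
      refine (hlip r _ _).trans ?_
      rw [← smul_sub, norm_smul, Real.norm_eq_abs, abs_of_pos (Real.exp_pos _), ← dist_eq_norm]
      have := z.dist_apply_le_dist (g := z') (projIcc 0 A hA r)
      have h2 : dist (IccExtend hA z r) (IccExtend hA z' r) ≤ dist z z' := this
      calc K * (Real.exp (lam * r) * dist (IccExtend hA z r) (IccExtend hA z' r))
          ≤ K * (Real.exp (lam * r) * dist z z') := by gcongr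
        _ = _ := by ring
    have e3 : ∫ r in (0 : ℝ)..s, K * dist z z' * Real.exp (lam * r)
        = K * dist z z' * ((Real.exp (lam * s) - 1) / lam) := by
      rw [intervalIntegral.integral_const_mul]
      congr 1
      have : ∀ r ∈ uIcc 0 s, HasDerivAt (fun r => Real.exp (lam * r) / lam)
          (Real.exp (lam * r)) r := fun r _ => by
        have h1 : HasDerivAt (fun r : ℝ => lam * r) lam r := by
          simpa using (hasDerivAt_id r).const_mul lam
        have h2 := h1.exp.div_const lam
        rwa [mul_div_cancel_right₀ _ hlam0.ne'] at h2
      rw [intervalIntegral.integral_eq_sub_of_hasDerivAt this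
        (by apply Continuous.intervalIntegrable; fun_prop)]
      simp
      ring
    rw [e1, norm_smul, Real.norm_eq_abs, abs_of_pos (Real.exp_pos _)]
    calc Real.exp (-(lam * s)) * ‖∫ r in (0 : ℝ)..s, (F r (lift z r) - F r (lift z' r))‖
        ≤ Real.exp (-(lam * s)) * (K * dist z z' * ((Real.exp (lam * s) - 1) / lam)) := by
          rw [← e3]; gcongr
      _ ≤ Real.exp (-(lam * s)) * (K * dist z z' * (Real.exp (lam * s) / lam)) := by
          gcongr; linarith
      _ = (K / lam) * dist z z' * (Real.exp (-(lam * s)) * Real.exp (lam * s)) := by ring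
      _ = (K / lam) * dist z z' := by rw [← Real.exp_add]; simp
      _ ≤ (1 / 2) * dist z z' := by
          refine mul_le_mul_of_nonneg_right ?_ dist_nonneg
          rw [div_le_div_iff₀ hlam0 two_pos]
          linarith
      _ = _ := by norm_num
  have hfix : P (ContractingWith.fixedPoint P hP) = ContractingWith.fixedPoint P hP :=
    hP.fixedPoint_isFixedPt
  set z := ContractingWith.fixedPoint P hP
  refine ⟨lift z, hlift z, fun s hs => ?_⟩
  have h1 : IccExtend hA z s = z ⟨s, hs⟩ := IccExtend_of_mem hA z hs
  have h2 : z ⟨s, hs⟩ = Real.exp (-(lam * s)) • (x₀ + ∫ r in (0 : ℝ)..s, F r (lift z r)) := by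
    conv_lhs => rw [← hfix]
    rfl
  change Real.exp (lam * s) • IccExtend hA z s = _
  rw [h1, h2, smul_smul, ← Real.exp_add]
  simp

theorem ae_hasDerivAt_of_integral {g ξ : ℝ → E n} {A : ℝ}
    (hg : IntervalIntegrable g volume 0 A)
    (h : ∀ a ∈ Icc 0 A, ∀ b ∈ Icc 0 A, ξ b - ξ a = ∫ r in a..b, g r) :
    ∀ᵐ s, s ∈ Ioo 0 A → HasDerivAt ξ (g s) s := by
  filter_upwards [hg.ae_hasDerivAt_integral] with s hs hsI
  have hA : 0 ≤ A := (hsI.1.trans hsI.2).le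
  have h1 := hs (by rw [uIcc_of_le hA]; exact Ioo_subset_Icc_self hsI) 0 left_mem_uIcc
  have h2 : HasDerivAt (fun r => ξ 0 + ∫ t in (0 : ℝ)..r, g t) (g s) s := h1.const_add _
  refine h2.congr_of_eventuallyEq ?_
  filter_upwards [Ioo_mem_nhds hsI.1 hsI.2] with r hr
  rw [← h 0 ⟨le_rfl, hA⟩ r (Ioo_subset_Icc_self hr)]
  abel

variable {U : Set (E m)} {f : E n → E m → ℝ → E n} {G : E n → E m → E m →L[ℝ] E n} {B K : ℝ}

theorem IsField.exists_solution (hF : IsField U f G B K) {θ : ℝ → ℝ} {φ : ℝ → E m}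
    {Kθ Kφ : NNReal} (hθ : LipschitzWith Kθ θ) (hφ : LipschitzWith Kφ φ) (hφU : ∀ s, φ s ∈ U)
    {A : ℝ} (hA : 0 ≤ A) (x₀ : E n) :
    ∃ ξ : ℝ → E n, Continuous ξ ∧ ξ 0 = x₀ ∧
      ∀ a ∈ Icc 0 A, ∀ b ∈ Icc 0 A, ξ b - ξ a = ∫ s in a..b, velocity f G θ φ ξ s := by
  have hdθ : ∀ s, |deriv θ s| ≤ Kθ := fun s => norm_deriv_le_of_lipschitz hθ
  have hdφ : ∀ s, ‖deriv φ s‖ ≤ Kφ := fun s => norm_deriv_le_of_lipschitz hφ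
  obtain ⟨ξ, hξ, h⟩ := exists_integral_solution (A := A)
    (F := fun s x => deriv θ s • f x (φ s) (θ s) + G x (φ s) (deriv φ s))
    (M := B * (Kθ + Kφ)) (K := K * (Kθ + Kφ))
    (mul_nonneg hF.nonneg_K (by positivity)) hA
    (fun y hy => hF.measurable_velocity hθ.continuous.measurable hφ.continuous hφU hy)
    (fun s x => (hF.norm_velocity_le (ξ := fun _ => x) (hφU s)).trans
      (mul_le_mul_of_nonneg_left (add_le_add (hdθ s) (hdφ s)) hF.nonneg_B))
    (fun s x y => by
      have e1 : deriv θ s • f x (φ s) (θ s) + G x (φ s) (deriv φ s)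
          - (deriv θ s • f y (φ s) (θ s) + G y (φ s) (deriv φ s))
          = deriv θ s • (f x (φ s) (θ s) - f y (φ s) (θ s))
            + (G x (φ s) (deriv φ s) - G y (φ s) (deriv φ s)) := by
        rw [smul_sub]; abel
      rw [e1]
      have h1 := hF.lip_f x y _ (hφU s) _ (hφU s) (θ s)
      have h2 := hF.lip_G x y _ (hφU s) _ (hφU s) (deriv φ s)
      rw [sub_self, norm_zero, add_zero] at h1 h2
      have hk : 0 ≤ K * ‖x - y‖ := mul_nonneg hF.nonneg_K (norm_nonneg _)
      calc _ ≤ |deriv θ s| * (K * ‖x - y‖) + K * ‖x - y‖ * ‖deriv φ s‖ := by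
            refine (norm_add_le _ _).trans (add_le_add ?_ h2)
            rw [norm_smul, Real.norm_eq_abs]
            exact mul_le_mul_of_nonneg_left h1 (abs_nonneg _)
        _ ≤ Kθ * (K * ‖x - y‖) + K * ‖x - y‖ * Kφ := by
            gcongr
            · exact hdθ s
            · exact hdφ s
        _ = _ := by ring) x₀
  have h0 : ξ 0 = x₀ := by simpa using h 0 ⟨le_rfl, hA⟩
  refine ⟨ξ, hξ, h0, fun a ha b hb => ?_⟩
  have hi : ∀ p q, IntervalIntegrable (velocity f G θ φ ξ) volume p q := fun p q =>
    hF.intervalIntegrable_velocity hθ hφ.continuous hφU hξ (lipschitz_ac hφ p q)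
  rw [h a ha, h b hb, add_sub_add_left_eq_sub]
  exact intervalIntegral.integral_interval_sub_left (hi 0 b) (hi 0 a)

/-- Discrete Grönwall estimate between two curves following the same control `u`, one with time `t`
and the other with a perturbed time `ϑ`. -/
theorem IsField.norm_sub_le_of_followsOn (hF : IsField U f G B K) {ϑ ℓ : ℝ → ℝ} {u : ℝ → E m}
    {x y : ℝ → E n} {C η T : ℝ} (hC : 0 ≤ C) (hη : 0 ≤ η)
    (hx : FollowsOn f G (Icc 0 T) id u x ℓ C) (hy : FollowsOn f G (Icc 0 T) ϑ u y ℓ C)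
    (hϑ : ∀ t ∈ Icc 0 T, |t - ϑ t| ≤ η) (huU : ∀ t ∈ Icc 0 T, u t ∈ U)
    (hℓc : ContinuousOn ℓ (Icc 0 T)) (hℓm : MonotoneOn ℓ (Icc 0 T)) (hℓ0 : ℓ 0 = 0)
    (hgauge : ∀ a ∈ Icc 0 T, ∀ b ∈ Icc 0 T, a ≤ b → (b - a) + ‖u b - u a‖ ≤ ℓ b - ℓ a)
    (h0 : x 0 = y 0) {N : ℕ} (hN : 0 < N) {t : ℝ} (ht : t ∈ Icc 0 T) :
    ‖x t - y t‖ ≤ Real.exp (K * ℓ T) * (2 * C * ℓ T ^ 2 / N + 2 * B * η * N) := by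
  have hT : 0 ≤ T := ht.1.trans ht.2
  have hTm : T ∈ Icc 0 T := ⟨hT, le_rfl⟩
  have h0m : (0 : ℝ) ∈ Icc 0 T := ⟨le_rfl, hT⟩
  have hℓt : ℓ t ≤ ℓ T := hℓm ht hTm ht.2
  have hℓt0 : 0 ≤ ℓ t := hℓ0 ▸ hℓm h0m ht ht.1
  have hN' : (0 : ℝ) < N := by exact_mod_cast hN
  -- The nodes are equally spaced in the gauge rather than in time, so that each of the N steps has
  -- following error at most C h² for either curve.
  set h : ℝ := ℓ t / N with hh
  have hh0 : 0 ≤ h := by positivity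
  have hnode : ∀ i : ℕ, ∃ s, i ≤ N → s ∈ Icc 0 t ∧ ℓ s = i * h := by
    intro i
    by_cases hi : i ≤ N
    · have hmem : (i : ℝ) * h ∈ Icc (ℓ 0) (ℓ t) := by
        rw [hℓ0]
        refine ⟨by positivity, ?_⟩
        have hi' : (i : ℝ) ≤ N := by exact_mod_cast hi
        calc (i : ℝ) * h ≤ N * h := by gcongr
          _ = ℓ t := by rw [hh]; field_simp
      obtain ⟨s, hs, hs'⟩ := intermediate_value_Icc ht.1
        (hℓc.mono (Icc_subset_Icc_right ht.2)) hmem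
      exact ⟨s, fun _ => ⟨hs, hs'⟩⟩
    · exact ⟨0, fun hc => absurd hc hi⟩
  choose p hp using hnode
  have hpT : ∀ i, i ≤ N → p i ∈ Icc 0 T := fun i hi =>
    ⟨(hp i hi).1.1, (hp i hi).1.2.trans ht.2⟩
  have hinj : ∀ a ∈ Icc 0 T, ∀ b ∈ Icc 0 T, ℓ a = ℓ b → a = b := by
    intro a ha b hb hab
    rcases le_total a b with hle | hle
    · have := hgauge a ha b hb hle
      have := norm_nonneg (u b - u a)
      linarith
    · have := hgauge b hb a ha hle
      have := norm_nonneg (u a - u b)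
      linarith
  have hp0 : p 0 = 0 := hinj _ (hpT 0 (Nat.zero_le _)) _ h0m (by
    rw [(hp 0 (Nat.zero_le _)).2, hℓ0]; simp)
  have hpN : p N = t := hinj _ (hpT N le_rfl) _ ht (by
    rw [(hp N le_rfl).2, hh]; field_simp)
  -- One step costs two following errors and the drift over the two time mismatches at its
  -- endpoints, each of length at most η.
  set ε : ℝ := 2 * C * h ^ 2 + 2 * B * η with hε
  have hε0 : 0 ≤ ε := by have := hF.nonneg_B; positivity
  have hstep : ∀ i, i + 1 ≤ N →
      ‖x (p (i + 1)) - y (p (i + 1))‖ ≤ (1 + K * h) * ‖x (p i) - y (p i)‖ + ε := by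
    intro i hi
    have hi0 : i ≤ N := (Nat.le_succ i).trans hi
    set a := p i
    set b := p (i + 1)
    have ha := hpT i hi0
    have hb := hpT (i + 1) hi
    have hℓab : ℓ b - ℓ a = h := by
      rw [(hp i hi0).2, (hp (i + 1) hi).2]; push_cast; ring
    have hab : a ≤ b := by
      by_contra hc
      have hlt := not_le.1 hc
      have := hgauge b hb a ha hlt.le
      have := norm_nonneg (u a - u b)
      linarith
    have hx' := hx a ha b hb
    have hy' := hy a ha b hb
    rw [hℓab] at hx' hy'
    have hg := hgauge a ha b hb hab
    rw [hℓab] at hg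
    have hinc : ‖increment f G id u (x a) a b - increment f G ϑ u (y a) a b‖
        ≤ K * h * ‖x a - y a‖ + 2 * B * η := by
      have e : increment f G id u (x a) a b - increment f G ϑ u (y a) a b
          = ((∫ r in a..b, f (x a) (u a) r) - ∫ r in ϑ a..ϑ b, f (y a) (u a) r)
            + (G (x a) (u a) (u b - u a) - G (y a) (u a) (u b - u a)) := by
        simp only [increment, id]; abel
      rw [e]
      have h1 := hF.norm_integral_f_sub_le (x a) (y a) (huU a ha) (huU a ha) a b (ϑ a) (ϑ b)
      have h2 := hF.norm_G_sub_le (x a) (y a) (huU a ha) (huU a ha) (u b - u a) (u b - u a)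
      rw [sub_self, norm_zero, add_zero] at h1 h2
      rw [sub_self, norm_zero, mul_zero, add_zero] at h2
      rw [abs_of_nonneg (sub_nonneg.2 hab)] at h1
      have h3 := mul_le_mul_of_nonneg_left (add_le_add (hϑ a ha) (hϑ b hb)) hF.nonneg_B
      have h4 := mul_le_mul_of_nonneg_left hg (mul_nonneg hF.nonneg_K (norm_nonneg (x a - y a)))
      refine (norm_add_le _ _).trans ?_
      linarith
    have e : x b - y b = (x a - y a) + (x b - x a - increment f G id u (x a) a b)
        - (y b - y a - increment f G ϑ u (y a) a b)
        + (increment f G id u (x a) a b - increment f G ϑ u (y a) a b) := by abel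
    rw [e]
    refine (norm_add_le _ _).trans ((add_le_add ((norm_sub_le _ _).trans
      (add_le_add (norm_add_le _ _) le_rfl)) le_rfl).trans ?_)
    linarith
  have hKh : 0 ≤ K * h := mul_nonneg hF.nonneg_K hh0
  have hind : ∀ i, i ≤ N → ‖x (p i) - y (p i)‖ ≤ (1 + K * h) ^ i * (i * ε) := by
    intro i
    induction i with
    | zero => intro _; rw [hp0, h0]; simp
    | succ i ih =>
      intro hi
      refine (hstep i hi).trans ?_
      have h1 := mul_le_mul_of_nonneg_left (ih ((Nat.le_succ i).trans hi))
        (by linarith : 0 ≤ 1 + K * h)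
      have h2 : 1 ≤ (1 + K * h) ^ (i + 1) := one_le_pow₀ (by linarith)
      have h3 := mul_le_mul_of_nonneg_right h2 hε0
      push_cast
      calc _ ≤ (1 + K * h) * ((1 + K * h) ^ i * (i * ε)) + 1 * ε := by linarith
        _ ≤ (1 + K * h) * ((1 + K * h) ^ i * (i * ε)) + (1 + K * h) ^ (i + 1) * ε := by linarith
        _ = _ := by ring
  have hfin := hind N le_rfl
  rw [hpN] at hfin
  refine hfin.trans (mul_le_mul ?_ ?_ (by positivity) (Real.exp_pos _).le)
  · calc (1 + K * h) ^ N ≤ Real.exp (K * h) ^ N :=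
          pow_le_pow_left₀ (by linarith) (by linarith [Real.add_one_le_exp (K * h)]) _
      _ = Real.exp (K * ℓ t) := by
          rw [← Real.exp_nat_mul, hh]; congr 1; field_simp
      _ ≤ Real.exp (K * ℓ T) :=
          Real.exp_le_exp.2 (mul_le_mul_of_nonneg_left hℓt hF.nonneg_K)
  · have e : (N : ℝ) * ε = 2 * C * ℓ t ^ 2 / N + 2 * B * η * N := by
      rw [hε, hh]; field_simp
    rw [e]
    gcongr

end Existence

/-! ### Clamping and truncation -/

/-- The projection of the line onto `[0,A]`. -/
noncomputable def clamp (A s : ℝ) : ℝ := max 0 (min A s)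

theorem clamp_mem {A : ℝ} (hA : 0 ≤ A) (s : ℝ) : clamp A s ∈ Icc 0 A :=
  ⟨le_max_left _ _, max_le hA (min_le_left _ _)⟩

theorem clamp_of_mem {A s : ℝ} (hs : s ∈ Icc 0 A) : clamp A s = s := by
  rw [clamp, min_eq_right hs.2, max_eq_right hs.1]

theorem abs_clamp_sub_le (A a b : ℝ) : |clamp A a - clamp A b| ≤ |a - b| := by
  have h1 := abs_max_sub_max_le_abs (min a A) (min b A) 0
  have h2 := abs_min_sub_min_le_max a A b A
  simp only [sub_self, abs_zero, abs_nonneg, sup_of_le_left] at h2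
  simpa [clamp, max_comm, min_comm] using h1.trans h2

theorem clamp_mono (A : ℝ) : Monotone (clamp A) := fun _ _ h =>
  max_le_max le_rfl (min_le_min le_rfl h)

theorem continuous_clamp (A : ℝ) : Continuous (clamp A) := by
  unfold clamp; fun_prop

theorem clamp_eventuallyEq {A s : ℝ} (hs : s ∈ Ioo 0 A) {X : Type*} (g : ℝ → X) :
    (fun r => g (clamp A r)) =ᶠ[𝓝 s] g := by
  filter_upwards [Ioo_mem_nhds hs.1 hs.2] with r hr
  rw [clamp_of_mem (Ioo_subset_Icc_self hr)]

theorem ac_congr {X : Type*} [PseudoMetricSpace X] {f g : ℝ → X} {a b : ℝ}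
    (hf : AbsolutelyContinuousOnInterval f a b) (h : EqOn f g (uIcc a b)) :
    AbsolutelyContinuousOnInterval g a b := by
  rw [absolutelyContinuousOnInterval_iff] at hf ⊢
  intro ε hε
  obtain ⟨δ, hδ, H⟩ := hf ε hε
  refine ⟨δ, hδ, fun Ed hE hlt => ?_⟩
  have := H Ed hE hlt
  rwa [Finset.sum_congr rfl fun i hi => by
    rw [← h (hE.1 i hi).1, ← h (hE.1 i hi).2]]

/-- Coordinatewise truncation at level `R`. -/
noncomputable def box {n : ℕ} (R : ℝ) (x : E n) : E n :=
  WithLp.toLp 2 fun i => max (-R) (min R (x i))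

theorem box_of_norm_le {n : ℕ} {R : ℝ} {x : E n} (h : ‖x‖ ≤ R) : box R x = x := by
  ext i
  have hi := (PiLp.norm_apply_le x i).trans h
  rw [Real.norm_eq_abs, abs_le] at hi
  simp [box, hi.1, hi.2]

theorem norm_box_sub_le {n : ℕ} (R : ℝ) (x y : E n) : ‖box R x - box R y‖ ≤ ‖x - y‖ := by
  rw [EuclideanSpace.norm_eq, EuclideanSpace.norm_eq]
  refine Real.sqrt_le_sqrt (Finset.sum_le_sum fun i _ => ?_)
  refine pow_le_pow_left₀ (norm_nonneg _) ?_ 2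
  have h1 := abs_max_sub_max_le_abs (min (x i) R) (min (y i) R) (-R)
  have h2 := abs_min_sub_min_le_max (x i) R (y i) R
  simp only [sub_self, abs_zero, abs_nonneg, sup_of_le_left] at h2
  simpa [box, max_comm, min_comm] using h1.trans h2

theorem continuous_box {n : ℕ} (R : ℝ) : Continuous (box (n := n) R) := by
  have : LipschitzWith 1 (box (n := n) R) := LipschitzWith.of_dist_le_mul fun x y => by
    simpa [dist_eq_norm] using norm_box_sub_le R x y
  exact this.continuous

/-- A compact set containing the range of `box R`. -/
def boxSet (n : ℕ) (R : ℝ) : Set (E n) :=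
  (WithLp.toLp 2) '' (Set.pi univ fun _ : Fin n => Icc (-|R|) |R|)

theorem isCompact_boxSet (n : ℕ) (R : ℝ) : IsCompact (boxSet n R) :=
  (isCompact_univ_pi fun _ => isCompact_Icc).image (PiLp.continuous_toLp 2 _)

theorem box_mem {n : ℕ} (R : ℝ) (x : E n) : box R x ∈ boxSet n R := by
  refine ⟨_, fun i _ => ⟨?_, ?_⟩, rfl⟩
  · exact (neg_le_neg (le_abs_self R)).trans (le_max_left _ _)
  · exact max_le (neg_le_abs R) ((min_le_left _ _).trans (le_abs_self R))

/-! ### The truncated system -/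

section System

variable {n m l : ℕ}

/-- The drift of the truncated system. -/
noncomputable def System.drift (sys : System n m l) (T : ℝ) (v : ℝ → E l) (R : ℝ) :
    E n → E m → ℝ → E n :=
  fun x u t => sys.g₀ (box R x) u (v (clamp T t))

/-- The control-linear term of the truncated system. -/
noncomputable def System.coupling (sys : System n m l) (R : ℝ) : E n → E m → E m →L[ℝ] E n :=
  fun x u => ∑ i, (EuclideanSpace.proj i : E m →L[ℝ] ℝ).smulRight (sys.g i (box R x) u)

theorem System.coupling_apply (sys : System n m l) (R : ℝ) (x : E n) (u w : E m) :
    sys.coupling R x u w = ∑ i, w i • sys.g i (box R x) u := by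
  simp [System.coupling]

/-- The growth condition controls the `sys.g i` only in the presence of some v, hence the guard
`sys.V.Nonempty`. -/
theorem System.Assumptions.exists_bound {sys : System n m l} (h : sys.Assumptions) (R : ℝ) :
    ∃ b : ℝ, 0 ≤ b ∧ ∀ x ∈ boxSet n R, ∀ u ∈ sys.U, (∀ v ∈ sys.V, ‖sys.g₀ x u v‖ ≤ b) ∧
      (sys.V.Nonempty → ∀ i, ‖sys.g i x u‖ ≤ b) := by
  obtain ⟨M, hM, hg⟩ := h.growth
  obtain ⟨r, hr⟩ := (isCompact_boxSet n R).isBounded.exists_norm_le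
  obtain ⟨q, hq⟩ := h.isCompact_U.isBounded.exists_norm_le
  have key : ∀ x ∈ boxSet n R, ∀ u ∈ sys.U, ∀ v ∈ sys.V,
      Real.sqrt (‖sys.g₀ x u v‖ ^ 2 + ∑ i, ‖sys.g i x u‖ ^ 2) ≤ M * (1 + |r| + |q|) := by
    intro x hx u hu v hv
    refine (hg x u hu v hv).trans ?_
    have h1 : pairNorm x u ≤ ‖x‖ + ‖u‖ := by
      rw [pairNorm, Real.sqrt_le_left (by positivity)]
      nlinarith [norm_nonneg x, norm_nonneg u]
    have h2 := (hr x hx).trans (le_abs_self r)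
    have h3 := (hq u hu).trans (le_abs_self q)
    exact mul_le_mul_of_nonneg_left (by linarith) hM.le
  refine ⟨M * (1 + |r| + |q|), by positivity, fun x hx u hu => ⟨fun v hv => ?_, ?_⟩⟩
  · refine le_trans (Real.le_sqrt_of_sq_le ?_) (key x hx u hu v hv)
    have : 0 ≤ ∑ i, ‖sys.g i x u‖ ^ 2 := Finset.sum_nonneg fun i _ => by positivity
    linarith
  · rintro ⟨v, hv⟩ i
    refine le_trans (Real.le_sqrt_of_sq_le ?_) (key x hx u hu v hv)
    have : ‖sys.g i x u‖ ^ 2 ≤ ∑ i, ‖sys.g i x u‖ ^ 2 :=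
      Finset.single_le_sum (f := fun i => ‖sys.g i x u‖ ^ 2) (fun i _ => by positivity)
        (Finset.mem_univ i)
    have : 0 ≤ ‖sys.g₀ x u v‖ ^ 2 := by positivity
    linarith

/-- Viewing q ↦ g₀(q, ·) as one map into C(V, ℝⁿ) with the sup norm encodes uniformity in v; this
map is locally Lipschitz, hence Lipschitz on a compact set. -/
theorem System.Assumptions.exists_lipschitz_g₀ {sys : System n m l} (h : sys.Assumptions)
    (R : ℝ) : ∃ K : NNReal, ∀ v ∈ sys.V,
      LipschitzOnWith K (fun q : E n × E m => sys.g₀ q.1 q.2 v) (boxSet n R ×ˢ sys.U) := by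
  classical
  have : CompactSpace sys.V := isCompact_iff_compactSpace.1 h.isCompact_V
  have hc : ∀ q : E n × E m, q.2 ∈ sys.U →
      Continuous fun v : sys.V => sys.g₀ q.1 q.2 v := fun q hq =>
    h.continuousOn_g₀.comp_continuous (f := fun v : sys.V => (q.1, q.2, (v : E l)))
      (by fun_prop) fun v => ⟨trivial, hq, v.2⟩
  let H : E n × E m → C(sys.V, E n) := fun q =>
    if hq : q.2 ∈ sys.U then ⟨fun v => sys.g₀ q.1 q.2 v, hc q hq⟩ else 0
  have hH : ∀ q : E n × E m, q.2 ∈ sys.U → ∀ v : sys.V, H q v = sys.g₀ q.1 q.2 v :=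
    fun q hq v => by simp [H, hq]
  have hloc : LocallyLipschitzOn (boxSet n R ×ˢ sys.U) H := by
    intro p hp
    obtain ⟨K, N, hN, hK⟩ := h.lipschitz_g₀ p ⟨trivial, hp.2⟩
    refine ⟨K, N ∩ (boxSet n R ×ˢ sys.U), inter_mem (nhdsWithin_mono p
      (prod_mono_left (subset_univ _)) hN) self_mem_nhdsWithin, ?_⟩
    refine LipschitzOnWith.of_dist_le_mul fun a ha b hb => ?_
    rw [ContinuousMap.dist_le (by positivity)]
    intro v
    rw [hH a ha.2.2, hH b hb.2.2]
    exact (hK v v.2).dist_le_mul a ha.1 b hb.1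
  obtain ⟨K, hK⟩ := hloc.exists_lipschitzOnWith_of_compact
    ((isCompact_boxSet n R).prod h.isCompact_U)
  refine ⟨K, fun v hv => LipschitzOnWith.of_dist_le_mul fun a ha b hb => ?_⟩
  have h1 := (ContinuousMap.dist_apply_le_dist (f := H a) (g := H b) (⟨v, hv⟩ : sys.V)).trans
    (hK.dist_le_mul a ha b hb)
  rwa [hH a ha.2, hH b hb.2] at h1

/-- Truncation confines the state to a compact box, where the local bounds and Lipschitz constants
become global. Clamping time evaluates `v` only on [0,T]. -/
theorem System.Assumptions.exists_isField {sys : System n m l} (h : sys.Assumptions) {T : ℝ}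
    (hT : 0 ≤ T) {v : ℝ → E l} (hv : IsOrdinaryControl sys.V T v) (R : ℝ) :
    ∃ B K : ℝ, IsField sys.U (sys.drift T v R) (sys.coupling R) B K := by
  obtain ⟨b, hb, hbd⟩ := h.exists_bound R
  obtain ⟨K₀, hK₀⟩ := h.exists_lipschitz_g₀ R
  have hvV : ∀ t, v (clamp T t) ∈ sys.V := fun t => hv.2 _ (clamp_mem hT t)
  have hVne : sys.V.Nonempty := ⟨_, hvV 0⟩
  have hg : ∀ i, ∃ K : NNReal, LipschitzOnWith K
      (fun q : E n × E m => sys.g i q.1 q.2) (boxSet n R ×ˢ sys.U) := fun i =>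
    ((h.lipschitz_g i).mono (prod_mono_left (subset_univ _))).exists_lipschitzOnWith_of_compact
      ((isCompact_boxSet n R).prod h.isCompact_U)
  choose K₁ hK₁ using hg
  have hcoord : ∀ (w : E m) i, |w i| ≤ ‖w‖ := fun w i => PiLp.norm_apply_le w i
  have hd : ∀ (x y : E n) (u w : E m), dist (box R x, u) (box R y, w) ≤ ‖x - y‖ + ‖u - w‖ := by
    intro x y u w
    rw [Prod.dist_eq, dist_eq_norm, dist_eq_norm]
    exact max_le ((norm_box_sub_le R x y).trans (le_add_of_nonneg_right (norm_nonneg _)))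
      (le_add_of_nonneg_left (norm_nonneg _))
  have hvm : Measurable fun t => v (clamp T t) := by
    have h1 : Measurable fun t : ℝ => (⟨clamp T t, clamp_mem hT t⟩ : Icc (0 : ℝ) T) :=
      (continuous_clamp T).measurable.subtype_mk
    exact hv.1.comp h1
  have hsumK : ∀ i, (K₁ i : ℝ) ≤ ∑ j, (K₁ j : ℝ) := fun i =>
    Finset.single_le_sum (f := fun j => (K₁ j : ℝ)) (fun _ _ => NNReal.coe_nonneg _)
      (Finset.mem_univ i)
  -- The coupling sums m terms, each at most b‖w‖; the extra 1 accounts for the drift bound, also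
  -- when m = 0.
  refine ⟨b * (m + 1), K₀ + ∑ j, (K₁ j : ℝ), ?_⟩
  constructor
  · positivity
  · positivity
  · intro x u hu t
    have := (hbd _ (box_mem R x) u hu).1 _ (hvV t)
    refine this.trans ?_
    nlinarith [(Nat.cast_nonneg m : (0 : ℝ) ≤ m)]
  · intro x u hu w
    rw [System.coupling_apply]
    calc ‖∑ i, w i • sys.g i (box R x) u‖ ≤ ∑ i : Fin m, ‖w‖ * b := by
          refine norm_sum_le_of_le _ fun i _ => ?_
          rw [norm_smul]
          exact mul_le_mul (hcoord w i) ((hbd _ (box_mem R x) u hu).2 hVne i) (norm_nonneg _)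
            (norm_nonneg _)
      _ = b * m * ‖w‖ := by simp; ring
      _ ≤ b * (m + 1) * ‖w‖ := by gcongr; linarith
  · intro x y u hu w hw t
    have h1 := (hK₀ _ (hvV t)).dist_le_mul (box R x, u) ⟨box_mem R x, hu⟩ (box R y, w)
      ⟨box_mem R y, hw⟩
    rw [dist_eq_norm] at h1
    refine h1.trans ?_
    refine mul_le_mul ?_ (hd x y u w) dist_nonneg (by positivity)
    have : 0 ≤ ∑ j, (K₁ j : ℝ) := by positivity
    linarith
  · intro x y u hu w hw z
    rw [System.coupling_apply, System.coupling_apply, ← Finset.sum_sub_distrib]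
    calc ‖∑ i, (z i • sys.g i (box R x) u - z i • sys.g i (box R y) w)‖
        ≤ ∑ i : Fin m, (K₁ i : ℝ) * ((‖x - y‖ + ‖u - w‖) * ‖z‖) := by
          refine norm_sum_le_of_le _ fun i _ => ?_
          rw [← smul_sub, norm_smul, Real.norm_eq_abs]
          have h1 := (hK₁ i).dist_le_mul (box R x, u) ⟨box_mem R x, hu⟩ (box R y, w)
            ⟨box_mem R y, hw⟩
          rw [dist_eq_norm] at h1
          have h2 := h1.trans (mul_le_mul_of_nonneg_left (hd x y u w) (NNReal.coe_nonneg _))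
          calc _ ≤ ‖z‖ * (K₁ i * (‖x - y‖ + ‖u - w‖)) :=
                mul_le_mul (hcoord z i) h2 (norm_nonneg _) (norm_nonneg _)
            _ = _ := by ring
      _ = (∑ i, (K₁ i : ℝ)) * ((‖x - y‖ + ‖u - w‖) * ‖z‖) := by rw [Finset.sum_mul]
      _ ≤ (K₀ + ∑ j, (K₁ j : ℝ)) * ((‖x - y‖ + ‖u - w‖) * ‖z‖) := by
          refine mul_le_mul_of_nonneg_right ?_ (by positivity)
          have := NNReal.coe_nonneg K₀
          linarith
      _ = _ := by ring
  · intro ξ φ θ hξ hφ hφU hθ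
    have h1 : Continuous ((univ ×ˢ sys.U ×ˢ sys.V).domRestrict
      (fun p : E n × E m × E l => sys.g₀ p.1 p.2.1 p.2.2)) :=
      continuousOn_iff_continuous_domRestrict.1 h.continuousOn_g₀
    have h2 : Measurable fun s => (box R (ξ s), φ s, v (clamp T (θ s))) :=
      ((continuous_box R).comp hξ).measurable.prodMk
        (hφ.measurable.prodMk (hvm.comp hθ))
    have h3 : Measurable fun s => (⟨(box R (ξ s), φ s, v (clamp T (θ s))),
      ⟨trivial, hφU s, hvV _⟩⟩ : (univ ×ˢ sys.U ×ˢ sys.V : Set (E n × E m × E l))) :=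
      h2.subtype_mk
    exact h1.measurable.comp h3
  · intro ξ φ w hξ hφ hφU hw
    have : (fun s => sys.coupling R (ξ s) (φ s) (w s))
        = fun s => ∑ i, w s i • sys.g i (box R (ξ s)) (φ s) := by
      funext s; rw [System.coupling_apply]
    rw [this]
    refine Finset.measurable_sum _ fun i _ =>
      Measurable.smul (f := fun s => w s i) (g := fun s => sys.g i (box R (ξ s)) (φ s)) ?_ ?_
    · exact (EuclideanSpace.proj i : E m →L[ℝ] ℝ).continuous.measurable.comp hw
    · have h1 := (h.lipschitz_g i).continuousOn.comp_continuous
        (f := fun s => (box R (ξ s), φ s)) (((continuous_box R).comp hξ).prodMk hφ)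
        (fun s => ⟨trivial, hφU s⟩)
      exact h1.measurable

/-- A curve bounded by R with times in [0,T] does not see the truncation: this is how the original
system is recovered. -/
theorem System.velocity_eq (sys : System n m l) {T R : ℝ} (v : ℝ → E l) {θ : ℝ → ℝ}
    {φ : ℝ → E m} {ξ : ℝ → E n} {s : ℝ} (hξ : ‖ξ s‖ ≤ R) (hθ : θ s ∈ Icc 0 T) :
    velocity (sys.drift T v R) (sys.coupling R) θ φ ξ s
      = deriv θ s • sys.g₀ (ξ s) (φ s) (v (θ s)) + ∑ i, (deriv φ s) i • sys.g i (ξ s) (φ s) := by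
  rw [velocity, System.coupling_apply, System.drift, box_of_norm_le hξ, clamp_of_mem hθ]

end System

/-! ### Solutions follow their controls -/

section Conversion

variable {n m l : ℕ}

theorem FollowsOn.congr {f : E n → E m → ℝ → E n} {G : E n → E m → E m →L[ℝ] E n} {I : Set ℝ}
    {θ θ' : ℝ → ℝ} {φ φ' : ℝ → E m} {ξ ξ' : ℝ → E n} {ℓ : ℝ → ℝ} {C : ℝ}
    (h : FollowsOn f G I θ φ ξ ℓ C) (hθ : EqOn θ θ' I) (hφ : EqOn φ φ' I) (hξ : EqOn ξ ξ' I) :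
    FollowsOn f G I θ' φ' ξ' ℓ C := by
  intro a ha b hb
  have := h a ha b hb
  rwa [increment, hξ ha, hξ hb, hφ ha, hφ hb, hθ ha, hθ hb] at this

theorem ae_mem_Ioo {A a b : ℝ} (ha : a ∈ Icc 0 A) (hb : b ∈ Icc 0 A) :
    ∀ᵐ s : ℝ, s ∈ uIoc a b → s ∈ Ioo 0 A := by
  have h0 : ∀ᵐ s : ℝ, s ≠ 0 := by simp [ae_iff, measure_singleton]
  have hA : ∀ᵐ s : ℝ, s ≠ A := by simp [ae_iff, measure_singleton]
  filter_upwards [h0, hA] with s hs0 hsA hs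
  have h1 : s ∈ Icc 0 A := uIcc_subset_Icc ha hb (uIoc_subset_uIcc hs)
  exact ⟨lt_of_le_of_ne h1.1 hs0.symm, lt_of_le_of_ne h1.2 hsA⟩

theorem uIcc_subset_uIcc_of_mem {A a b : ℝ} (ha : a ∈ Icc 0 A) (hb : b ∈ Icc 0 A) :
    uIcc a b ⊆ uIcc 0 A := by
  rw [uIcc_of_le (ha.1.trans ha.2)]; exact uIcc_subset_Icc ha hb

theorem continuous_comp_clamp {X : Type*} [TopologicalSpace X] {g : ℝ → X} {A : ℝ} (hA : 0 ≤ A)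
    (hg : ContinuousOn g (uIcc 0 A)) : Continuous fun s => g (clamp A s) := by
  rw [uIcc_of_le hA] at hg
  exact hg.comp_continuous (continuous_clamp A) (clamp_mem hA)

/-- The gauge `t + Var_{[0,t]}(u)`. -/
noncomputable def gauge (u : ℝ → E m) (t : ℝ) : ℝ := t + (eVariationOn u (Icc 0 t)).toReal

/-- For an absolutely continuous control the variation is the integral of the speed, hence additive
over intervals. -/
theorem gauge_sub {u : ℝ → E m} {T : ℝ} (hu : AbsolutelyContinuousOnInterval u 0 T) {a b : ℝ}
    (ha : a ∈ Icc 0 T) (hb : b ∈ Icc 0 T) :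
    gauge u b - gauge u a = (b - a) + ∫ s in a..b, ‖deriv u s‖ := by
  have h0 : (0 : ℝ) ∈ Icc 0 T := ⟨le_rfl, ha.1.trans ha.2⟩
  have hV : ∀ t ∈ Icc 0 T, (eVariationOn u (Icc 0 t)).toReal = ∫ s in (0 : ℝ)..t, ‖deriv u s‖ :=
    fun t ht => ac_eVariationOn_eq ht.1 (hu.mono (uIcc_subset_uIcc_of_mem h0 ht))
  have hi : ∀ t ∈ Icc 0 T, IntervalIntegrable (fun s => ‖deriv u s‖) volume 0 t := fun t ht =>
    (ac_intervalIntegrable_deriv (hu.mono (uIcc_subset_uIcc_of_mem h0 ht))).norm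
  rw [gauge, gauge, hV a ha, hV b hb,
    ← intervalIntegral.integral_interval_sub_left (hi b hb) (hi a ha)]
  ring

theorem gauge_zero (u : ℝ → E m) : gauge u 0 = 0 := by
  simp [gauge]

theorem le_gauge_sub {u : ℝ → E m} {T : ℝ} (hu : AbsolutelyContinuousOnInterval u 0 T) {a b : ℝ}
    (ha : a ∈ Icc 0 T) (hb : b ∈ Icc 0 T) (hab : a ≤ b) :
    (b - a) + ‖u b - u a‖ ≤ gauge u b - gauge u a := by
  rw [gauge_sub hu ha hb, ← ac_integral_deriv (hu.mono (uIcc_subset_uIcc_of_mem ha hb))]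
  gcongr
  exact intervalIntegral.norm_integral_le_integral_norm hab

theorem continuousOn_gauge {u : ℝ → E m} {T : ℝ} (hT : 0 ≤ T)
    (hu : AbsolutelyContinuousOnInterval u 0 T) : ContinuousOn (gauge u) (Icc 0 T) := by
  have h0 : (0 : ℝ) ∈ Icc 0 T := ⟨le_rfl, hT⟩
  have h1 : ContinuousOn (fun t => t + ∫ s in (0 : ℝ)..t, ‖deriv u s‖) (Icc 0 T) := by
    refine continuousOn_id.add ?_
    have := intervalIntegral.continuousOn_primitive_interval' (μ := volume)
      (ac_intervalIntegrable_deriv hu).norm left_mem_uIcc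
    rwa [uIcc_of_le hT] at this
  refine h1.congr fun t ht => ?_
  have := gauge_sub hu h0 ht
  rw [gauge_zero] at this
  linarith

/-- Carathéodory solutions follow their controls. -/
theorem System.IsCaratheodorySolution.followsOn {sys : System n m l} {T R B K : ℝ} {v : ℝ → E l}
    (hF : IsField sys.U (sys.drift T v R) (sys.coupling R) B K) (hT : 0 ≤ T) {u : ℝ → E m}
    (hu : IsACControl sys.U T u) {x₀ : E n} {x : ℝ → E n}
    (hx : sys.IsCaratheodorySolution x₀ T u v x) (hR : ∀ t ∈ Icc 0 T, ‖x t‖ ≤ R) :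
    FollowsOn (sys.drift T v R) (sys.coupling R) (Icc 0 T) id u x (gauge u) (K * (B + 1)) := by
  obtain ⟨-, hxac, hxd⟩ := hx
  obtain ⟨huac, huU⟩ := hu
  -- Control and solution are known only on [0,T]; composing with `clamp` makes them continuous on
  -- the line without changing derivatives in the interior.
  have hcl : ∀ {X : Type} (g : ℝ → X), EqOn (fun s => g (clamp T s)) g (Icc 0 T) :=
    fun g s hs => by simp only [clamp_of_mem hs]
  have hac' : AbsolutelyContinuousOnInterval (fun s => u (clamp T s)) 0 T :=
    ac_congr (f := u) huac (by rw [uIcc_of_le hT]; exact (hcl u).symm)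
  have hidm : Monotone fun t : ℝ => t := monotone_id
  have hidL : LipschitzWith 1 fun t : ℝ => t := LipschitzWith.id
  suffices h : FollowsOn (sys.drift T v R) (sys.coupling R) (Icc 0 T) (fun t => t)
      (fun s => u (clamp T s)) (fun s => x (clamp T s)) (gauge u) (K * (B + 1)) from
    h.congr (fun _ _ => rfl) (hcl u) (hcl x)
  refine hF.followsOn_of_integral hidm hidL (continuous_comp_clamp hT huac.continuousOn)
    (fun s => huU _ (clamp_mem hT s)) (continuous_comp_clamp hT hxac.continuousOn) (I := Icc 0 T) ordConnected_Icc
    (fun a ha b hb => hac'.mono (uIcc_subset_uIcc_of_mem ha hb)) ?_ ?_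
  · intro a ha b hb
    simp only [clamp_of_mem ha, clamp_of_mem hb]
    rw [← ac_integral_deriv (hxac.mono (uIcc_subset_uIcc_of_mem ha hb))]
    refine intervalIntegral.integral_congr_ae ?_
    filter_upwards [hxd, ae_mem_Ioo ha hb] with s hs1 hs2 hs
    have hs' := hs2 hs
    have hsI := Ioo_subset_Icc_self hs'
    rw [(hs1 hs').deriv, sys.velocity_eq v (by rw [clamp_of_mem hsI]; exact hR s hsI) hsI,
      (clamp_eventuallyEq hs' u).deriv_eq]
    simp only [clamp_of_mem hsI, deriv_id'', one_smul]
  · intro a ha b hb hab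
    rw [gauge_sub huac ha hb]
    have hi := (ac_intervalIntegrable_deriv
      (huac.mono (uIcc_subset_uIcc_of_mem ha hb))).norm
    have e : ∫ s in a..b, (|deriv (fun t : ℝ => t) s| + ‖deriv (fun s => u (clamp T s)) s‖)
        = ∫ s in a..b, ((1 : ℝ) + ‖deriv u s‖) := by
      refine intervalIntegral.integral_congr_ae ?_
      filter_upwards [ae_mem_Ioo ha hb] with s hs2 hs
      rw [(clamp_eventuallyEq (hs2 hs) u).deriv_eq]
      simp
    rw [e, intervalIntegral.integral_add intervalIntegrable_const hi]
    simp

/-! ### Pseudo-time intervals and the filter at their end -/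

theorem mem_pseudoTime_of_le {S : EReal} {s r : ℝ} (hs : s ∈ pseudoTime S) (h0 : 0 ≤ r)
    (hr : r ≤ s) : r ∈ pseudoTime S :=
  ⟨h0, lt_of_le_of_lt (EReal.coe_le_coe_iff.2 hr) hs.2⟩

theorem Icc_subset_pseudoTime {S : EReal} {A : ℝ} (hA : A ∈ pseudoTime S) :
    Icc 0 A ⊆ pseudoTime S := fun _ hs => mem_pseudoTime_of_le hA hs.1 hs.2

theorem exists_gt_mem_pseudoTime {S : EReal} {s : ℝ} (hs : s ∈ pseudoTime S) :
    ∃ q : ℚ, s < q ∧ (q : ℝ) ∈ pseudoTime S := by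
  obtain ⟨q, h1, h2⟩ := EReal.lt_iff_exists_rat_btwn.1 hs.2
  have h1' : s < q := EReal.coe_lt_coe_iff.1 h1
  exact ⟨q, h1', hs.1.trans h1'.le, h2⟩

/-- The intervals are exhausted by countably many with rational endpoint, so the exceptional null
sets can be united. -/
theorem ae_pseudoTime {S : EReal} {P : ℝ → Prop}
    (h : ∀ A ∈ pseudoTime S, ∀ᵐ s : ℝ, s ∈ Ioo 0 A → P s) :
    ∀ᵐ s : ℝ, s ∈ pseudoTime S → P s := by
  have h0 : ∀ᵐ s : ℝ, s ≠ 0 := by simp [ae_iff, measure_singleton]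
  have h1 : ∀ᵐ s : ℝ, ∀ q : ℚ, (q : ℝ) ∈ pseudoTime S → s ∈ Ioo 0 (q : ℝ) → P s := by
    rw [ae_all_iff]
    intro q
    by_cases hq : (q : ℝ) ∈ pseudoTime S
    · filter_upwards [h q hq] with s hs _ using hs
    · exact Eventually.of_forall fun s hc => absurd hc hq
  filter_upwards [h0, h1] with s hs0 hs hsS
  obtain ⟨q, hq1, hq2⟩ := exists_gt_mem_pseudoTime hsS
  exact hs q hq2 ⟨lt_of_le_of_ne hsS.1 hs0.symm, hq1⟩

theorem toEnd_eq_of_lt_top {S : EReal} (h : S < ⊤) (h0 : 0 < S) :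
    ∃ r : ℝ, S = r ∧ 0 < r ∧ toEnd S = 𝓝[<] r := by
  lift S to ℝ using ⟨h.ne, (lt_trans (EReal.bot_lt_coe 0) h0).ne'⟩
  exact ⟨S, rfl, by exact_mod_cast h0, toEnd_coe S⟩

theorem eventually_toEnd {S : EReal} {A : ℝ} (hA : A ∈ pseudoTime S) :
    ∀ᶠ s in toEnd S, A < s ∧ s ∈ pseudoTime S := by
  rw [toEnd, eventually_comap]
  have h1 : ∀ᶠ y : EReal in 𝓝[<] S, (A : EReal) < y ∧ y < S :=
    (Ioo_mem_nhdsLT hA.2)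
  filter_upwards [h1] with y hy s hs
  subst hs
  have : A < s := by exact_mod_cast hy.1
  exact ⟨this, hA.1.trans this.le, hy.2⟩

instance toEnd_isCountablyGenerated (S : EReal) : (toEnd S).IsCountablyGenerated := by
  unfold toEnd; infer_instance

theorem toEnd_neBot {S : EReal} (h0 : 0 < S) : (toEnd S).NeBot := by
  rcases eq_or_lt_of_le (le_top : S ≤ ⊤) with h | h
  · rw [h, toEnd_top]; infer_instance
  · obtain ⟨r, -, -, hr⟩ := toEnd_eq_of_lt_top h h0
    rw [hr]; infer_instance

theorem abs_le_pairNorm (a : ℝ) (b : E m) : |a| ≤ pairNorm a b := by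
  refine Real.le_sqrt_of_sq_le ?_
  rw [sq_abs, Real.norm_eq_abs, sq_abs]
  nlinarith [norm_nonneg b]

theorem norm_le_pairNorm_right {F : Type*} [SeminormedAddCommGroup F] (a : F) (b : E m) :
    ‖b‖ ≤ pairNorm a b := by
  refine Real.le_sqrt_of_sq_le ?_
  nlinarith [norm_nonneg a]

theorem norm_le_pairNorm_left {F : Type*} [SeminormedAddCommGroup F] (a : F) (b : E m) :
    ‖a‖ ≤ pairNorm a b := by
  refine Real.le_sqrt_of_sq_le ?_
  nlinarith [norm_nonneg b]

theorem pairNorm_le_add {F H : Type*} [SeminormedAddCommGroup F] [SeminormedAddCommGroup H]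
    (a : F) (b : H) : pairNorm a b ≤ ‖a‖ + ‖b‖ := by
  rw [pairNorm, Real.sqrt_le_left (by positivity)]
  nlinarith [norm_nonneg a, norm_nonneg b]

/-! ### Feasible space-time controls -/

namespace SpaceTimeControl

variable {c : SpaceTimeControl m l} {U : Set (E m)} {V : Set (E l)} {T : ℝ} {u₀ : E m}

theorem IsFeasible.lip_φ₀ (hc : c.IsFeasible U V T u₀) {A : ℝ} (hA : A ∈ pseudoTime c.S) (a b : ℝ) :
    ‖c.φ₀ (clamp A a) - c.φ₀ (clamp A b)‖ ≤ 1 * |a - b| := by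
  have hmem := fun s => Icc_subset_pseudoTime hA (clamp_mem hA.1 s)
  have h1 := hc.isControl.lipschitz _ (hmem a) _ (hmem b)
  rw [one_mul] at h1 ⊢
  exact (abs_le_pairNorm _ _).trans (h1.trans (abs_clamp_sub_le A a b))

theorem IsFeasible.lip_φ (hc : c.IsFeasible U V T u₀) {A : ℝ} (hA : A ∈ pseudoTime c.S) (a b : ℝ) :
    ‖c.φ (clamp A a) - c.φ (clamp A b)‖ ≤ 1 * |a - b| := by
  have hmem := fun s => Icc_subset_pseudoTime hA (clamp_mem hA.1 s)
  have h1 := hc.isControl.lipschitz _ (hmem a) _ (hmem b)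
  rw [one_mul] at h1 ⊢
  exact (norm_le_pairNorm_right _ _).trans (h1.trans (abs_clamp_sub_le A a b))

/-- Feasibility gives the sign of the derivative only almost everywhere; being Lipschitz, `φ₀` is
the integral of its derivative. -/
theorem IsFeasible.mono (hc : c.IsFeasible U V T u₀) {A : ℝ} (hA : A ∈ pseudoTime c.S) :
    Monotone fun s => c.φ₀ (clamp A s) := by
  have hL := lipschitzWith_of_norm_sub_le zero_le_one (hc.lip_φ₀ hA)
  have key : ∀ a ∈ Icc 0 A, ∀ b ∈ Icc 0 A, a ≤ b → c.φ₀ a ≤ c.φ₀ b := by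
    intro a ha b hb hab
    have h1 := (lipschitz_ac hL a b).integral_deriv_eq_sub
    simp only [clamp_of_mem ha, clamp_of_mem hb] at h1
    have h2 : 0 ≤ ∫ s in a..b, deriv (fun s => c.φ₀ (clamp A s)) s := by
      refine intervalIntegral.integral_nonneg_of_ae_restrict hab ?_
      rw [Filter.EventuallyLE, ae_restrict_iff' measurableSet_Icc]
      have hne : ∀ᵐ s : ℝ, s ≠ a := by simp [ae_iff, measure_singleton]
      filter_upwards [hc.isControl.deriv_nonneg, ae_mem_Ioo ha hb, hne] with s hs1 hs2 hsa hs
      have hs3 := hs2 (by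
        rw [uIoc_of_le hab]; exact ⟨lt_of_le_of_ne hs.1 hsa.symm, hs.2⟩)
      rw [(clamp_eventuallyEq hs3 c.φ₀).deriv_eq]
      exact hs1 (Icc_subset_pseudoTime hA (Ioo_subset_Icc_self hs3))
    linarith
  exact fun a b hab => key _ (clamp_mem hA.1 a) _ (clamp_mem hA.1 b) (clamp_mono A hab)

theorem IsFeasible.monotoneOn (hc : c.IsFeasible U V T u₀) :
    MonotoneOn c.φ₀ (pseudoTime c.S) := by
  intro a ha b hb hab
  have := hc.mono hb hab
  simpa only [clamp_of_mem ⟨ha.1, hab⟩, clamp_of_mem (right_mem_Icc.2 hb.1)] using this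

theorem IsFeasible.integral_speed (hc : c.IsFeasible U V T u₀) {A : ℝ} (hA : A ∈ pseudoTime c.S)
    {a b : ℝ} (ha : a ∈ Icc 0 A) (hb : b ∈ Icc 0 A) :
    ∫ s in a..b, (|deriv (fun s => c.φ₀ (clamp A s)) s| + ‖deriv (fun s => c.φ (clamp A s)) s‖)
      = b - a := by
  have : ∫ s in a..b, (1 : ℝ) = b - a := by simp
  rw [← this]
  refine intervalIntegral.integral_congr_ae ?_
  filter_upwards [hc.isControl.deriv_nonneg, hc.arcLength, ae_mem_Ioo ha hb] with s h1 h2 h3 hs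
  have hs' := h3 hs
  have hsS := Icc_subset_pseudoTime hA (Ioo_subset_Icc_self hs')
  rw [(clamp_eventuallyEq hs' c.φ₀).deriv_eq, (clamp_eventuallyEq hs' c.φ).deriv_eq,
    abs_of_nonneg (h1 hsS), h2 hsS]

theorem IsFeasible.le_T (hc : c.IsFeasible U V T u₀) {s : ℝ} (hs : s ∈ pseudoTime c.S) :
    c.φ₀ s ≤ T := by
  have := toEnd_neBot hc.isControl.pos_S
  refine ge_of_tendsto hc.tendsto_φ₀ ?_
  filter_upwards [eventually_toEnd hs] with r hr using hc.monotoneOn hs hr.2 hr.1.le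

theorem IsFeasible.mem_Icc (hc : c.IsFeasible U V T u₀) {s : ℝ} (hs : s ∈ pseudoTime c.S) :
    c.φ₀ s ∈ Icc 0 T := ⟨hc.isControl.nonneg_φ₀ s hs, hc.le_T hs⟩

/-- Pseudo-time is arc length, shared between the elapsed time and the variation of the control. The
gauges of the approximating controls are computed from it. -/
theorem IsFeasible.eVariationOn_eq (hc : c.IsFeasible U V T u₀) {s : ℝ}
    (hs : s ∈ pseudoTime c.S) : (eVariationOn c.φ (Icc 0 s)).toReal = s - c.φ₀ s := by
  have hL := lipschitzWith_of_norm_sub_le zero_le_one (hc.lip_φ hs)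
  have hL0 := lipschitzWith_of_norm_sub_le zero_le_one (hc.lip_φ₀ hs)
  have h0 : (0 : ℝ) ∈ Icc 0 s := ⟨le_rfl, hs.1⟩
  have hs' : s ∈ Icc 0 s := ⟨hs.1, le_rfl⟩
  have e : eVariationOn c.φ (Icc 0 s) = eVariationOn (fun r => c.φ (clamp s r)) (Icc 0 s) :=
    eVariationOn.eq_of_eqOn fun r hr => by simp only [clamp_of_mem hr]
  rw [e, ac_eVariationOn_eq hs.1 (lipschitz_ac hL 0 s)]
  have h1 := hc.integral_speed hs h0 hs'
  have hm := hc.mono hs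
  have habs : ∀ r, |deriv (fun s' => c.φ₀ (clamp s s')) r|
      = deriv (fun s' => c.φ₀ (clamp s s')) r := fun r => abs_of_nonneg hm.deriv_nonneg
  simp only [habs] at h1
  rw [intervalIntegral.integral_add (intervalIntegrable_deriv_lipschitz hL0 0 s)
    (ac_intervalIntegrable_deriv (lipschitz_ac hL 0 s)).norm,
    (lipschitz_ac hL0 0 s).integral_deriv_eq_sub, clamp_of_mem h0, clamp_of_mem hs',
    hc.isControl.φ₀_zero] at h1
  linarith

/-- Where `φ₀` moves, `ψ` agrees almost everywhere with the given ordinary control. -/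
theorem IsGraphCompletion.ae_ψ_eq {u : ℝ → E m} {v : ℝ → E l}
    (hc : c.IsGraphCompletion U V T u₀ u v) {A : ℝ} (hA : A ∈ pseudoTime c.S) :
    ∀ᵐ s : ℝ, s ∈ Ioo 0 A → deriv c.φ₀ s ≠ 0 → c.ψ s = v (c.φ₀ s) := by
  have hf := hc.isFeasible
  -- N collects the times at which `φ₀` has a plateau, countably many by monotonicity. Off N the
  -- covering condition pins down the only pseudo-time with that value. T is discarded too, since
  -- covering concerns t < T only.
  set N : Set ℝ := {t | ∃ a b, a ∈ pseudoTime c.S ∧ b ∈ pseudoTime c.S ∧ a < b ∧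
    c.φ₀ a = t ∧ c.φ₀ b = t} with hN
  have hNc : N.Countable := hf.monotoneOn.countable_setOfPred_two_preimages
  filter_upwards [ae_deriv_eq_zero_of_mem_countable (hf.mono hA)
    (hNc.union (countable_singleton T))] with s hs hsA hne
  have hsI := Ioo_subset_Icc_self hsA
  have hsS := Icc_subset_pseudoTime hA hsI
  have h1 : c.φ₀ s ∉ N ∪ {T} := fun hc' => by
    rw [(clamp_eventuallyEq hsA c.φ₀).deriv_eq, clamp_of_mem hsI] at hs
    exact hne (hs hc')
  have h2 := hf.mem_Icc hsS
  obtain ⟨r, hr, hr1, -, hr3⟩ := hc.covers (c.φ₀ s)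
    ⟨h2.1, lt_of_le_of_ne h2.2 fun e => h1 (Or.inr e)⟩
  rcases lt_trichotomy r s with h | h | h
  · exact absurd (Or.inl ⟨r, s, hr, hsS, h, hr1, rfl⟩) h1
  · rw [← h, hr3, hr1]
  · exact absurd (Or.inl ⟨s, r, hsS, hr, h, rfl, hr1⟩) h1

end SpaceTimeControl

/-- Space-time solutions follow their controls. -/
theorem System.IsSpaceTimeSolution.followsOn {sys : System n m l} {T R B K : ℝ} {v : ℝ → E l}
    (hF : IsField sys.U (sys.drift T v R) (sys.coupling R) B K) {u₀ : E m} {u : ℝ → E m}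
    {x₀ : E n} {c : SpaceTimeControl m l} {ξ : ℝ → E n}
    (hc : c.IsGraphCompletion sys.U sys.V T u₀ u v) (hξ : sys.IsSpaceTimeSolution x₀ c ξ)
    (hR : ∀ s ∈ pseudoTime c.S, ‖ξ s‖ ≤ R) {A : ℝ} (hA : A ∈ pseudoTime c.S) :
    FollowsOn (sys.drift T v R) (sys.coupling R) (Icc 0 A) c.φ₀ c.φ ξ id (K * (B + 1)) := by
  obtain ⟨-, hac, hd⟩ := hξ
  have hf := hc.isFeasible
  have hL := lipschitzWith_of_norm_sub_le zero_le_one (hf.lip_φ hA)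
  have hL0 := lipschitzWith_of_norm_sub_le zero_le_one (hf.lip_φ₀ hA)
  have hcl : ∀ {X : Type} (g : ℝ → X), EqOn (fun s => g (clamp A s)) g (Icc 0 A) :=
    fun g s hs => by simp only [clamp_of_mem hs]
  have hξc : Continuous fun s => ξ (clamp A s) :=
    continuous_comp_clamp hA.1 (hac A hA).continuousOn
  refine FollowsOn.congr (hF.followsOn_of_integral (θ := fun s => c.φ₀ (clamp A s))
    (φ := fun s => c.φ (clamp A s)) (ξ := fun s => ξ (clamp A s)) (ℓ := id)
    (hf.mono hA) hL0 hL.continuous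
    (fun s => hf.isControl.mem_U _ (Icc_subset_pseudoTime hA (clamp_mem hA.1 s))) hξc
    (I := Icc 0 A) ordConnected_Icc (fun a _ b _ => lipschitz_ac hL a b) ?_ ?_)
    (hcl c.φ₀) (hcl c.φ) (hcl ξ)
  · intro a ha b hb
    simp only [clamp_of_mem ha, clamp_of_mem hb]
    rw [← ac_integral_deriv ((hac A hA).mono (uIcc_subset_uIcc_of_mem ha hb))]
    refine intervalIntegral.integral_congr_ae ?_
    filter_upwards [hd, ae_mem_Ioo ha hb, hc.ae_ψ_eq hA] with s hs1 hs2 hs3 hs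
    have hs' := hs2 hs
    have hsI := Ioo_subset_Icc_self hs'
    have hsS := Icc_subset_pseudoTime hA hsI
    rw [(hs1 hsS).deriv, sys.velocity_eq v (by rw [clamp_of_mem hsI]; exact hR s hsS)
      (by rw [clamp_of_mem hsI]; exact hf.mem_Icc hsS),
      (clamp_eventuallyEq hs' c.φ).deriv_eq, (clamp_eventuallyEq hs' c.φ₀).deriv_eq]
    simp only [clamp_of_mem hsI]
    congr 1
    -- The drift is multiplied by `φ₀'`: either it disappears, or `ψ` is `v ∘ φ₀` there. Hence `ψ`
    -- can be eliminated from the space-time system.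
    by_cases h0 : deriv c.φ₀ s = 0
    · rw [h0, zero_smul, zero_smul]
    · rw [hs3 hs' h0]
  · intro a ha b hb _
    exact (hf.integral_speed hA ha hb).le

end Conversion

/-! ### Arc-length reparametrization -/

section ArcLength

variable {n m l : ℕ}

/-- The length of the curve `(θ, φ)` over `[0,s]`. -/
noncomputable def arcLen (θ : ℝ → ℝ) (φ : ℝ → E m) (s : ℝ) : ℝ :=
  ∫ r in (0 : ℝ)..s, (|deriv θ r| + ‖deriv φ r‖)

section

variable {θ : ℝ → ℝ} {φ : ℝ → E m} (hθ : LipschitzWith 1 θ) (hφ : LipschitzWith 1 φ)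

include hθ hφ

theorem intervalIntegrable_speed (a b : ℝ) :
    IntervalIntegrable (fun r => |deriv θ r| + ‖deriv φ r‖) volume a b :=
  (intervalIntegrable_deriv_lipschitz hθ a b).abs.add
    (ac_intervalIntegrable_deriv (lipschitz_ac hφ a b)).norm

theorem arcLen_sub (a b : ℝ) :
    arcLen θ φ b - arcLen θ φ a = ∫ r in a..b, (|deriv θ r| + ‖deriv φ r‖) :=
  intervalIntegral.integral_interval_sub_left (intervalIntegrable_speed hθ hφ 0 b)
    (intervalIntegrable_speed hθ hφ 0 a)

theorem arcLen_mono : Monotone (arcLen θ φ) := fun a b hab => by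
  have h : 0 ≤ ∫ r in a..b, (|deriv θ r| + ‖deriv φ r‖) :=
    intervalIntegral.integral_nonneg hab fun _ _ => by positivity
  rw [← arcLen_sub hθ hφ a b] at h
  linarith

theorem abs_add_norm_le_arcLen (a b : ℝ) :
    |θ b - θ a| + ‖φ b - φ a‖ ≤ |arcLen θ φ b - arcLen θ φ a| := by
  wlog hab : a ≤ b generalizing a b
  · rw [abs_sub_comm, norm_sub_rev, abs_sub_comm (arcLen θ φ b)]
    exact this b a (by linarith)
  rw [abs_of_nonneg (sub_nonneg.2 (arcLen_mono hθ hφ hab)), arcLen_sub hθ hφ,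
    intervalIntegral.integral_add (intervalIntegrable_deriv_lipschitz hθ a b).abs
      (ac_intervalIntegrable_deriv (lipschitz_ac hφ a b)).norm]
  refine add_le_add ?_ ?_
  · rw [← (lipschitz_ac hθ a b).integral_deriv_eq_sub]
    exact intervalIntegral.abs_integral_le_integral_abs hab
  · rw [← ac_integral_deriv (lipschitz_ac hφ a b)]
    exact intervalIntegral.norm_integral_le_integral_norm hab

theorem arcLen_lipschitz : LipschitzWith 2 (arcLen θ φ) := by
  refine LipschitzWith.of_dist_le_mul fun a b => ?_
  rw [Real.dist_eq, Real.dist_eq, arcLen_sub hθ hφ b a, ← Real.norm_eq_abs]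
  refine intervalIntegral.norm_integral_le_of_norm_le_const fun r _ => ?_
  have h1 : ‖deriv θ r‖ ≤ (1 : NNReal) := norm_deriv_le_of_lipschitz hθ
  have h2 : ‖deriv φ r‖ ≤ (1 : NNReal) := norm_deriv_le_of_lipschitz hφ
  rw [Real.norm_of_nonneg (by positivity), ← Real.norm_eq_abs]
  push_cast at *
  linarith

theorem ae_hasDerivAt_arcLen :
    ∀ᵐ s, HasDerivAt (arcLen θ φ) (|deriv θ s| + ‖deriv φ s‖) s := by
  have h : LocallyIntegrable (fun r => |deriv θ r| + ‖deriv φ r‖) volume := by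
    intro s
    refine ⟨Icc (s - 1) (s + 1), Icc_mem_nhds (by linarith) (by linarith), ?_⟩
    rw [integrableOn_Icc_iff_integrableOn_Ioc,
      ← intervalIntegrable_iff_integrableOn_Ioc_of_le (by linarith)]
    exact intervalIntegrable_speed hθ hφ _ _
  filter_upwards [LocallyIntegrable.ae_hasDerivAt_integral h] with s hs using hs 0

/-- A curve parametrized by the arc length of another parametrization has unit speed. -/
theorem ae_unit_speed (hm : Monotone θ) {θ' : ℝ → ℝ} {φ' : ℝ → E m} {J : Set ℝ} (hJ : IsOpen J)
    (hrange : ∀ r ∈ J, ∃ s, arcLen θ φ s = r)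
    (hθ' : ∀ s, arcLen θ φ s ∈ J → θ' (arcLen θ φ s) = θ s)
    (hφ' : ∀ s, arcLen θ φ s ∈ J → φ' (arcLen θ φ s) = φ s)
    (hdθ : ∀ᵐ r : ℝ, r ∈ J → DifferentiableAt ℝ θ' r)
    (hdφ : ∀ᵐ r : ℝ, r ∈ J → DifferentiableAt ℝ φ' r) :
    ∀ᵐ r : ℝ, r ∈ J → deriv θ' r + ‖deriv φ' r‖ = 1 := by
  set L := arcLen θ φ with hL
  set D : Set ℝ := {s | DifferentiableAt ℝ θ s ∧ DifferentiableAt ℝ φ s ∧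
    HasDerivAt L (|deriv θ s| + ‖deriv φ s‖) s} with hD
  have hDn : volume Dᶜ = 0 := by
    have h1 : ∀ᵐ s, s ∈ D := by
      filter_upwards [hθ.ae_differentiableAt_real, hφ.ae_differentiableAt_real,
        ae_hasDerivAt_arcLen hθ hφ] with s h1 h2 h3 using ⟨h1, h2, h3⟩
    rwa [ae_iff] at h1
  -- Two sets of pseudo-times have null image under L: the points of non-differentiability, because
  -- L is Lipschitz, and the critical points, by the one-dimensional Sard lemma. Elsewhere the chain
  -- rule divides by the positive speed.
  set Z : Set ℝ := {s | HasDerivAt L 0 s} with hZ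
  have h1 : volume (L '' Dᶜ) = 0 :=
    volume_image_eq_zero_of_lipschitz (arcLen_lipschitz hθ hφ) hDn
  have h2 : volume (L '' Z) = 0 := by
    refine addHaar_image_eq_zero_of_det_fderivWithin_eq_zero volume
      (f' := fun _ => (0 : ℝ →L[ℝ] ℝ)) (fun s hs => ?_) fun s _ => by simp
    have := (show HasDerivAt L 0 s from hs).hasFDerivAt.hasFDerivWithinAt (s := Z)
    simpa using this
  filter_upwards [measure_eq_zero_iff_ae_notMem.1 h1, measure_eq_zero_iff_ae_notMem.1 h2,
    hdθ, hdφ] with r hr1 hr2 hr3 hr4 hrJ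
  obtain ⟨s, rfl⟩ := hrange r hrJ
  have hsD : s ∈ D := by
    by_contra hc
    exact hr1 ⟨s, hc, rfl⟩
  obtain ⟨-, -, hLs⟩ := hsD
  have hpos : |deriv θ s| + ‖deriv φ s‖ ≠ 0 := fun h0 => hr2 ⟨s, by rw [h0] at hLs; exact hLs, rfl⟩
  have hnear : ∀ᶠ s' in 𝓝 s, L s' ∈ J := hLs.continuousAt.eventually (hJ.mem_nhds hrJ)
  have e1 : deriv θ s = deriv θ' (L s) * (|deriv θ s| + ‖deriv φ s‖) := by
    have h3 := (hr3 hrJ).hasDerivAt.comp s hLs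
    refine (HasDerivAt.congr_of_eventuallyEq h3 ?_).deriv
    filter_upwards [hnear] with s' hs' using (hθ' s' hs').symm
  have e2 : deriv φ s = (|deriv θ s| + ‖deriv φ s‖) • deriv φ' (L s) := by
    have h3 := (hr4 hrJ).hasDerivAt.scomp s hLs
    refine (HasDerivAt.congr_of_eventuallyEq h3 ?_).deriv
    filter_upwards [hnear] with s' hs' using (hφ' s' hs').symm
  set p := |deriv θ s| + ‖deriv φ s‖ with hp
  have hp0 : 0 < p := lt_of_le_of_ne (by positivity) hpos.symm
  have e3 : ‖deriv φ s‖ = p * ‖deriv φ' (L s)‖ := by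
    rw [e2, norm_smul, Real.norm_of_nonneg hp0.le]
  have e4 : |deriv θ s| = deriv θ' (L s) * p := by
    rw [abs_of_nonneg hm.deriv_nonneg, e1]
  have e5 : p * 1 = p * (deriv θ' (L s) + ‖deriv φ' (L s)‖) := by
    rw [mul_one]; nth_rw 1 [hp]; rw [e3, e4]; ring
  exact (mul_left_cancel₀ hp0.ne' e5).symm

end

/-- A bounded Lipschitz curve, not necessarily parametrized by arc length, that solves the
truncated space-time system, passes through the graph of `(u, x)`, and accumulates at the final
values. -/
structure System.IsLimitCurve (sys : System n m l) (x₀ : E n) (u₀ : E m) (T : ℝ) (u : ℝ → E m)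
    (v : ℝ → E l) (x : ℝ → E n) (R : ℝ) (θ : ℝ → ℝ) (φ : ℝ → E m) (ξ : ℝ → E n) (σ : ℝ → ℝ) :
    Prop where
  lip : ∀ a b, |θ a - θ b| + ‖φ a - φ b‖ ≤ |a - b|
  mono : Monotone θ
  mem_T : ∀ s, θ s ∈ Icc 0 T
  mem_U : ∀ s, φ s ∈ sys.U
  init : θ 0 = 0 ∧ φ 0 = u₀ ∧ ξ 0 = x₀
  bound : ∀ s, ‖ξ s‖ ≤ R
  continuous : Continuous ξ
  integral : ∀ a b, ξ b - ξ a = ∫ s in a..b, velocity (sys.drift T v R) (sys.coupling R) θ φ ξ s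
  σ_mono : MonotoneOn σ (Ico 0 T)
  σ_zero : σ 0 = 0
  graph : ∀ t ∈ Ico 0 T, θ (σ t) = t ∧ φ (σ t) = u t ∧ ξ (σ t) = x t
  final : ∃ s : ℕ → ℝ, (∀ j, 0 ≤ s j) ∧ Tendsto s atTop atTop ∧
    Tendsto (fun j => (ξ (s j), φ (s j))) atTop (𝓝 (x T, u T))

/-- The triple `(c, σ, ξ)` exhibits `x` as a graph completion solution. -/
def System.IsCompletionWitness (sys : System n m l) (x₀ : E n) (u₀ : E m) (T : ℝ) (u : ℝ → E m)
    (v : ℝ → E l) (x : ℝ → E n) (c : SpaceTimeControl m l) (σ : ℝ → ℝ) (ξ : ℝ → E n) : Prop :=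
  c.IsGraphCompletion sys.U sys.V T u₀ u v ∧ c.IsClock T u σ ∧
    sys.IsSpaceTimeSolution x₀ c ξ ∧
    (∀ t ∈ Ico 0 T, x t = ξ (σ t)) ∧
    (c.S < ⊤ → Tendsto ξ (toEnd c.S) (𝓝 (x T))) ∧
    (c.S = ⊤ → (∃ R : ℝ, ∀ s ∈ pseudoTime c.S, ‖ξ s‖ ≤ R) ∧
      ∃ s : ℕ → ℝ, StrictMono s ∧ (∀ j, 0 ≤ s j) ∧ Tendsto s atTop atTop ∧
        Tendsto (fun j => (ξ (s j), c.φ (s j))) atTop (𝓝 (x T, u T)))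

/-- The increments of θ, φ and ξ are dominated by those of the arc length L, so all three are
constant wherever L is, and any section of L transports them to arc-length parametrization. The
equation is transported through `FollowsOn`, which does not differentiate the possibly discontinuous
section. The last conclusion lets a curve of infinite length produce S = +∞. -/
theorem System.IsLimitCurve.exists_completionWitness {sys : System n m l} {x₀ : E n} {u₀ : E m}
    {T : ℝ} {u : ℝ → E m} {v : ℝ → E l} {x : ℝ → E n} {R : ℝ} {θ : ℝ → ℝ} {φ : ℝ → E m}
    {ξ : ℝ → E n} {σ : ℝ → ℝ} {B K : ℝ}
    (hF : IsField sys.U (sys.drift T v R) (sys.coupling R) B K) (hT : 0 < T)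
    (hv : IsOrdinaryControl sys.V T v) (h : sys.IsLimitCurve x₀ u₀ T u v x R θ φ ξ σ) :
    ∃ c σ' ξ', sys.IsCompletionWitness x₀ u₀ T u v x c σ' ξ' ∧
      ((∀ M, ∃ s, M < arcLen θ φ s) → c.S = ⊤) := by
  have hθL : LipschitzWith 1 θ := LipschitzWith.of_dist_le_mul fun a b => by
    have := h.lip a b
    have := norm_nonneg (φ a - φ b)
    rw [Real.dist_eq, Real.dist_eq]; push_cast; linarith
  have hφL : LipschitzWith 1 φ := LipschitzWith.of_dist_le_mul fun a b => by
    have := h.lip a b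
    have := abs_nonneg (θ a - θ b)
    rw [dist_eq_norm, Real.dist_eq]; push_cast; linarith
  set L := arcLen θ φ with hL
  have hLm : Monotone L := arcLen_mono hθL hφL
  have hLc : Continuous L := (arcLen_lipschitz hθL hφL).continuous
  have hL0 : L 0 = 0 := intervalIntegral.integral_same
  have hinc := abs_add_norm_le_arcLen hθL hφL
  have hθinc : ∀ a b, |θ b - θ a| ≤ |L b - L a| := fun a b => by
    have := hinc a b; have := norm_nonneg (φ b - φ a); linarith
  have hφinc : ∀ a b, ‖φ b - φ a‖ ≤ |L b - L a| := fun a b => by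
    have := hinc a b; have := abs_nonneg (θ b - θ a); linarith
  have hξinc : ∀ a b, ‖ξ b - ξ a‖ ≤ B * |L b - L a| := fun a b => by
    rw [h.integral a b, arcLen_sub hθL hφL a b]
    refine (intervalIntegral.norm_integral_le_abs_of_norm_le
      (Eventually.of_forall fun r => hF.norm_velocity_le (h.mem_U r))
      ((intervalIntegrable_speed hθL hφL a b).const_mul B)).trans ?_
    rw [intervalIntegral.integral_const_mul, abs_mul, abs_of_nonneg hF.nonneg_B]
  have hfol : FollowsOn (sys.drift T v R) (sys.coupling R) univ θ φ ξ L (K * (B + 1)) :=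
    hF.followsOn_of_integral h.mono hθL hφL.continuous h.mem_U h.continuous ordConnected_univ
      (fun a _ b _ => lipschitz_ac hφL a b) (fun a _ b _ => h.integral a b)
      (fun a _ b _ _ => (arcLen_sub hθL hφL a b).ge)
  have hC : 0 ≤ K * (B + 1) := mul_nonneg hF.nonneg_K (by linarith [hF.nonneg_B])
  set S : EReal := ⨆ s : ℝ, (L s : EReal) with hS
  have hLle : ∀ s, (L s : EReal) ≤ S := fun s => le_iSup (fun s : ℝ => (L s : EReal)) s
  have hlt : ∀ r : ℝ, (r : EReal) < S → ∃ s, r < L s := fun r hr => by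
    obtain ⟨s, hs⟩ := lt_iSup_iff.1 hr
    exact ⟨s, EReal.coe_lt_coe_iff.1 hs⟩
  have hsec : ∀ r, ∃ s, r ∈ pseudoTime S → 0 ≤ s ∧ L s = r := by
    intro r
    by_cases hr : r ∈ pseudoTime S
    · obtain ⟨s, hs⟩ := hlt r hr.2
      have hs0 : 0 ≤ s := by
        by_contra hc
        have := hLm (not_le.1 hc).le
        rw [hL0] at this
        linarith [hr.1]
      obtain ⟨s', hs', e⟩ := intermediate_value_Icc hs0 hLc.continuousOn
        (show r ∈ Icc (L 0) (L s) from ⟨by rw [hL0]; exact hr.1, hs.le⟩)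
      exact ⟨s', fun _ => ⟨hs'.1, e⟩⟩
    · exact ⟨0, fun hc => absurd hc hr⟩
  choose τ hτ using hsec
  have heqθ : ∀ a b, L a = L b → θ a = θ b := fun a b hab => by
    have := hθinc a b
    rw [hab, sub_self, abs_zero] at this
    have := abs_nonpos_iff.1 this
    linarith
  have heqφ : ∀ a b, L a = L b → φ a = φ b := fun a b hab => by
    have := hφinc a b
    rw [hab, sub_self, abs_zero] at this
    exact (sub_eq_zero.1 (norm_le_zero_iff.1 this)).symm
  have heqξ : ∀ a b, L a = L b → ξ a = ξ b := fun a b hab => by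
    have := hξinc a b
    rw [hab, sub_self, abs_zero, mul_zero] at this
    exact (sub_eq_zero.1 (norm_le_zero_iff.1 this)).symm
  have hτL : ∀ s, L s ∈ pseudoTime S → L (τ (L s)) = L s := fun s hs => (hτ _ hs).2
  -- From t the time still has to reach (t + T)/2, which takes positive length; hence the clock
  -- stays strictly below the supremum S.
  have hstrict : ∀ t ∈ Ico 0 T, L (σ t) ∈ pseudoTime S := by
    intro t ht
    have ht' : (t + T) / 2 ∈ Ico 0 T := ⟨by linarith [ht.1], by linarith [ht.2]⟩
    have h1 := h.σ_mono ht ht' (by linarith [ht.2])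
    have h2 := hθinc (σ t) (σ ((t + T) / 2))
    rw [(h.graph t ht).1, (h.graph _ ht').1, abs_of_nonneg (by linarith [ht.2]),
      abs_of_nonneg (sub_nonneg.2 (hLm h1))] at h2
    have h0 := h.σ_mono ⟨le_rfl, hT⟩ ht ht.1
    rw [h.σ_zero] at h0
    refine ⟨hL0 ▸ hLm h0, lt_of_lt_of_le ?_ (hLle (σ ((t + T) / 2)))⟩
    rw [EReal.coe_lt_coe_iff]
    linarith [ht.2]
  have hS0 : 0 < S := by
    have h1 := hstrict 0 ⟨le_rfl, hT⟩
    rw [h.σ_zero, hL0] at h1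
    exact_mod_cast h1.2
  set θ' : ℝ → ℝ := fun r => θ (τ r) with hθ'
  set φ' : ℝ → E m := fun r => φ (τ r) with hφ'
  set ξ' : ℝ → E n := fun r => ξ (τ r) with hξ'
  -- Taking `ψ = v ∘ θ'` makes it Borel and gives the covering condition along the clock.
  let c : SpaceTimeControl m l := ⟨θ', φ', fun r => v (θ' r), S⟩
  have hcS : c.S = S := rfl
  have hlip' : ∀ r ∈ pseudoTime S, ∀ q ∈ pseudoTime S,
      |θ' r - θ' q| + ‖φ' r - φ' q‖ ≤ |r - q| := fun r hr q hq => by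
    have := hinc (τ q) (τ r)
    rwa [← hL, (hτ q hq).2, (hτ r hr).2] at this
  have hmono' : ∀ r ∈ pseudoTime S, ∀ q ∈ pseudoTime S, r ≤ q → θ' r ≤ θ' q := by
    intro r hr q hq hrq
    rcases le_total (τ r) (τ q) with hle | hle
    · exact h.mono hle
    · refine (heqθ _ _ (le_antisymm ?_ (hLm hle))).le
      rw [(hτ q hq).2, (hτ r hr).2]; exact hrq
  have hat : ∀ s, L s ∈ pseudoTime S → θ' (L s) = θ s ∧ φ' (L s) = φ s ∧ ξ' (L s) = ξ s :=
    fun s hs => ⟨heqθ _ _ (hτL s hs), heqφ _ _ (hτL s hs), heqξ _ _ (hτL s hs)⟩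
  have hclip : ∀ A ∈ pseudoTime S, ∀ a b, |θ' (clamp A a) - θ' (clamp A b)|
      + ‖φ' (clamp A a) - φ' (clamp A b)‖ ≤ |a - b| := fun A hA a b =>
    (hlip' _ (Icc_subset_pseudoTime hA (clamp_mem hA.1 a)) _
      (Icc_subset_pseudoTime hA (clamp_mem hA.1 b))).trans (abs_clamp_sub_le A a b)
  have hcθ : ∀ A ∈ pseudoTime S, LipschitzWith 1 fun s => θ' (clamp A s) := fun A hA =>
    LipschitzWith.of_dist_le_mul fun a b => by
      have := hclip A hA a b
      have := norm_nonneg (φ' (clamp A a) - φ' (clamp A b))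
      rw [Real.dist_eq, Real.dist_eq]; push_cast; linarith
  have hcφ : ∀ A ∈ pseudoTime S, LipschitzWith 1 fun s => φ' (clamp A s) := fun A hA =>
    LipschitzWith.of_dist_le_mul fun a b => by
      have := hclip A hA a b
      have := abs_nonneg (θ' (clamp A a) - θ' (clamp A b))
      rw [dist_eq_norm, Real.dist_eq]; push_cast; linarith
  have hcm : ∀ A ∈ pseudoTime S, Monotone fun s => θ' (clamp A s) := fun A hA a b hab =>
    hmono' _ (Icc_subset_pseudoTime hA (clamp_mem hA.1 a)) _
      (Icc_subset_pseudoTime hA (clamp_mem hA.1 b)) (clamp_mono A hab)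
  have hsol : ∀ A ∈ pseudoTime S, Continuous (fun s => ξ' (clamp A s)) ∧
      ∀ a b, ξ' (clamp A b) - ξ' (clamp A a) = ∫ s in a..b,
        velocity (sys.drift T v R) (sys.coupling R) (fun s => θ' (clamp A s))
          (fun s => φ' (clamp A s)) (fun s => ξ' (clamp A s)) s := by
    intro A hA
    refine hF.integral_of_followsOn (C := K * (B + 1)) (hcm A hA) (hclip A hA)
      (fun s => h.mem_U _) hC ?_
    refine hfol.comp (ℓ' := id) hC (τ := fun s => τ (clamp A s)) (fun _ _ => trivial)
      fun a _ b _ => ?_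
    rw [(hτ _ (Icc_subset_pseudoTime hA (clamp_mem hA.1 a))).2,
      (hτ _ (Icc_subset_pseudoTime hA (clamp_mem hA.1 b))).2]
    exact abs_clamp_sub_le A b a
  have hae_diffθ : ∀ A ∈ pseudoTime S, ∀ᵐ r : ℝ, r ∈ Ioo 0 A → DifferentiableAt ℝ θ' r := by
    intro A hA
    filter_upwards [(hcθ A hA).ae_differentiableAt_real] with r hr hrA
    exact hr.congr_of_eventuallyEq (clamp_eventuallyEq hrA θ').symm
  have hae_diffφ : ∀ A ∈ pseudoTime S, ∀ᵐ r : ℝ, r ∈ Ioo 0 A → DifferentiableAt ℝ φ' r := by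
    intro A hA
    filter_upwards [(hcφ A hA).ae_differentiableAt_real] with r hr hrA
    exact hr.congr_of_eventuallyEq (clamp_eventuallyEq hrA φ').symm
  have harc : ∀ᵐ r : ℝ, r ∈ pseudoTime S → deriv θ' r + ‖deriv φ' r‖ = 1 := by
    refine ae_pseudoTime fun A hA => ?_
    have hsub : ∀ r ∈ Ioo 0 A, r ∈ pseudoTime S := fun r hr =>
      Icc_subset_pseudoTime hA (Ioo_subset_Icc_self hr)
    exact ae_unit_speed hθL hφL h.mono isOpen_Ioo (fun r hr => ⟨_, (hτ r (hsub r hr)).2⟩)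
      (fun s hs => (hat s (hsub _ hs)).1) (fun s hs => (hat s (hsub _ hs)).2.1)
      (hae_diffθ A hA) (hae_diffφ A hA)
  have hctl : c.IsControl sys.U sys.V 1 := by
    refine ⟨hS0, fun s _ => (h.mem_T _).1, fun s _ => h.mem_U _, fun s hs r hr => ?_, ?_, ?_, ?_,
      ?_, fun s _ => hv.2 _ (h.mem_T _)⟩
    · rw [one_mul]
      exact (pairNorm_le_add _ _).trans (hlip' s hs r hr)
    · have h0 : (0 : ℝ) ∈ pseudoTime S := ⟨le_rfl, by exact_mod_cast hS0⟩
      have := heqθ (τ 0) 0 (by rw [(hτ 0 h0).2, hL0])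
      exact this.trans h.init.1
    · refine ae_pseudoTime fun A hA => Eventually.of_forall fun s hs => ?_
      have := (hcm A hA).deriv_nonneg (x := s)
      rwa [(clamp_eventuallyEq hs θ').deriv_eq] at this
    · filter_upwards [harc] with s hs hsS using (hs hsS).le
    · have h1 : LipschitzOnWith 1 θ' (pseudoTime S) :=
        LipschitzOnWith.of_dist_le_mul fun a ha b hb => by
          have := hlip' a ha b hb
          have := norm_nonneg (φ' a - φ' b)
          rw [Real.dist_eq, Real.dist_eq]; push_cast; linarith
      have h2 : Measurable ((pseudoTime S).domRestrict θ') :=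
        (continuousOn_iff_continuous_domRestrict.1 h1.continuousOn).measurable
      have h3 : Measurable fun r : pseudoTime S => (⟨θ' r, h.mem_T _⟩ : Icc (0 : ℝ) T) :=
        h2.subtype_mk
      exact hv.1.comp h3
  have hlimT : Tendsto θ' (toEnd S) (𝓝 T) := by
    rw [tendsto_order]
    refine ⟨fun a ha => ?_, fun a ha =>
      Eventually.of_forall fun r => lt_of_le_of_lt (h.mem_T _).2 ha⟩
    obtain ⟨t, ht1, ht2⟩ := exists_between (max_lt ha hT)
    have ht : t ∈ Ico 0 T := ⟨(le_max_right _ _).trans ht1.le, ht2⟩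
    filter_upwards [eventually_toEnd (hstrict t ht)] with r hr
    have h1 := hmono' _ (hstrict t ht) r hr.2 hr.1.le
    rw [(hat _ (hstrict t ht)).1, (h.graph t ht).1] at h1
    exact lt_of_lt_of_le (lt_of_le_of_lt (le_max_left _ _) ht1) h1
  have h0S : (0 : ℝ) ∈ pseudoTime S := ⟨le_rfl, by exact_mod_cast hS0⟩
  have hfeas : c.IsFeasible sys.U sys.V T u₀ :=
    ⟨hctl, harc, (heqφ (τ 0) 0 (by rw [(hτ 0 h0S).2, hL0])).trans h.init.2.1, hlimT⟩
  obtain ⟨sq, hsq0, hsq, hsqlim⟩ := h.final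
  have hfin : S < ⊤ → Tendsto φ' (toEnd S) (𝓝 (u T)) ∧ Tendsto ξ' (toEnd S) (𝓝 (x T)) := by
    intro hlt'
    obtain ⟨r₀, hr₀, -, hend⟩ := toEnd_eq_of_lt_top hlt' hS0
    have hLlim : Tendsto (fun j => L (sq j)) atTop (𝓝 r₀) := by
      have h1 : Tendsto L atTop (𝓝 r₀) := by
        refine tendsto_atTop_isLUB hLm ⟨?_, ?_⟩
        · rintro _ ⟨s, rfl⟩
          have := hLle s
          rw [hr₀] at this
          exact EReal.coe_le_coe_iff.1 this
        · intro b hb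
          have : S ≤ b := iSup_le fun s => EReal.coe_le_coe_iff.2 (hb ⟨s, rfl⟩)
          rw [hr₀] at this
          exact EReal.coe_le_coe_iff.1 this
      exact h1.comp hsq
    -- Comparison with the final sequence, whose arc lengths tend to r₀ = S, upgrades the
    -- accumulation point to a limit, with a Lipschitz rate.
    have hboundary : ∀ r ∈ pseudoTime S, ‖φ' r - u T‖ ≤ |r - r₀| ∧
        ‖ξ' r - x T‖ ≤ B * |r - r₀| := by
      intro r hr
      have ha : Tendsto (fun j => |r - L (sq j)|) atTop (𝓝 |r - r₀|) :=
        (tendsto_const_nhds.sub hLlim).abs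
      refine ⟨le_of_tendsto_of_tendsto ((tendsto_const_nhds (x := φ' r)).sub
        (hsqlim.snd_nhds)).norm ha (Eventually.of_forall fun j => ?_),
        le_of_tendsto_of_tendsto ((tendsto_const_nhds (x := ξ' r)).sub
        (hsqlim.fst_nhds)).norm (ha.const_mul B) (Eventually.of_forall fun j => ?_)⟩
      · have := hφinc (sq j) (τ r)
        rwa [(hτ r hr).2] at this
      · have := hξinc (sq j) (τ r)
        rwa [(hτ r hr).2] at this
    have hz : Tendsto (fun r : ℝ => |r - r₀|) (toEnd S) (𝓝 0) := by
      rw [hend]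
      have : Continuous fun r : ℝ => |r - r₀| := by fun_prop
      simpa using (this.tendsto r₀).mono_left nhdsWithin_le_nhds
    have hev : ∀ᶠ r in toEnd S, r ∈ pseudoTime S :=
      (eventually_toEnd h0S).mono fun r hr => hr.2
    refine ⟨tendsto_iff_norm_sub_tendsto_zero.2 (squeeze_zero'
      (Eventually.of_forall fun _ => norm_nonneg _) (hev.mono fun r hr => (hboundary r hr).1) hz),
      tendsto_iff_norm_sub_tendsto_zero.2 (squeeze_zero'
      (Eventually.of_forall fun _ => norm_nonneg _) (hev.mono fun r hr => (hboundary r hr).2)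
      (by simpa using hz.const_mul B))⟩
  have hinf : S = ⊤ → ∃ s : ℕ → ℝ, StrictMono s ∧ (∀ j, 0 ≤ s j) ∧ Tendsto s atTop atTop ∧
      Tendsto (fun j => (ξ' (s j), φ' (s j))) atTop (𝓝 (x T, u T)) := by
    intro htop
    have hunb : Tendsto L atTop atTop := tendsto_atTop_atTop_of_monotone hLm fun b => by
      obtain ⟨s, hs⟩ := hlt b (htop ▸ EReal.coe_lt_top b)
      exact ⟨s, hs.le⟩
    -- The final pseudo-times are not assumed increasing; a subsequence makes their arc lengths
    -- strictly increasing.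
    obtain ⟨k, hk, hk'⟩ := strictMono_subseq_of_tendsto_atTop (hunb.comp hsq)
    have hmem : ∀ j, L (sq (k j)) ∈ pseudoTime S := fun j =>
      ⟨hL0 ▸ hLm (hsq0 _), htop ▸ EReal.coe_lt_top _⟩
    refine ⟨fun j => L (sq (k j)), hk', fun j => (hmem j).1,
      (hunb.comp hsq).comp hk.tendsto_atTop, ?_⟩
    have := hsqlim.comp hk.tendsto_atTop
    refine this.congr fun j => ?_
    simp only [Function.comp, (hat _ (hmem j)).2.1, (hat _ (hmem j)).2.2]
  refine ⟨c, fun t => L (σ t), ξ', ⟨⟨hfeas, fun t ht => ?_, fun hc => (hfin hc).1, fun hc => ?_⟩,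
    ⟨fun a ha b hb hab => hLm (h.σ_mono ha hb hab), by simp only [h.σ_zero, hL0],
      fun t ht => hstrict t ht, fun t ht => ?_⟩, ⟨?_, fun s hs => ?_, ?_⟩, fun t ht => ?_,
      fun hc => (hfin hc).2, fun hc => ⟨⟨R, fun s _ => h.bound _⟩, hinf hc⟩⟩, fun hM => ?_⟩
  · have h1 := hat _ (hstrict t ht)
    have h2 := h.graph t ht
    refine ⟨L (σ t), hstrict t ht, h1.1.trans h2.1, h1.2.1.trans h2.2.1, ?_⟩
    change v (θ' (L (σ t))) = v t
    rw [h1.1, h2.1]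
  · obtain ⟨s, h1, h2, h3, h4⟩ := hinf hc
    exact ⟨s, h1, h2, h3, h4.snd_nhds⟩
  · have h1 := hat _ (hstrict t ht)
    have h2 := h.graph t ht
    exact ⟨h1.1.trans h2.1, h1.2.1.trans h2.2.1⟩
  · exact (heqξ (τ 0) 0 (by rw [(hτ 0 h0S).2, hL0])).trans h.init.2.2
  · refine LipschitzOnWith.absolutelyContinuousOnInterval (K := ⟨B, hF.nonneg_B⟩) ?_
    rw [uIcc_of_le hs.1]
    refine LipschitzOnWith.of_dist_le_mul fun a ha b hb => ?_
    have := hξinc (τ b) (τ a)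
    rw [(hτ a (Icc_subset_pseudoTime hs ha)).2, (hτ b (Icc_subset_pseudoTime hs hb)).2] at this
    rw [dist_eq_norm, Real.dist_eq]
    exact this
  · refine ae_pseudoTime fun A hA => ?_
    have hv1 := hF.intervalIntegrable_velocity (hcθ A hA) (hcφ A hA).continuous
      (fun s => h.mem_U _) (hsol A hA).1 (lipschitz_ac (hcφ A hA) 0 A)
    filter_upwards [ae_hasDerivAt_of_integral hv1 fun a _ b _ => (hsol A hA).2 a b] with s hs hsA
    have h1 := (hs hsA).congr_of_eventuallyEq (clamp_eventuallyEq hsA ξ').symm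
    have hsI := Ioo_subset_Icc_self hsA
    rw [sys.velocity_eq v (θ := fun s => θ' (clamp A s)) (ξ := fun s => ξ' (clamp A s))
      (h.bound _) (h.mem_T _), (clamp_eventuallyEq hsA θ').deriv_eq,
      (clamp_eventuallyEq hsA φ').deriv_eq] at h1
    simp only [clamp_of_mem hsI] at h1
    exact h1
  · rw [(hat _ (hstrict t ht)).2.2, (h.graph t ht).2.2]
  · refine iSup_eq_top.2 fun b hb => ?_
    induction b with
    | bot => exact ⟨0, EReal.bot_lt_coe _⟩
    | coe b =>
      obtain ⟨s, hs⟩ := hM b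
      exact ⟨s, EReal.coe_lt_coe_iff.2 hs⟩
    | top => exact absurd hb (lt_irrefl _)

end ArcLength

/-! ### Limit solutions are graph completion solutions -/

section Characterization

variable {n m l : ℕ}

theorem IsField.norm_sub_le {U : Set (E m)} {f : E n → E m → ℝ → E n}
    {G : E n → E m → E m →L[ℝ] E n} {B K : ℝ} (hF : IsField U f G B K) {θ : ℝ → ℝ}
    {φ : ℝ → E m} {ξ : ℝ → E n} (hlip : ∀ a b, |θ a - θ b| + ‖φ a - φ b‖ ≤ |a - b|)
    (hφU : ∀ s, φ s ∈ U) {C : ℝ} (h : FollowsOn f G univ θ φ ξ id C) (a b : ℝ) :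
    ‖ξ b - ξ a‖ ≤ B * |b - a| + C * (b - a) ^ 2 := by
  have h1 := h a trivial b trivial
  have h2 := hF.norm_increment_le (θ := θ) (ξ a) (hφU a) b
  have h3 := mul_le_mul_of_nonneg_left (hlip b a) hF.nonneg_B
  have h4 := norm_add_le (ξ b - ξ a - increment f G θ φ (ξ a) a b)
    (increment f G θ φ (ξ a) a b)
  rw [sub_add_cancel] at h4
  simp only [id] at h1
  linarith

/-- The inverse of the gauge `t + Var_{[0,t]}(u)`, extended to the line by clamping. -/
theorem exists_gauge_section {u : ℝ → E m} {T : ℝ} (hT : 0 ≤ T)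
    (hu : AbsolutelyContinuousOnInterval u 0 T) :
    ∃ τ : ℝ → ℝ, (∀ s, τ s ∈ Icc 0 T) ∧ Monotone τ ∧ (∀ t ∈ Icc 0 T, τ (gauge u t) = t) ∧
      (∀ a b, |τ a - τ b| + ‖u (τ a) - u (τ b)‖ ≤ |a - b|) ∧
      ∀ a b, |gauge u (τ b) - gauge u (τ a)| ≤ |b - a| := by
  have h0 : (0 : ℝ) ∈ Icc 0 T := ⟨le_rfl, hT⟩
  have hTm : T ∈ Icc 0 T := ⟨hT, le_rfl⟩
  have hstep : ∀ p ∈ Icc 0 T, ∀ q ∈ Icc 0 T,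
      |p - q| + ‖u p - u q‖ ≤ |gauge u p - gauge u q| := by
    intro p hp q hq
    rcases le_total p q with hle | hle
    · have := le_gauge_sub hu hp hq hle
      rw [abs_sub_comm, norm_sub_rev, abs_sub_comm (gauge u p), abs_of_nonneg (sub_nonneg.2 hle)]
      exact this.trans (le_abs_self _)
    · have := le_gauge_sub hu hq hp hle
      rw [abs_of_nonneg (sub_nonneg.2 hle)]
      exact this.trans (le_abs_self _)
  have hgm : ∀ p ∈ Icc 0 T, ∀ q ∈ Icc 0 T, p ≤ q → gauge u p ≤ gauge u q := by
    intro p hp q hq hpq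
    have := le_gauge_sub hu hp hq hpq
    have := norm_nonneg (u q - u p)
    linarith
  have hex : ∀ s, ∃ t ∈ Icc 0 T, gauge u t = clamp (gauge u T) s := by
    intro s
    have h1 : 0 ≤ gauge u T := by simpa [gauge_zero] using hgm 0 h0 T hTm hT
    obtain ⟨t, ht, e⟩ := intermediate_value_Icc hT (continuousOn_gauge hT hu)
      (show clamp (gauge u T) s ∈ Icc (gauge u 0) (gauge u T) by
        rw [gauge_zero]; exact clamp_mem h1 s)
    exact ⟨t, ht, e⟩
  choose τ hτ hτ' using hex
  have hinj : ∀ p ∈ Icc 0 T, ∀ q ∈ Icc 0 T, gauge u p = gauge u q → p = q := by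
    intro p hp q hq e
    have h1 := hstep p hp q hq
    rw [e, sub_self, abs_zero] at h1
    have h2 := norm_nonneg (u p - u q)
    have h3 : |p - q| ≤ 0 := by linarith
    linarith [abs_nonpos_iff.1 h3]
  have hgap : ∀ a b, |gauge u (τ b) - gauge u (τ a)| ≤ |b - a| := fun a b => by
    rw [hτ', hτ']; exact abs_clamp_sub_le _ _ _
  refine ⟨τ, hτ, fun a b hab => ?_, fun t ht => ?_, fun a b => ?_, hgap⟩
  · by_contra hc
    have hc' := not_le.1 hc
    have h1 := hgm _ (hτ b) _ (hτ a) hc'.le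
    have h2 := clamp_mono (gauge u T) hab
    rw [← hτ', ← hτ'] at h2
    exact hc'.ne (hinj _ (hτ b) _ (hτ a) (le_antisymm h1 h2))
  · refine hinj _ (hτ _) _ ht ?_
    rw [hτ', clamp_of_mem]
    refine ⟨?_, hgm _ ht _ hTm ht.2⟩
    simpa [gauge_zero] using hgm 0 h0 t ht ht.1
  · exact (hstep _ (hτ a) _ (hτ b)).trans (hgap b a)

/-- A fixed ultrafilter selects limits at all pseudo-times simultaneously, in place of an
Arzelà–Ascoli extraction and diagonal subsequences. -/
theorem exists_hyperfilter_lim {X : Type*} [TopologicalSpace X] {s : Set X} (hs : IsCompact s)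
    {y : ℕ → X} (hy : ∀ k, y k ∈ s) :
    ∃ z ∈ s, Tendsto y (hyperfilter ℕ : Filter ℕ) (𝓝 z) := by
  obtain ⟨z, hz, h⟩ := hs.ultrafilter_le_nhds ((hyperfilter ℕ).map y)
    (le_principal_iff.2 (Filter.mem_map.2 (Filter.Eventually.of_forall hy)))
  exact ⟨z, hz, h⟩

/-- In gauge parametrization the controls are uniformly Lipschitz, so their pointwise ultrafilter
limit is a Lipschitz space-time curve, and the trajectories pass to the limit through `FollowsOn`.
Jumps of u become arcs along which the limit time stands still. -/
theorem System.IsBVLocSLimitSolution.isGraphCompletionSolution {sys : System n m l}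
    (hsys : sys.Assumptions) {x₀ : E n} {u₀ : E m} {T : ℝ} (hT : 0 < T) {u : ℝ → E m}
    {v : ℝ → E l} (hv : IsOrdinaryControl sys.V T v) {x : ℝ → E n}
    (h : sys.IsBVLocSLimitSolution x₀ u₀ T u v x) :
    sys.IsGraphCompletionSolution x₀ u₀ T u v x := by
  obtain ⟨uk, xk, hS, hloc, -, ε, sj, κ, hε0, -, hεlim, -, hsj0, hsj, -, -, hend⟩ := h
  obtain ⟨R, hR⟩ := hS.equibounded
  obtain ⟨B, K, hF⟩ := hsys.exists_isField hT.le hv R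
  have h0m : (0 : ℝ) ∈ Icc 0 T := ⟨le_rfl, hT.le⟩
  have hTm : T ∈ Icc 0 T := ⟨hT.le, le_rfl⟩
  choose τ hτm hτmono hτg hτlip hτgap using fun k => exists_gauge_section hT.le (hS.isAC k).1
  set C := K * (B + 1) with hCdef
  have hC : 0 ≤ C := mul_nonneg hF.nonneg_K (by linarith [hF.nonneg_B])
  have hφkU : ∀ k s, uk k (τ k s) ∈ sys.U := fun k s => (hS.isAC k).2 _ (hτm k s)
  have hfol : ∀ k, FollowsOn (sys.drift T v R) (sys.coupling R) univ (τ k)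
      (fun s => uk k (τ k s)) (fun s => xk k (τ k s)) id C := fun k =>
    ((hS.isSolution k).followsOn hF hT.le (hS.isAC k) (hR k)).comp (ℓ' := id) hC
      (fun s _ => hτm k s) (fun a _ b _ => hτgap k a b)
  have hle : ((hyperfilter ℕ : Ultrafilter ℕ) : Filter ℕ) ≤ atTop := Nat.hyperfilter_le_atTop
  choose θ hθm hθ using fun s => exists_hyperfilter_lim (isCompact_Icc (a := (0 : ℝ)) (b := T))
    (fun k => hτm k s)
  choose φ hφU hφ using fun s => exists_hyperfilter_lim hsys.isCompact_U (fun k => hφkU k s)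
  choose ξ hξm hξ using fun s => exists_hyperfilter_lim (isCompact_closedBall (0 : E n) R)
    (y := fun k => xk k (τ k s)) (fun k => by simpa using hR k _ (hτm k s))
  -- Equibounded variation on some [0, t'] with t < t' < T keeps the gauges at t bounded; their
  -- limit is the clock.
  have hσex : ∀ t, ∃ r, t ∈ Ico 0 T →
      Tendsto (fun k => gauge (uk k) t) (hyperfilter ℕ : Filter ℕ) (𝓝 r) := by
    intro t
    by_cases ht : t ∈ Ico 0 T
    · have ht' : (t + T) / 2 ∈ Ioo 0 T := ⟨by linarith [ht.1], by linarith [ht.2]⟩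
      obtain ⟨M, hM⟩ := hloc _ ht'
      obtain ⟨r, -, hr⟩ := exists_hyperfilter_lim (isCompact_Icc (a := (0 : ℝ)) (b := t + M))
        (y := fun k => gauge (uk k) t) (fun k => by
          have h1 : (eVariationOn (uk k) (Icc 0 t)).toReal ≤ M :=
            ENNReal.toReal_le_coe_of_le_coe ((eVariationOn.mono _
              (Icc_subset_Icc_right (by linarith [ht.2]))).trans (hM k))
          exact ⟨add_nonneg ht.1 ENNReal.toReal_nonneg, add_le_add le_rfl h1⟩)
      exact ⟨r, fun _ => hr⟩
    · exact ⟨0, fun hc => absurd hc ht⟩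
  choose σ hσ using hσex
  have hlip : ∀ a b, |θ a - θ b| + ‖φ a - φ b‖ ≤ |a - b| := fun a b =>
    le_of_tendsto (((hθ a).sub (hθ b)).abs.add ((hφ a).sub (hφ b)).norm)
      (Eventually.of_forall fun k => hτlip k a b)
  have hmono : Monotone θ := fun a b hab =>
    le_of_tendsto_of_tendsto (hθ a) (hθ b) (Eventually.of_forall fun k => hτmono k hab)
  have hlimfol : FollowsOn (sys.drift T v R) (sys.coupling R) univ θ φ ξ id C :=
    hF.followsOn_of_tendsto (fun s _ => hθ s) (fun s _ => hφ s) (fun s _ => hξ s)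
      (fun k s _ => hφkU k s) (fun s _ => hφU s) hfol
  obtain ⟨hξc, hint⟩ := hF.integral_of_followsOn hmono hlip hφU hC hlimfol
  have hτ0 : ∀ k, τ k 0 = 0 := fun k => by
    have := hτg k 0 h0m
    rwa [gauge_zero] at this
  have hgraph : ∀ t ∈ Ico 0 T, θ (σ t) = t ∧ φ (σ t) = u t ∧ ξ (σ t) = x t := by
    intro t ht
    have ht' : t ∈ Icc 0 T := Ico_subset_Icc_self ht
    -- The gauge of `u_k` at t tends to σ(t), and there the reparametrized curves take exactly the
    -- values t, `u_k(t)`, `x_k(t)`. Estimates uniform in k carry this over to σ(t).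
    have hz : Tendsto (fun k => |σ t - gauge (uk k) t|) (hyperfilter ℕ : Filter ℕ) (𝓝 0) := by
      simpa using ((tendsto_const_nhds (x := σ t)).sub (hσ t ht)).abs
    refine ⟨?_, ?_, ?_⟩
    · refine tendsto_nhds_unique (hθ (σ t)) (tendsto_iff_norm_sub_tendsto_zero.2
        (squeeze_zero (fun _ => norm_nonneg _) (fun k => ?_) hz))
      have h1 := hτlip k (σ t) (gauge (uk k) t)
      rw [hτg k t ht'] at h1
      have h2 := norm_nonneg (uk k (τ k (σ t)) - uk k t)
      rw [Real.norm_eq_abs]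
      linarith
    · refine tendsto_nhds_unique (hφ (σ t)) ?_
      have h2 : Tendsto (fun k => uk k (τ k (σ t)) - uk k t) (hyperfilter ℕ : Filter ℕ) (𝓝 0) := by
        refine squeeze_zero_norm (fun k => ?_) hz
        have h1 := hτlip k (σ t) (gauge (uk k) t)
        rw [hτg k t ht'] at h1
        have := abs_nonneg (τ k (σ t) - t)
        linarith
      simpa using h2.add ((hS.tendsto_u t ht').mono_left hle)
    · refine tendsto_nhds_unique (hξ (σ t)) ?_
      have h2 : Tendsto (fun k => xk k (τ k (σ t)) - xk k t) (hyperfilter ℕ : Filter ℕ) (𝓝 0) := by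
        have h3 := (hz.const_mul B).add ((hz.pow 2).const_mul C)
        simp only [mul_zero, ne_eq, OfNat.ofNat_ne_zero, not_false_eq_true, zero_pow, add_zero] at h3
        refine squeeze_zero_norm (fun k => ?_) h3
        have h1 := hF.norm_sub_le (hτlip k) (hφkU k) (hfol k) (gauge (uk k) t) (σ t)
        rwa [hτg k t ht', ← sq_abs (σ t - _)] at h1
      simpa using h2.add ((hS.tendsto_x t ht').mono_left hle)
  have hfinal : ∀ j, ‖ξ (sj j) - x T‖ ≤ ε j ∧ ‖φ (sj j) - u T‖ ≤ ε j := by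
    intro j
    have hev : ∀ᶠ k in (hyperfilter ℕ : Filter ℕ),
        pairNorm (xk k (τ k (sj j)) - xk k T) (uk k (τ k (sj j)) - uk k T) ≤ ε j := by
      refine hle ?_
      filter_upwards [eventually_gt_atTop (κ j)] with k hk
      obtain ⟨t, ht, h1, h2⟩ := hend j k hk
      -- The time in the endpoint condition has gauge s_j, so it is the value of the section τ_k at
      -- s_j.
      have h3 := hτg k t (Ico_subset_Icc_self ht)
      rw [gauge, h1] at h3
      rwa [h3]
    exact ⟨le_of_tendsto ((hξ (sj j)).sub ((hS.tendsto_x T hTm).mono_left hle)).norm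
        (hev.mono fun k hk => (norm_le_pairNorm_left _ _).trans hk),
      le_of_tendsto ((hφ (sj j)).sub ((hS.tendsto_u T hTm).mono_left hle)).norm
        (hev.mono fun k hk => (norm_le_pairNorm_right _ _).trans hk)⟩
  have hεj : Tendsto (fun j : ℕ => ε j) atTop (𝓝 0) := hεlim.comp tendsto_natCast_atTop_atTop
  have hcurve : sys.IsLimitCurve x₀ u₀ T u v x R θ φ ξ σ := by
    refine ⟨hlip, hmono, hθm, hφU, ⟨?_, ?_, ?_⟩, fun s => by simpa using hξm s, hξc, hint, ?_, ?_,
      hgraph, sj, hsj0, hsj, ?_⟩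
    · exact tendsto_nhds_unique (hθ 0) (by simp only [hτ0]; exact tendsto_const_nhds)
    · exact tendsto_nhds_unique (hφ 0) (by simp only [hτ0, hS.init]; exact tendsto_const_nhds)
    · exact tendsto_nhds_unique (hξ 0) (by
        simp only [hτ0, (hS.isSolution _).1]; exact tendsto_const_nhds)
    · intro a ha b hb hab
      refine le_of_tendsto_of_tendsto (hσ a ha) (hσ b hb) (Eventually.of_forall fun k => ?_)
      have := le_gauge_sub (hS.isAC k).1 (Ico_subset_Icc_self ha) (Ico_subset_Icc_self hb) hab
      have := norm_nonneg (uk k b - uk k a)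
      simp only
      linarith
    · exact tendsto_nhds_unique (hσ 0 ⟨le_rfl, hT⟩) (by
        simp only [gauge_zero]; exact tendsto_const_nhds)
    · refine Tendsto.prodMk_nhds ?_ ?_
      · exact tendsto_iff_norm_sub_tendsto_zero.2
          (squeeze_zero (fun _ => norm_nonneg _) (fun j => (hfinal j).1) hεj)
      · exact tendsto_iff_norm_sub_tendsto_zero.2
          (squeeze_zero (fun _ => norm_nonneg _) (fun j => (hfinal j).2) hεj)
  obtain ⟨c, σ', ξ', hw, -⟩ := hcurve.exists_completionWitness hF hT hv
  exact ⟨c, σ', ξ', hw⟩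

end Characterization

/-! ### Extending a graph completion beyond a finite final pseudo-time -/

section Extension

variable {n m l : ℕ}

/-- Feasibility bounds the Euclidean norm of increments; unit speed in the sum norm improves this to
the sum norm itself. -/
theorem SpaceTimeControl.IsFeasible.abs_add_norm_le {c : SpaceTimeControl m l} {U : Set (E m)}
    {V : Set (E l)} {T : ℝ} {u₀ : E m} (hc : c.IsFeasible U V T u₀) {a b : ℝ}
    (ha : a ∈ pseudoTime c.S) (hb : b ∈ pseudoTime c.S) :
    |c.φ₀ a - c.φ₀ b| + ‖c.φ a - c.φ b‖ ≤ |a - b| := by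
  obtain ⟨A, hA, haA, hbA⟩ : ∃ A ∈ pseudoTime c.S, a ∈ Icc 0 A ∧ b ∈ Icc 0 A := by
    rcases le_total a b with h | h
    · exact ⟨b, hb, ⟨ha.1, h⟩, ⟨hb.1, le_rfl⟩⟩
    · exact ⟨a, ha, ⟨ha.1, le_rfl⟩, ⟨hb.1, h⟩⟩
  have hL0 := lipschitzWith_of_norm_sub_le zero_le_one (hc.lip_φ₀ hA)
  have hL := lipschitzWith_of_norm_sub_le zero_le_one (hc.lip_φ hA)
  have h1 := abs_add_norm_le_arcLen hL0 hL b a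
  rw [arcLen_sub hL0 hL, hc.integral_speed hA hbA haA] at h1
  simpa only [clamp_of_mem haA, clamp_of_mem hbA] using h1

/-- The trajectory of a graph completion with finite final pseudo-time, stopped at that time. -/
theorem System.IsSpaceTimeSolution.exists_stopped {sys : System n m l} {T R B K : ℝ} {v : ℝ → E l}
    (hF : IsField sys.U (sys.drift T v R) (sys.coupling R) B K) {u₀ : E m} {u : ℝ → E m}
    {x₀ : E n} {c : SpaceTimeControl m l} {ξ : ℝ → E n}
    (hc : c.IsGraphCompletion sys.U sys.V T u₀ u v) (hξ : sys.IsSpaceTimeSolution x₀ c ξ)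
    (hR : ∀ s ∈ pseudoTime c.S, ‖ξ s‖ ≤ R) {r : ℝ} (hr : 0 < r) (hS : c.S = r) {w : E m} {y : E n}
    (hw : w ∈ sys.U) (hφ : Tendsto c.φ (𝓝[<] r) (𝓝 w)) (hy : Tendsto ξ (𝓝[<] r) (𝓝 y)) :
    ∃ (θ : ℝ → ℝ) (φ : ℝ → E m) (ζ : ℝ → E n),
      (∀ a b, |θ a - θ b| + ‖φ a - φ b‖ ≤ |a - b|) ∧ Monotone θ ∧ (∀ s, θ s ∈ Icc 0 T) ∧
      (∀ s, φ s ∈ sys.U) ∧ (∀ s, ‖ζ s‖ ≤ R) ∧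
      FollowsOn (sys.drift T v R) (sys.coupling R) univ θ φ ζ id (K * (B + 1)) ∧
      (∀ s, 0 ≤ s → s < r → θ s = c.φ₀ s ∧ φ s = c.φ s ∧ ζ s = ξ s) ∧
      ∀ s, r ≤ s → θ s = T ∧ φ s = w ∧ ζ s = y := by
  have hf := hc.isFeasible
  have hθT : Tendsto c.φ₀ (𝓝[<] r) (𝓝 T) := by
    have := hf.tendsto_φ₀
    rwa [hS, toEnd_coe] at this
  have hC : 0 ≤ K * (B + 1) := mul_nonneg hF.nonneg_K (by linarith [hF.nonneg_B])
  -- The curve is not controlled at r itself, so it is stopped at pseudo-times q_k increasing to r;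
  -- the following condition then passes to the limit.
  set q : ℕ → ℝ := fun k => r - r / (k + 1) with hq
  have hq0 : ∀ k, 0 ≤ q k := fun k => sub_nonneg.2 (div_le_self hr.le (by linarith [k.cast_nonneg (α := ℝ)]))
  have hqr : ∀ k, q k < r := fun k => sub_lt_self _ (by positivity)
  have hqm : ∀ k, q k ∈ pseudoTime c.S := fun k => ⟨hq0 k, by rw [hS]; exact_mod_cast hqr k⟩
  have hqlim : Tendsto q atTop (𝓝[<] r) := by
    refine tendsto_nhdsWithin_iff.2 ⟨?_, Eventually.of_forall hqr⟩
    have h1 : Tendsto (fun k : ℕ => r / ((k : ℝ) + 1)) atTop (𝓝 0) :=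
      tendsto_const_nhds.div_atTop (tendsto_natCast_atTop_atTop.atTop_add tendsto_const_nhds)
    simpa using (tendsto_const_nhds (x := r)).sub h1
  have hlim : ∀ {X : Type} [TopologicalSpace X] (g : ℝ → X) (z : X), Tendsto g (𝓝[<] r) (𝓝 z) →
      ∀ s, Tendsto (fun k => g (clamp (q k) s)) atTop (𝓝 (if s < r then g (max 0 s) else z)) := by
    intro X _ g z hg s
    split_ifs with hs
    · refine tendsto_const_nhds.congr' ?_
      have h2 : Tendsto q atTop (𝓝 r) := hqlim.mono_right nhdsWithin_le_nhds
      filter_upwards [h2.eventually (eventually_gt_nhds hs)] with k hk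
      rw [clamp, min_eq_right hk.le]
    · refine (hg.comp hqlim).congr fun k => ?_
      have : q k ≤ s := (hqr k).le.trans (not_lt.1 hs)
      simp only [Function.comp, clamp, min_eq_left this, max_eq_right (hq0 k)]
  have l1 := hlim c.φ₀ T hθT
  have l2 := hlim c.φ w hφ
  have l3 := hlim ξ y hy
  have hclm : ∀ k s, clamp (q k) s ∈ pseudoTime c.S := fun k s =>
    Icc_subset_pseudoTime (hqm k) (clamp_mem (hq0 k) s)
  have hmaxm : ∀ s, s < r → max 0 s ∈ pseudoTime c.S := fun s hs =>
    ⟨le_max_left _ _, by rw [hS]; exact_mod_cast max_lt hr hs⟩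
  have hUm : ∀ s, (if s < r then c.φ (max 0 s) else w) ∈ sys.U := fun s => by
    split_ifs with hs
    · exact hf.isControl.mem_U _ (hmaxm s hs)
    · exact hw
  refine ⟨_, _, _, fun a b => ?_, fun a b hab => ?_, fun s => ?_, hUm, fun s => ?_,
    hF.followsOn_of_tendsto (F := atTop) (fun s _ => l1 s) (fun s _ => l2 s) (fun s _ => l3 s)
      (fun k s _ => hf.isControl.mem_U _ (hclm k s)) (fun s _ => hUm s) fun k => ?_,
    fun s hs hs' => ?_, fun s hs => ?_⟩
  · exact le_of_tendsto (((l1 a).sub (l1 b)).abs.add ((l2 a).sub (l2 b)).norm)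
      (Eventually.of_forall fun k => (hf.abs_add_norm_le (hclm k a) (hclm k b)).trans
        (abs_clamp_sub_le _ _ _))
  · exact le_of_tendsto_of_tendsto (l1 a) (l1 b) (Eventually.of_forall fun k => hf.mono (hqm k) hab)
  · exact isClosed_Icc.mem_of_tendsto (l1 s) (Eventually.of_forall fun k => hf.mem_Icc (hclm k s))
  · exact le_of_tendsto (l3 s).norm (Eventually.of_forall fun k => hR _ (hclm k s))
  · exact (hξ.followsOn hF hc hR (hqm k)).comp hC (fun s _ => clamp_mem (hq0 k) s)
      fun a _ b _ => abs_clamp_sub_le _ b a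
  · simp only [hs', if_true, max_eq_right hs, and_self]
  · simp only [hs.not_gt, if_false, and_self]

theorem velocity_congr {f : E n → E m → ℝ → E n} {G : E n → E m → E m →L[ℝ] E n}
    {θ θ' : ℝ → ℝ} {φ φ' : ℝ → E m} {ξ ξ' : ℝ → E n} {s : ℝ} (hθ : θ =ᶠ[𝓝 s] θ')
    (hφ : φ =ᶠ[𝓝 s] φ') (hξ : ξ s = ξ' s) :
    velocity f G θ φ ξ s = velocity f G θ' φ' ξ' s := by
  rw [velocity, velocity, hθ.deriv_eq, hφ.deriv_eq, hθ.eq_of_nhds, hφ.eq_of_nhds, hξ]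

/-- Two integral curves that agree at time `r` can be concatenated. -/
theorem IsField.integral_concat {U : Set (E m)} {f : E n → E m → ℝ → E n}
    {G : E n → E m → E m →L[ℝ] E n} {B K : ℝ} (hF : IsField U f G B K) {r : ℝ}
    {θ θ₁ θ₂ : ℝ → ℝ} {φ φ₁ φ₂ : ℝ → E m} {ξ ξ₁ ξ₂ : ℝ → E n}
    (hlip : ∀ a b, |θ a - θ b| + ‖φ a - φ b‖ ≤ |a - b|) (hφU : ∀ s, φ s ∈ U)
    (hξ : Continuous ξ)
    (h₁ : ∀ s, s ≤ r → θ s = θ₁ s ∧ φ s = φ₁ s ∧ ξ s = ξ₁ s)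
    (h₂ : ∀ s, r ≤ s → θ s = θ₂ s ∧ φ s = φ₂ s ∧ ξ s = ξ₂ s)
    (i₁ : ∀ a b, ξ₁ b - ξ₁ a = ∫ s in a..b, velocity f G θ₁ φ₁ ξ₁ s)
    (i₂ : ∀ a b, ξ₂ b - ξ₂ a = ∫ s in a..b, velocity f G θ₂ φ₂ ξ₂ s) (a b : ℝ) :
    ξ b - ξ a = ∫ s in a..b, velocity f G θ φ ξ s := by
  have hθL : LipschitzWith 1 θ := LipschitzWith.of_dist_le_mul fun a b => by
    have := hlip a b
    have := norm_nonneg (φ a - φ b)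
    rw [Real.dist_eq, Real.dist_eq]; push_cast; linarith
  have hφL : LipschitzWith 1 φ := LipschitzWith.of_dist_le_mul fun a b => by
    have := hlip a b
    have := abs_nonneg (θ a - θ b)
    rw [dist_eq_norm, Real.dist_eq]; push_cast; linarith
  have hi : ∀ b, IntervalIntegrable (velocity f G θ φ ξ) volume r b := fun b =>
    hF.intervalIntegrable_velocity hθL hφL.continuous hφU hξ (lipschitz_ac hφL _ _)
  have hne : ∀ᵐ s : ℝ, s ≠ r := by simp [ae_iff, measure_singleton]
  have key : ∀ b, ξ b - ξ r = ∫ s in r..b, velocity f G θ φ ξ s := by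
    intro b
    rcases le_total b r with hb | hb
    · rw [(h₁ b hb).2.2, (h₁ r le_rfl).2.2, i₁ r b]
      refine intervalIntegral.integral_congr_ae ?_
      filter_upwards [hne] with s hs hsI
      rw [uIoc_of_ge hb] at hsI
      have hsr : s < r := lt_of_le_of_ne hsI.2 hs
      have hev : ∀ᶠ q in 𝓝 s, q ≤ r := (eventually_lt_nhds hsr).mono fun q hq => hq.le
      exact velocity_congr (hev.mono fun q hq => (h₁ q hq).1.symm)
        (hev.mono fun q hq => (h₁ q hq).2.1.symm) (h₁ s hsr.le).2.2.symm
    · rw [(h₂ b hb).2.2, (h₂ r le_rfl).2.2, i₂ r b]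
      refine intervalIntegral.integral_congr_ae ?_
      filter_upwards [hne] with s hs hsI
      rw [uIoc_of_le hb] at hsI
      have hsr : r < s := hsI.1
      have hev : ∀ᶠ q in 𝓝 s, r ≤ q := (eventually_gt_nhds hsr).mono fun q hq => hq.le
      exact velocity_congr (hev.mono fun q hq => (h₂ q hq).1.symm)
        (hev.mono fun q hq => (h₂ q hq).2.1.symm) (h₂ s hsr.le).2.2.symm
  rw [← intervalIntegral.integral_interval_sub_left (hi b) (hi a), ← key, ← key]
  abel

/-- Short nonconstant Lipschitz paths out of a point of a set with the Whitney property. -/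
theorem WhitneyProperty.exists_short_path {U : Set (E m)} (hW : WhitneyProperty U)
    (hU : U.Nontrivial) {w : E m} (hw : w ∈ U) {ρ : ℝ} (hρ : 0 < ρ) :
    ∃ (q : ℝ → E m) (d : ℝ), 0 < d ∧ d ≤ ρ ∧ (∀ a b, ‖q a - q b‖ ≤ |a - b|) ∧ (∀ s, q s ∈ U) ∧
      q 0 = w ∧ q d ≠ w := by
  obtain ⟨C, -, hC⟩ := hW
  obtain ⟨w', hw', hne⟩ := hU.exists_ne w
  obtain ⟨p, hp, hpU, hp0, hp1, -⟩ := hC w hw w' hw'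
  obtain ⟨τ, hτm, -, hτg, hτlip, -⟩ := exists_gauge_section zero_le_one hp
  set g := gauge p 1 with hg
  have hlip : ∀ a b, ‖p (τ a) - p (τ b)‖ ≤ |a - b| := fun a b => by
    have := hτlip a b
    have := abs_nonneg (τ a - τ b)
    linarith
  have hcont : Continuous fun s => p (τ s) := (lipschitzWith_of_norm_sub_le zero_le_one
    (f := fun s => p (τ s)) fun a b => by rw [one_mul]; exact hlip a b).continuous
  have h0 : p (τ 0) = w := by
    have := hτg 0 ⟨le_rfl, zero_le_one⟩
    rw [gauge_zero] at this
    rw [this, hp0]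
  have h1 : p (τ g) = w' := by rw [hg, hτg 1 ⟨zero_le_one, le_rfl⟩, hp1]
  have hg0 : 0 ≤ g := by
    have := le_gauge_sub hp (a := 0) (b := 1) ⟨le_rfl, zero_le_one⟩ ⟨zero_le_one, le_rfl⟩ zero_le_one
    rw [gauge_zero] at this
    have := norm_nonneg (p 1 - p 0)
    linarith
  -- The path is cut at its last visit s₀ to w: after s₀ it differs from w, so any short piece
  -- starting there is nonconstant.
  have hcomp : IsCompact (Icc 0 g ∩ {s | p (τ s) = w}) :=
    isCompact_Icc.inter_right (isClosed_eq hcont continuous_const)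
  obtain ⟨s₀, ⟨hs₀, hs₀w⟩, hmax⟩ := hcomp.exists_isGreatest ⟨0, ⟨le_rfl, hg0⟩, h0⟩
  have hs₀g : s₀ < g := lt_of_le_of_ne hs₀.2 fun e => hne (by rw [← h1, ← e]; exact hs₀w)
  refine ⟨fun s => p (τ (s₀ + s)), min ρ (g - s₀), lt_min hρ (sub_pos.2 hs₀g), min_le_left _ _,
    fun a b => ?_, fun s => hpU _ (hτm _), by simpa using hs₀w, fun hc => ?_⟩
  · have := hlip (s₀ + a) (s₀ + b)
    rwa [add_sub_add_left_eq_sub] at this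
  · have hd : 0 < min ρ (g - s₀) := lt_min hρ (sub_pos.2 hs₀g)
    have := hmax (a := s₀ + min ρ (g - s₀)) ⟨⟨by linarith [hs₀.1], by
      linarith [min_le_right ρ (g - s₀)]⟩, hc⟩
    linarith

/-- A trajectory can be prolonged for ever near a given state, with a nonconstant control and
coming back infinitely often. -/
theorem System.exists_loop {sys : System n m l} {T R B K : ℝ} {v : ℝ → E l}
    (hF : IsField sys.U (sys.drift T v R) (sys.coupling R) B K) (hW : WhitneyProperty sys.U)
    (hU : sys.U.Nontrivial) {w : E m} (hw : w ∈ sys.U) {y : E n} (hy : ‖y‖ + 1 ≤ R) :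
    ∃ (φ : ℝ → E m) (ζ : ℝ → E n) (δ : ℝ), 0 < δ ∧ (∀ a b, ‖φ a - φ b‖ ≤ |a - b|) ∧
      (∀ s, φ s ∈ sys.U) ∧ (∀ s, ‖ζ s‖ ≤ R) ∧
      FollowsOn (sys.drift T v R) (sys.coupling R) univ (fun _ => T) φ ζ id (K * (B + 1)) ∧
      (∀ s, s ≤ 0 → φ s = w ∧ ζ s = y) ∧
      (∀ j : ℕ, φ (j * (2 * Real.pi)) = w ∧ ζ (j * (2 * Real.pi)) = y) ∧
      ∀ j : ℕ, ‖φ (Real.pi + j * (2 * Real.pi)) - w‖ = δ := by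
  have hB := hF.nonneg_B
  have hC : 0 ≤ K * (B + 1) := mul_nonneg hF.nonneg_K (by linarith)
  obtain ⟨q, d, hd, hdρ, hqlip, hqU, hq0, hqd⟩ :=
    -- With length at most 1/(B + 1) the state moves by less than 1, which keeps it in the ball of
    -- radius R; also d ≤ 1.
    hW.exists_short_path hU hw (ρ := 1 / (B + 1)) (by positivity)
  have hqL : LipschitzWith 1 q := LipschitzWith.of_dist_le_mul fun a b => by
    rw [dist_eq_norm, Real.dist_eq]; push_cast; linarith [hqlip a b]
  have hθL : LipschitzWith 0 fun _ : ℝ => T := LipschitzWith.const T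
  obtain ⟨η, hηc, hη0, hη⟩ := hF.exists_solution hθL hqL hqU hd.le y
  have hdq : ∀ s, ‖deriv q s‖ ≤ 1 := norm_deriv_le_of_dist_le zero_le_one (by simpa using hqlip)
  have hηb : ∀ s ∈ Icc 0 d, ‖η s‖ ≤ R := by
    intro s hs
    have h1 := hη 0 ⟨le_rfl, hd.le⟩ s hs
    have h2 : ‖∫ s in (0 : ℝ)..s, velocity (sys.drift T v R) (sys.coupling R) (fun _ => T) q η s‖
        ≤ B * |s - 0| := intervalIntegral.norm_integral_le_of_norm_le_const fun r _ => by
      have h3 := hF.norm_velocity_le (θ := fun _ => T) (ξ := η) (hqU r)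
      simp only [deriv_const, abs_zero, zero_add] at h3
      exact h3.trans (mul_le_of_le_one_right hB (hdq r))
    rw [← h1, hη0, sub_zero, abs_of_nonneg hs.1] at h2
    have h4 : B * s ≤ 1 := by
      have h5 : s * (B + 1) ≤ 1 := by
        rw [← le_div_iff₀ (by linarith)]; exact hs.2.trans hdρ
      nlinarith [hs.1]
    have h6 := norm_sub_norm_le (η s) y
    linarith
  have hd1 : d ≤ 1 := hdρ.trans (by rw [div_le_one (by linarith)]; linarith)
  have hfol : FollowsOn (sys.drift T v R) (sys.coupling R) (Icc 0 d) (fun _ => T) q η id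
      (K * (B + 1)) :=
    hF.followsOn_of_integral monotone_const hθL hqL.continuous hqU hηc ordConnected_Icc
      (fun a _ b _ => lipschitz_ac hqL a b) hη fun a _ b _ hab => by
        simp only [deriv_const, abs_zero, zero_add, id]
        have := intervalIntegral.integral_mono_on (μ := volume) hab
          (ac_intervalIntegrable_deriv (lipschitz_ac hqL a b)).norm
          (intervalIntegrable_const (c := (1 : ℝ))) fun s _ => hdq s
        simpa using this
  -- The parameter swings between 0 and d with period 2π, at speed at most d/2 ≤ 1. Time being
  -- frozen, the drift does not act and the state is a function of the position on the path:
  -- retracing the path undoes its effect.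
  set τ : ℝ → ℝ := fun s => d / 2 * (1 - Real.cos (max 0 s)) with hτ
  have hτm : ∀ s, τ s ∈ Icc 0 d := fun s => by
    have h1 := Real.neg_one_le_cos (max 0 s)
    have h2 := Real.cos_le_one (max 0 s)
    constructor
    · exact mul_nonneg (by linarith) (by linarith)
    · have := mul_le_mul_of_nonneg_left (show 1 - Real.cos (max 0 s) ≤ 2 by linarith) (half_pos hd).le
      simp only [hτ]; linarith
  have hτlip : ∀ a b, |τ b - τ a| ≤ |b - a| := fun a b => by
    have e : τ b - τ a = d / 2 * (Real.cos (max 0 a) - Real.cos (max 0 b)) := by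
      simp only [hτ]; ring
    have h1 : |Real.cos (max 0 a) - Real.cos (max 0 b)| ≤ |max 0 a - max 0 b| := by
      have : LipschitzWith 1 Real.cos := lipschitzWith_of_nnnorm_deriv_le Real.differentiable_cos
        fun x => by
          rw [Real.deriv_cos, nnnorm_neg, ← NNReal.coe_le_coe, coe_nnnorm]
          simpa using Real.abs_sin_le_one x
      simpa [Real.dist_eq] using this.dist_le_mul (max 0 a) (max 0 b)
    have h2 : |max 0 a - max 0 b| ≤ |a - b| := by
      have := abs_max_sub_max_le_max 0 a 0 b
      simpa using this
    rw [e, abs_mul, abs_of_pos (half_pos hd), abs_sub_comm b a]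
    have := abs_nonneg (Real.cos (max 0 a) - Real.cos (max 0 b))
    nlinarith
  have hτ0 : ∀ s, Real.cos (max 0 s) = 1 → τ s = 0 := fun s hs => by simp only [hτ, hs]; ring
  have hpi := Real.pi_pos
  have hback : ∀ s, Real.cos (max 0 s) = 1 → q (τ s) = w ∧ η (τ s) = y := fun s hs => by
    rw [hτ0 s hs]; exact ⟨hq0, hη0⟩
  refine ⟨fun s => q (τ s), fun s => η (τ s), ‖q d - w‖, norm_pos_iff.2 (sub_ne_zero.2 hqd),
    fun a b => (hqlip _ _).trans (hτlip b a), fun s => hqU _, fun s => hηb _ (hτm s),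
    hfol.comp (θ := fun _ => T) hC (fun s _ => hτm s) fun a _ b _ => hτlip a b, fun s hs =>
      hback s (by rw [max_eq_left hs, Real.cos_zero]), fun j => hback _ ?_, fun j => ?_⟩
  · rw [max_eq_right (by positivity), Real.cos_nat_mul_two_pi]
  · have : τ (Real.pi + j * (2 * Real.pi)) = d := by
      simp only [hτ]
      rw [max_eq_right (by positivity), Real.cos_add_nat_mul_two_pi, Real.cos_pi]; ring
    simp only [this]

theorem System.IsSpaceTimeSolution.exists_norm_le {sys : System n m l} {x₀ : E n}
    {c : SpaceTimeControl m l} {ξ : ℝ → E n} (hξ : sys.IsSpaceTimeSolution x₀ c ξ) {r : ℝ}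
    (hr : 0 < r) (hS : c.S = r) {y : E n} (hy : Tendsto ξ (𝓝[<] r) (𝓝 y)) :
    ∃ R, ∀ s ∈ pseudoTime c.S, ‖ξ s‖ ≤ R := by
  have h1 : ∀ᶠ s in 𝓝[<] r, ‖ξ s‖ ≤ ‖y‖ + 1 :=
    (hy.norm.eventually (eventually_lt_nhds (lt_add_one ‖y‖))).mono fun s hs => hs.le
  obtain ⟨q, hq, hq'⟩ := (mem_nhdsLT_iff_exists_mem_Ico_Ioo_subset hr).1 h1
  have hqm : q ∈ pseudoTime c.S := ⟨hq.1, by rw [hS]; exact_mod_cast hq.2⟩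
  have hcont := (hξ.2.1 q hqm).continuousOn
  rw [uIcc_of_le hq.1] at hcont
  obtain ⟨M, hM⟩ := (isCompact_Icc.image_of_continuousOn hcont).isBounded.exists_norm_le
  refine ⟨max M (‖y‖ + 1), fun s hs => ?_⟩
  rcases le_or_gt s q with h | h
  · exact (hM _ ⟨s, ⟨hs.1, h⟩, rfl⟩).trans (le_max_left _ _)
  · have : s < r := by
      have := hs.2
      rw [hS] at this
      exact_mod_cast this
    exact (hq' ⟨h, this⟩ : ‖ξ s‖ ≤ ‖y‖ + 1).trans (le_max_right _ _)

/-- The finite completion is continued from (T, u(T), x(T)) by a loop with frozen time, traversed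
for ever. It never stops accumulating length, so S becomes +∞, while its periodic returns provide
the final sequence; the clock on [0,T[ precedes the loop and, before arc-length normalization, is
unchanged. -/
theorem System.IsCompletionWitness.exists_infinite {sys : System n m l} (hsys : sys.Assumptions)
    (hW : WhitneyProperty sys.U) (hU : sys.U.Nontrivial) {x₀ : E n} {u₀ : E m} {T : ℝ} (hT : 0 < T)
    {u : ℝ → E m} {v : ℝ → E l} (hv : IsOrdinaryControl sys.V T v) (huT : u T ∈ sys.U)
    {x : ℝ → E n} {c : SpaceTimeControl m l} {σ : ℝ → ℝ} {ξ : ℝ → E n}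
    (h : sys.IsCompletionWitness x₀ u₀ T u v x c σ ξ) (hfin : c.S < ⊤) :
    ∃ c' σ' ξ', sys.IsCompletionWitness x₀ u₀ T u v x c' σ' ξ' ∧ c'.S = ⊤ := by
  obtain ⟨hc, hσ, hξ, hx, hend, -⟩ := h
  have hf := hc.isFeasible
  obtain ⟨r, hS, hr, hE⟩ := toEnd_eq_of_lt_top hfin hf.isControl.pos_S
  have hφT := hc.final_of_finite hfin
  have hξT := hend hfin
  rw [hE] at hφT hξT
  obtain ⟨R₀, hR₀⟩ := hξ.exists_norm_le hr hS hξT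
  have hyR : ‖x T‖ ≤ R₀ := by
    refine le_of_tendsto hξT.norm ?_
    filter_upwards [Ioo_mem_nhdsLT hr] with s hs
    exact hR₀ s ⟨hs.1.le, by rw [hS]; exact_mod_cast hs.2⟩
  -- The extra 1 in the truncation radius leaves room for the loop around x(T).
  obtain ⟨B, K, hF⟩ := hsys.exists_isField hT.le hv (R₀ + 1)
  have hC : 0 ≤ K * (B + 1) := mul_nonneg hF.nonneg_K (by linarith [hF.nonneg_B])
  obtain ⟨θ, φ₁, ξ₁, hlip₁, hθm, hθT, hU₁, hb₁, hfol₁, hin₁, hout₁⟩ :=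
    hξ.exists_stopped hF hc (fun s hs => (hR₀ s hs).trans (by linarith)) hr hS huT hφT hξT
  obtain ⟨φ₂, ξ₂, δ, hδ, hlip₂, hU₂, hb₂, hfol₂, hneg₂, hback₂, hfar₂⟩ :=
    System.exists_loop hF hW hU huT (y := x T) (by linarith)
  obtain ⟨hc₁, hint₁⟩ := hF.integral_of_followsOn hθm hlip₁ hU₁ hC hfol₁
  have hfol₂' : FollowsOn (sys.drift T v (R₀ + 1)) (sys.coupling (R₀ + 1)) univ (fun _ => T)
      (fun s => φ₂ (s - r)) (fun s => ξ₂ (s - r)) id (K * (B + 1)) :=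
    hfol₂.comp (θ := fun _ => T) hC (fun _ _ => trivial) fun a _ b _ => by
      simp [sub_sub_sub_cancel_right]
  obtain ⟨hc₂, hint₂⟩ := hF.integral_of_followsOn monotone_const (fun a b => by
    simpa using hlip₂ (a - r) (b - r)) (fun s => hU₂ _) hC hfol₂'
  set φ : ℝ → E m := fun s => if s ≤ r then φ₁ s else φ₂ (s - r) with hφ
  set ζ : ℝ → E n := fun s => if s ≤ r then ξ₁ s else ξ₂ (s - r) with hζ
  have h₁ : ∀ s, s ≤ r → θ s = θ s ∧ φ s = φ₁ s ∧ ζ s = ξ₁ s := fun s hs => by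
    simp only [hφ, hζ, hs, if_true, and_self]
  have h₂ : ∀ s, r ≤ s → θ s = (fun _ => T) s ∧ φ s = (fun s => φ₂ (s - r)) s ∧
      ζ s = (fun s => ξ₂ (s - r)) s := fun s hs => by
    refine ⟨(hout₁ s hs).1, ?_⟩
    rcases hs.eq_or_lt with rfl | hs'
    · have := hneg₂ (r - r) (by simp)
      simp only [hφ, hζ, le_refl, if_true, this, hout₁ r le_rfl, and_self]
    · simp only [hφ, hζ, not_le.2 hs', if_false, and_self]
  have hlip : ∀ a b, |θ a - θ b| + ‖φ a - φ b‖ ≤ |a - b| := by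
    intro a b
    wlog hab : a ≤ b generalizing a b
    · rw [abs_sub_comm, norm_sub_rev, abs_sub_comm a]
      exact this b a (le_of_not_ge hab)
    have hl : ∀ a b, a ≤ r → b ≤ r → |θ a - θ b| + ‖φ a - φ b‖ ≤ |a - b| := fun a b ha hb => by
      rw [(h₁ a ha).2.1, (h₁ b hb).2.1]; exact hlip₁ a b
    have hg : ∀ a b, r ≤ a → r ≤ b → |θ a - θ b| + ‖φ a - φ b‖ ≤ |a - b| := fun a b ha hb => by
      rw [(h₂ a ha).1, (h₂ b hb).1, (h₂ a ha).2.1, (h₂ b hb).2.1]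
      simpa using hlip₂ (a - r) (b - r)
    rcases le_total b r with hb | hb
    · exact hl a b (hab.trans hb) hb
    rcases le_total r a with ha | ha
    · exact hg a b ha hb
    have e1 := hl a r ha le_rfl
    have e2 := hg r b le_rfl hb
    rw [abs_of_nonpos (sub_nonpos.2 ha)] at e1
    rw [abs_of_nonpos (sub_nonpos.2 hb)] at e2
    rw [abs_of_nonpos (sub_nonpos.2 hab)]
    have e3 := abs_sub_le (θ a) (θ r) (θ b)
    have e4 := norm_sub_le_norm_sub_add_norm_sub (φ a) (φ r) (φ b)
    linarith
  have hφU : ∀ s, φ s ∈ sys.U := fun s => by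
    simp only [hφ]; split_ifs
    exacts [hU₁ _, hU₂ _]
  have hζb : ∀ s, ‖ζ s‖ ≤ R₀ + 1 := fun s => by
    simp only [hζ]; split_ifs
    exacts [hb₁ _, hb₂ _]
  have hζc : Continuous ζ := by
    refine hc₁.if_le hc₂ continuous_id continuous_const fun s hs => ?_
    have hs' : s = r := hs
    subst hs'
    rw [(hout₁ s le_rfl).2.2, (hneg₂ (s - s) (by simp)).2]
  have hlt : ∀ s ∈ pseudoTime c.S, s < r := fun s hs => by
    have := hs.2
    rw [hS] at this
    exact_mod_cast this
  have hat : ∀ s ∈ pseudoTime c.S, θ s = c.φ₀ s ∧ φ s = c.φ s ∧ ζ s = ξ s := fun s hs => by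
    obtain ⟨-, e1, e2⟩ := h₁ s (hlt s hs).le
    rw [e1, e2]
    exact hin₁ s hs.1 (hlt s hs)
  have h0 : (0 : ℝ) ∈ pseudoTime c.S := ⟨le_rfl, hf.isControl.pos_S⟩
  have hpi := Real.pi_pos
  have hret : ∀ j : ℕ, φ (r + j * (2 * Real.pi)) = u T ∧ ζ (r + j * (2 * Real.pi)) = x T := fun j => by
    obtain ⟨-, e1, e2⟩ := h₂ (r + j * (2 * Real.pi)) (by
      have : 0 ≤ (j : ℝ) * (2 * Real.pi) := by positivity
      linarith)
    rw [e1, e2]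
    simpa using hback₂ j
  have hcurve : sys.IsLimitCurve x₀ u₀ T u v x (R₀ + 1) θ φ ζ σ := by
    refine ⟨hlip, hθm, hθT, hφU, ?_, hζb, hζc, hF.integral_concat hlip hφU hζc h₁ h₂ hint₁ hint₂,
      hσ.monotone, hσ.zero, fun t ht => ?_, fun j => r + j * (2 * Real.pi), fun j => by positivity,
      ?_, ?_⟩
    · obtain ⟨e1, e2, e3⟩ := hat 0 h0
      exact ⟨e1.trans hf.isControl.φ₀_zero, e2.trans hf.φ_zero, e3.trans hξ.1⟩
    · obtain ⟨e1, e2, e3⟩ := hat _ (hσ.mem t ht)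
      rw [e1, e2, e3, hx t ht]
      exact ⟨(hσ.graph t ht).1, (hσ.graph t ht).2, rfl⟩
    · exact tendsto_atTop_add_const_left _ _
        (tendsto_natCast_atTop_atTop.atTop_mul_const (by positivity))
    · simp only [(hret _).1, (hret _).2]
      exact tendsto_const_nhds
  obtain ⟨c', σ', ξ', hw, htop⟩ := hcurve.exists_completionWitness hF hT hv
  refine ⟨c', σ', ξ', hw, htop fun M => ?_⟩
  have hθL : LipschitzWith 1 θ := LipschitzWith.of_dist_le_mul fun a b => by
    have := hlip a b
    have := norm_nonneg (φ a - φ b)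
    rw [Real.dist_eq, Real.dist_eq]; push_cast; linarith
  have hφL : LipschitzWith 1 φ := LipschitzWith.of_dist_le_mul fun a b => by
    have := hlip a b
    have := abs_nonneg (θ a - θ b)
    rw [dist_eq_norm, Real.dist_eq]; push_cast; linarith
  have hmono := arcLen_mono hθL hφL
  -- Every period reaches a point at distance δ from u(T), hence adds at least δ to the length.
  have hgrow : ∀ j : ℕ, j * δ ≤ arcLen θ φ (r + j * (2 * Real.pi)) := by
    intro j
    induction j with
    | zero =>
      have := hmono hr.le
      rw [arcLen, intervalIntegral.integral_same] at this
      simpa using this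
    | succ j ih =>
      have e1 := abs_add_norm_le_arcLen hθL hφL (r + j * (2 * Real.pi))
        (r + (Real.pi + j * (2 * Real.pi)))
      have e2 := hmono (show r + (Real.pi + j * (2 * Real.pi)) ≤ r + (j + 1 : ℕ) * (2 * Real.pi) by
        push_cast; linarith)
      have e3 := hmono (show r + j * (2 * Real.pi) ≤ r + (Real.pi + j * (2 * Real.pi)) by linarith)
      rw [abs_of_nonneg (sub_nonneg.2 e3), (hret j).1,
        (h₂ (r + (Real.pi + j * (2 * Real.pi))) (by
          have : 0 ≤ (j : ℝ) * (2 * Real.pi) := by positivity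
          linarith)).2.1] at e1
      simp only [add_sub_cancel_left, hfar₂] at e1
      have e4 := abs_nonneg (θ (r + (Real.pi + j * (2 * Real.pi))) - θ (r + j * (2 * Real.pi)))
      push_cast at e2 ⊢
      linarith
  obtain ⟨j, hj⟩ := exists_nat_gt (M / δ)
  exact ⟨_, ((div_lt_iff₀ hδ).1 hj).trans_le (hgrow j)⟩

end Extension

/-! ### Graph completion solutions are limit solutions -/

section WellPosedness

variable {n m l : ℕ}

/-- A monotone function on `[0,T]` has monotone Lipschitz interpolants, exact on a given finite set
and with a given resolution elsewhere. -/
theorem exists_monotone_interpolation {ρ : ℝ → ℝ} {T η : ℝ} (hT : 0 < T)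
    (hρ : MonotoneOn ρ (Icc 0 T)) (F : Finset ℝ) (hη : 0 < η) :
    ∃ κ : ℝ → ℝ, (∃ K, LipschitzWith K κ) ∧ Monotone κ ∧ (∀ r ∈ F, r ∈ Icc 0 T → κ r = ρ r) ∧
      κ 0 = ρ 0 ∧ (∀ t, T ≤ t → κ t = ρ T) ∧ (∀ t, κ t ∈ Icc (ρ 0) (ρ T)) ∧
      (∀ r ∈ Icc 0 T, ∀ t ∈ Icc 0 T, r + η ≤ t → ρ r ≤ κ t) ∧
      ∀ r ∈ Icc 0 T, ∀ t ∈ Icc 0 T, t + η ≤ r → κ t ≤ ρ r := by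
  classical
  have h0m : (0 : ℝ) ∈ Icc 0 T := ⟨le_rfl, hT.le⟩
  have hTm : T ∈ Icc 0 T := ⟨hT.le, le_rfl⟩
  -- The nodes are the endpoints, the prescribed points and a grid of mesh η; two times at distance
  -- at least η always have a node between them.
  set G : Finset ℝ := ({0, T} ∪ F ∪ (Finset.range (⌈T / η⌉₊ + 1)).image fun i : ℕ => i * η).filter
    (· ∈ Icc 0 T) with hG
  have hGI : ∀ r ∈ G, r ∈ Icc 0 T := fun r hr => (Finset.mem_filter.1 hr).2
  have h0 : (0 : ℝ) ∈ G := by simp [hG, hT.le]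
  have hTG : T ∈ G := by simp [hG, hT.le]
  have hFG : ∀ r ∈ F, r ∈ Icc 0 T → r ∈ G := fun r hr hr' =>
    Finset.mem_filter.2 ⟨Finset.mem_union_left _ (Finset.mem_union_right _ hr), hr'⟩
  have hgrid : ∀ r ∈ Icc 0 T, ∀ t ∈ Icc 0 T, r + η ≤ t → ∃ p ∈ G, r ≤ p ∧ p ≤ t := by
    intro r hr t ht hrt
    have h1 : r ≤ ⌈r / η⌉₊ * η := (div_le_iff₀ hη).1 (Nat.le_ceil _)
    have h2 : ⌈r / η⌉₊ * η ≤ t := by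
      have h3 := (Nat.ceil_lt_add_one (div_nonneg hr.1 hη.le)).le
      have h4 := mul_le_mul_of_nonneg_right h3 hη.le
      rw [add_mul, div_mul_cancel₀ _ hη.ne', one_mul] at h4
      linarith
    refine ⟨_, Finset.mem_filter.2 ⟨Finset.mem_union_right _ (Finset.mem_image.2
      ⟨⌈r / η⌉₊, Finset.mem_range.2 (Nat.lt_succ_of_le (Nat.ceil_mono ?_)), rfl⟩),
      ⟨hr.1.trans h1, h2.trans ht.2⟩⟩, h1, h2⟩
    exact div_le_div_of_nonneg_right hr.2 hη.le
  obtain ⟨M₀, hM₀⟩ := Finset.exists_le ((G ×ˢ G).image fun p => (ρ p.2 - ρ p.1) / (p.2 - p.1))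
  set M := max M₀ 0 with hM
  have hM0 : 0 ≤ M := le_max_right _ _
  have hslope : ∀ r ∈ G, ∀ p ∈ G, r < p → ρ p ≤ ρ r + M * (p - r) := by
    intro r hr p hp hrp
    have h1 := (hM₀ _ (Finset.mem_image.2 ⟨(r, p), Finset.mem_product.2 ⟨hr, hp⟩, rfl⟩)).trans
      (le_max_left M₀ 0)
    have h2 := (div_le_iff₀ (sub_pos.2 hrp)).1 h1
    linarith
  -- This is a one-sided Lipschitz regularization. It is monotone because only `max (t - r) 0` is
  -- penalized, and it is exact at the nodes because M dominates every slope between nodes.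
  set g : ℝ → ℝ := fun t => G.inf' ⟨0, h0⟩ fun r => ρ r + M * max (t - r) 0 with hg
  have hgm : Monotone g := fun s t hst => by
    refine Finset.le_inf' _ _ fun r hr => (Finset.inf'_le _ hr).trans ?_
    gcongr
  have hgl : ∀ s t, g s ≤ g t + M * |s - t| := by
    intro s t
    obtain ⟨r, hr, e⟩ := Finset.exists_mem_eq_inf' ⟨0, h0⟩ fun r => ρ r + M * max (t - r) 0
    have h1 : g s ≤ ρ r + M * max (s - r) 0 := Finset.inf'_le _ hr
    have h2 : max (s - r) 0 ≤ max (t - r) 0 + |s - t| := by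
      refine max_le ?_ (by positivity)
      have := le_max_left (t - r) 0
      have := le_abs_self (s - t)
      linarith
    have h3 := mul_le_mul_of_nonneg_left h2 hM0
    have h4 : g t = ρ r + M * max (t - r) 0 := e
    linarith
  have hgG : ∀ p ∈ G, g p = ρ p := by
    intro p hp
    refine le_antisymm ?_ (Finset.le_inf' _ _ fun r hr => ?_)
    · have : g p ≤ ρ p + M * max (p - p) 0 := Finset.inf'_le _ hp
      simpa using this
    · rcases lt_or_ge r p with h | h
      · exact (hslope r hr p hp h).trans (by gcongr; exact le_max_left _ _)
      · have h1 := hρ (hGI p hp) (hGI r hr) h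
        have : 0 ≤ M * max (p - r) 0 := mul_nonneg hM0 (le_max_right _ _)
        linarith
  have hκG : ∀ p ∈ G, g (clamp T p) = ρ p := fun p hp => by rw [clamp_of_mem (hGI p hp), hgG p hp]
  have hκm : Monotone fun t => g (clamp T t) := hgm.comp (clamp_mono T)
  refine ⟨fun t => g (clamp T t), ⟨⟨M, hM0⟩, lipschitzWith_of_norm_sub_le hM0 fun s t => ?_⟩, hκm,
    fun r hr hr' => hκG r (hFG r hr hr'), hκG 0 h0, fun t ht => ?_, fun t => ⟨?_, ?_⟩,
    fun r hr t ht hrt => ?_, fun r hr t ht hrt => ?_⟩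
  · have h1 := hgl (clamp T s) (clamp T t)
    have h2 := hgl (clamp T t) (clamp T s)
    rw [abs_sub_comm (clamp T t)] at h2
    have h3 := mul_le_mul_of_nonneg_left (abs_clamp_sub_le T s t) hM0
    rw [Real.norm_eq_abs, abs_le]
    constructor <;> linarith
  · simp only [clamp, min_eq_left ht, max_eq_right hT.le, hgG T hTG]
  · rw [← hgG 0 h0]; exact hgm (clamp_mem hT.le t).1
  · rw [← hgG T hTG]; exact hgm (clamp_mem hT.le t).2
  · obtain ⟨p, hp, h1, h2⟩ := hgrid r hr t ht hrt
    exact (hρ hr (hGI p hp) h1).trans ((hκG p hp).ge.trans (hκm h2))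
  · obtain ⟨p, hp, h1, h2⟩ := hgrid t ht r hr hrt
    exact (hκm h1).trans ((hκG p hp).le.trans (hρ (hGI p hp) hr h2))

theorem SpaceTimeControl.IsFeasible.continuousOn_φ {c : SpaceTimeControl m l} {U : Set (E m)}
    {V : Set (E l)} {T : ℝ} {u₀ : E m} (hc : c.IsFeasible U V T u₀) :
    ContinuousOn c.φ (pseudoTime c.S) := by
  refine (LipschitzOnWith.of_dist_le_mul (K := 1) fun a ha b hb => ?_).continuousOn
  have := hc.abs_add_norm_le ha hb
  have := abs_nonneg (c.φ₀ a - c.φ₀ b)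
  rw [dist_eq_norm, Real.dist_eq]; push_cast; linarith

theorem System.IsSpaceTimeSolution.continuousOn {sys : System n m l} {x₀ : E n}
    {c : SpaceTimeControl m l} {ξ : ℝ → E n} (h : sys.IsSpaceTimeSolution x₀ c ξ) :
    ContinuousOn ξ (pseudoTime c.S) := by
  intro s hs
  obtain ⟨q, hsq, hq⟩ := exists_gt_mem_pseudoTime hs
  have h1 := (h.2.1 _ hq).continuousOn
  rw [uIcc_of_le hq.1] at h1
  refine (h1 s ⟨hs.1, hsq.le⟩).mono_of_mem_nhdsWithin ?_
  refine mem_of_superset (inter_mem_nhdsWithin _ (Iio_mem_nhds hsq)) fun r hr => ?_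
  exact ⟨hr.1.1, (mem_Iio.1 hr.2).le⟩

/-- N is chosen first, to make the 1/N term small; η comes afterwards and absorbs the factor N. -/
theorem exists_step_bound {K B C L ε : ℝ} (hB : 0 ≤ B) (hε : 0 < ε) :
    ∃ N : ℕ, 0 < N ∧ ∃ η : ℝ, 0 < η ∧ η ≤ ε ∧
      Real.exp (K * L) * (2 * C * L ^ 2 / N + 2 * B * η * N) ≤ ε := by
  have he := Real.exp_pos (K * L)
  obtain ⟨N, hN⟩ := exists_nat_gt (max 0 (Real.exp (K * L) * (2 * C * L ^ 2) / (ε / 2)))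
  have hN0 : (0 : ℝ) < N := (le_max_left _ _).trans_lt hN
  have hN1 := ((le_max_right _ _).trans_lt hN).le
  rw [div_le_iff₀ (half_pos hε)] at hN1
  set D := Real.exp (K * L) * (2 * B * N) + 1 with hD
  have hD0 : 1 ≤ D := by have : 0 ≤ Real.exp (K * L) * (2 * B * N) := by positivity
                         linarith
  refine ⟨N, by exact_mod_cast hN0, ε / 2 / D, by positivity, ?_, ?_⟩
  · exact (div_le_self (half_pos hε).le hD0).trans (half_le_self hε.le)
  · have h1 : Real.exp (K * L) * (2 * C * L ^ 2 / N) ≤ ε / 2 := by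
      rw [← mul_div_assoc, div_le_iff₀ hN0]; linarith
    have h2 : Real.exp (K * L) * (2 * B * (ε / 2 / D) * N) ≤ ε / 2 := by
      have : Real.exp (K * L) * (2 * B * (ε / 2 / D) * N) = (D - 1) / D * (ε / 2) := by
        rw [hD]; ring
      rw [this]
      exact mul_le_of_le_one_left (half_pos hε).le (by rw [div_le_one (by linarith)]; linarith)
    rw [mul_add]
    linarith

theorem integral_norm_deriv_le_of_monotone {w : ℝ → E m} {κ : ℝ → ℝ} {L : NNReal}
    (hκ : Monotone κ) (hL : LipschitzWith L κ) (h : ∀ a b, ‖w a - w b‖ ≤ |κ a - κ b|) {a b : ℝ}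
    (hab : a ≤ b) : ∫ s in a..b, ‖deriv w s‖ ≤ κ b - κ a := by
  have hw : LipschitzWith L w := LipschitzWith.of_dist_le_mul fun a b => by
    rw [dist_eq_norm]; exact (h a b).trans (hL.dist_le_mul a b)
  have hac := lipschitz_ac hL a b
  rw [← hac.integral_deriv_eq_sub]
  refine intervalIntegral.integral_mono_ae hab
    (ac_intervalIntegrable_deriv (lipschitz_ac hw a b)).norm hac.intervalIntegrable_deriv ?_
  filter_upwards [hL.ae_differentiableAt_real, hw.ae_differentiableAt_real] with s h1 h2
  have e1 := h2.hasDerivAt.tendsto_slope.norm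
  have e2 := h1.hasDerivAt.tendsto_slope.norm
  have e3 : ‖deriv w s‖ ≤ ‖deriv κ s‖ := by
    refine le_of_tendsto_of_tendsto e1 e2 (Eventually.of_forall fun r => ?_)
    simp only [slope_def_module, norm_smul]
    exact mul_le_mul_of_nonneg_left (h r s) (norm_nonneg _)
  rwa [Real.norm_of_nonneg hκ.deriv_nonneg] at e3

/-- Approximation of a graph completion solution by a Carathéodory solution, up to a pseudo-time `a`
close to the final one. -/
theorem System.IsSpaceTimeSolution.exists_approximation {sys : System n m l} {T R₀ B K : ℝ}
    {v : ℝ → E l}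
    (hF : IsField sys.U (sys.drift T v (R₀ + 2)) (sys.coupling (R₀ + 2)) B K) {u₀ : E m}
    {u : ℝ → E m} {x₀ : E n} {c : SpaceTimeControl m l} {ξ : ℝ → E n} {σ : ℝ → ℝ}
    (hc : c.IsGraphCompletion sys.U sys.V T u₀ u v) (hσ : c.IsClock T u σ)
    (hξ : sys.IsSpaceTimeSolution x₀ c ξ) (hR : ∀ s ∈ pseudoTime c.S, ‖ξ s‖ ≤ R₀) {a ε : ℝ}
    (ha : a ∈ pseudoTime c.S) (hpos : 0 < c.φ₀ a) (hε : 0 < ε) (hε1 : ε ≤ 1)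
    (haT : (B + K * (B + 1) + 1) * (T - c.φ₀ a) ≤ ε) (F : Finset ℝ) :
    ∃ (κ : ℝ → ℝ) (y : ℝ → E n), Monotone κ ∧ Continuous κ ∧ κ 0 = 0 ∧ (∀ t, κ t ∈ Icc 0 a) ∧
      (∀ t, c.φ₀ a ≤ t → κ t = a) ∧ (∀ r ∈ F, r ∈ Ico 0 (c.φ₀ a) → κ r = σ r) ∧
      (∀ r ∈ Ico 0 (c.φ₀ a), ∀ t ∈ Icc 0 (c.φ₀ a), r + ε ≤ t → σ r ≤ κ t) ∧
      (∀ r ∈ Ico 0 (c.φ₀ a), ∀ t ∈ Icc 0 (c.φ₀ a), t + ε ≤ r → κ t ≤ σ r) ∧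
      (∀ t ∈ Icc 0 (c.φ₀ a), |t - c.φ₀ (κ t)| ≤ ε) ∧
      IsACControl sys.U T (fun t => c.φ (κ t)) ∧
      sys.IsCaratheodorySolution x₀ T (fun t => c.φ (κ t)) v y ∧
      ∀ t ∈ Icc 0 T, ‖y t - ξ (κ t)‖ ≤ 2 * ε := by
  have hf := hc.isFeasible
  have hB := hF.nonneg_B
  set C := K * (B + 1) with hCdef
  have hC : 0 ≤ C := mul_nonneg hF.nonneg_K (by linarith)
  set T' := c.φ₀ a with hT'
  have hT'T : T' ≤ T := hf.le_T ha
  have hT0 : 0 ≤ T := hpos.le.trans hT'T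
  have hsub : Icc 0 T' ⊆ Icc 0 T := Icc_subset_Icc_right hT'T
  obtain ⟨N, hN, η, hη, hηε, hNη⟩ := exists_step_bound (K := K) (C := C) (L := T' + a) hB hε
  have hσm : ∀ r ∈ Ico 0 T', r ∈ Ico 0 T := fun r hr => ⟨hr.1, hr.2.trans_le hT'T⟩
  have hσa : ∀ r ∈ Ico 0 T', σ r ≤ a := fun r hr => by
    by_contra hcon
    have h1 := hf.monotoneOn ha (hσ.mem r (hσm r hr)) (not_le.1 hcon).le
    rw [(hσ.graph r (hσm r hr)).1] at h1
    exact absurd hr.2 (not_lt.2 h1)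
  -- The clock is followed up to T' = φ₀(a) and then jumps to a, so that the interpolant stops at
  -- pseudo-time a instead of approaching S.
  set ρ : ℝ → ℝ := fun r => if r < T' then σ r else a with hρdef
  have hρσ : ∀ r, r < T' → ρ r = σ r := fun r hr => by simp only [hρdef, hr, if_true]
  have hρa : ρ T' = a := by simp only [hρdef, lt_irrefl, if_false]
  have hρ0 : ρ 0 = 0 := (hρσ 0 hpos).trans hσ.zero
  have hρm : MonotoneOn ρ (Icc 0 T') := by
    intro r hr t ht hrt
    rcases ht.2.lt_or_eq with h | h
    · rw [hρσ t h, hρσ r (hrt.trans_lt h)]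
      exact hσ.monotone (hσm r ⟨hr.1, hrt.trans_lt h⟩) (hσm t ⟨ht.1, h⟩) hrt
    · rw [h, hρa]
      rcases hr.2.lt_or_eq with h' | h'
      · rw [hρσ r h']; exact hσa r ⟨hr.1, h'⟩
      · rw [h', hρa]
  obtain ⟨κ, ⟨L, hL⟩, hκm, hκF, hκ0, hκT, hκI, hκlo, hκhi⟩ :=
    exists_monotone_interpolation hpos hρm F hη
  rw [hρ0] at hκ0 hκI
  rw [hρa] at hκT hκI
  have hκS : ∀ t, κ t ∈ pseudoTime c.S := fun t => Icc_subset_pseudoTime ha (hκI t)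
  set w : ℝ → E m := fun t => c.φ (κ t) with hw
  have hwκ : ∀ p q, ‖w p - w q‖ ≤ |κ p - κ q| := fun p q => by
    have := hf.abs_add_norm_le (hκS p) (hκS q)
    have := abs_nonneg (c.φ₀ (κ p) - c.φ₀ (κ q))
    linarith
  have hwL : LipschitzWith L w := LipschitzWith.of_dist_le_mul fun p q => by
    rw [dist_eq_norm]; exact (hwκ p q).trans (hL.dist_le_mul p q)
  have hwU : ∀ t, w t ∈ sys.U := fun t => hf.isControl.mem_U _ (hκS t)
  -- κ(t) is squeezed between σ(t - η) and σ(t + η), and `φ₀` inverts the clock; near the ends of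
  -- [0,T'] the bounds 0 and T' replace the missing comparison.
  have hclose : ∀ t ∈ Icc 0 T', |t - c.φ₀ (κ t)| ≤ η := by
    intro t ht
    rw [abs_le]
    constructor
    · rcases lt_or_ge (t + η) T' with h | h
      · have hr : t + η ∈ Ico 0 T' := ⟨by linarith [ht.1], h⟩
        have h1 := hκhi _ (Ico_subset_Icc_self hr) t ht le_rfl
        rw [hρσ _ h] at h1
        have h2 := hf.monotoneOn (hκS t) (hσ.mem _ (hσm _ hr)) h1
        rw [(hσ.graph _ (hσm _ hr)).1] at h2
        linarith
      · have h2 := hf.monotoneOn (hκS t) ha (hκI t).2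
        linarith
    · rcases lt_or_ge t η with h | h
      · have := hf.isControl.nonneg_φ₀ _ (hκS t)
        linarith
      · have hr : t - η ∈ Ico 0 T' := ⟨by linarith, by linarith [ht.2]⟩
        have h1 := hκlo _ (Ico_subset_Icc_self hr) t ht (by linarith)
        rw [hρσ _ hr.2] at h1
        have h2 := hf.monotoneOn (hσ.mem _ (hσm _ hr)) (hκS t) h1
        rw [(hσ.graph _ (hσm _ hr)).1] at h2
        linarith
  have hidL : LipschitzWith 1 (id : ℝ → ℝ) := LipschitzWith.id
  obtain ⟨y, hyc, hy0, hy⟩ := hF.exists_solution hidL hwL hwU hT0 x₀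
  -- This gauge serves both curves: t + κ(t) dominates the length of (t, w) and the pseudo-time
  -- spent by ξ ∘ κ.
  set ℓ : ℝ → ℝ := fun t => t + κ t with hℓ
  have hyfol : FollowsOn (sys.drift T v (R₀ + 2)) (sys.coupling (R₀ + 2)) (Icc 0 T) id w y ℓ C := by
    refine hF.followsOn_of_integral monotone_id hidL hwL.continuous hwU hyc ordConnected_Icc
      (fun p _ q _ => lipschitz_ac hwL p q) hy fun p _ q _ hpq => ?_
    rw [intervalIntegral.integral_add (intervalIntegrable_deriv_lipschitz hidL p q).abs
      (ac_intervalIntegrable_deriv (lipschitz_ac hwL p q)).norm]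
    have h1 := integral_norm_deriv_le_of_monotone hκm hL hwκ hpq
    have h2 : ∫ s in p..q, |deriv (id : ℝ → ℝ) s| = q - p := by simp
    rw [h2]
    simp only [hℓ]
    linarith
  have hξfol : FollowsOn (sys.drift T v (R₀ + 2)) (sys.coupling (R₀ + 2)) (Icc 0 T')
      (fun t => c.φ₀ (κ t)) w (fun t => ξ (κ t)) ℓ C :=
    (hξ.followsOn hF hc (fun s hs => (hR s hs).trans (by linarith)) ha).comp hC
      (fun t _ => hκI t) fun p _ q _ => by
        simp only [hℓ, id]
        rcases le_total p q with h | h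
        · have := hκm h
          rw [abs_of_nonneg (by linarith), abs_of_nonneg (by linarith)]; linarith
        · have := hκm h
          rw [abs_of_nonpos (by linarith), abs_of_nonpos (by linarith)]; linarith
  have hfirst : ∀ t ∈ Icc 0 T', ‖y t - ξ (κ t)‖ ≤ ε := by
    intro t ht
    refine (hF.norm_sub_le_of_followsOn hC hη.le
      (fun p hp q hq => hyfol p (hsub hp) q (hsub hq)) hξfol hclose (fun t _ => hwU t)
      (continuous_id.add hL.continuous).continuousOn
      (fun p _ q _ hpq => add_le_add hpq (hκm hpq)) (by simp only [hℓ, hκ0, add_zero])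
      (fun p _ q _ hpq => ?_) (by rw [hy0]; simp only [hκ0, hξ.1]) hN ht).trans ?_
    · have h1 := hwκ q p
      rw [abs_of_nonneg (sub_nonneg.2 (hκm hpq))] at h1
      simp only [hℓ]
      linarith
    · have : ℓ T' = T' + a := by simp only [hℓ, hκT T' le_rfl]
      rwa [this]
  have hall : ∀ t ∈ Icc 0 T, ‖y t - ξ (κ t)‖ ≤ 2 * ε := by
    intro t ht
    rcases le_total t T' with h | h
    · exact (hfirst t ⟨ht.1, h⟩).trans (by linarith)
    -- After T' the control is constant, so only the drift acts, for a time at most T - T'; `haT`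
    -- makes this contribution at most ε.
    · have hTm : T' ∈ Icc 0 T' := ⟨hpos.le, le_rfl⟩
      have h1 := hfirst T' hTm
      have h2 := hyfol T' (hsub hTm) t ht
      have h3 := hF.norm_increment_le (θ := id) (φ := w) (y T') (hwU T') t
      have e : w t = w T' := by simp only [hw, hκT t h, hκT T' le_rfl]
      have hd : 0 ≤ t - T' := sub_nonneg.2 h
      rw [e, sub_self, norm_zero, add_zero, id, id, abs_of_nonneg hd] at h3
      simp only [hℓ, hκT t h, hκT T' le_rfl, add_sub_add_right_eq_sub] at h2
      rw [hκT T' le_rfl] at h1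
      rw [hκT t h]
      have hdT : t - T' ≤ T - T' := by linarith [ht.2]
      have h4 : (B + C + 1) * (t - T') ≤ ε :=
        (mul_le_mul_of_nonneg_left hdT (by linarith)).trans haT
      have h5 : t - T' ≤ 1 := by nlinarith
      have h6 : C * (t - T') ^ 2 ≤ C * (t - T') := by
        refine mul_le_mul_of_nonneg_left ?_ hC
        nlinarith
      have h7 : y t - ξ a = (y t - y T' - increment (sys.drift T v (R₀ + 2))
          (sys.coupling (R₀ + 2)) id w (y T') T' t) + increment (sys.drift T v (R₀ + 2))
          (sys.coupling (R₀ + 2)) id w (y T') T' t + (y T' - ξ a) := by abel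
      rw [h7]
      refine (norm_add₃_le).trans ?_
      linarith
  -- Closeness to ξ bounds y a posteriori, so the truncated equation it solves is the original one.
  have hyb : ∀ t ∈ Icc 0 T, ‖y t‖ ≤ R₀ + 2 := fun t ht => by
    have h1 := hall t ht
    have h2 := hR _ (hκS t)
    have h3 := norm_sub_norm_le (y t) (ξ (κ t))
    linarith
  refine ⟨κ, y, hκm, hL.continuous, hκ0, hκI, hκT, fun r hr hr' => ?_, fun r hr t ht hrt => ?_,
    fun r hr t ht hrt => ?_, fun t ht => (hclose t ht).trans hηε, ⟨lipschitz_ac hwL 0 T,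
    fun t _ => hwU t⟩, ⟨hy0, ?_, ?_⟩, hall⟩
  · rw [hκF r hr (Ico_subset_Icc_self hr'), hρσ r hr'.2]
  · rw [← hρσ r hr.2]
    exact hκlo r (Ico_subset_Icc_self hr) t ht (by linarith)
  · rw [← hρσ r hr.2]
    exact hκhi r (Ico_subset_Icc_self hr) t ht (by linarith)
  · refine LipschitzOnWith.absolutelyContinuousOnInterval (K := ⟨B, hB⟩ * (1 + L)) ?_
    rw [uIcc_of_le hT0]
    refine LipschitzOnWith.of_dist_le_mul fun p hp q hq => ?_
    rw [dist_eq_norm, hy q hq p hp, Real.dist_eq]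
    refine intervalIntegral.norm_integral_le_of_norm_le_const fun s _ => ?_
    refine (hF.norm_velocity_le (hwU s)).trans ?_
    have h1 : ‖deriv w s‖ ≤ L := norm_deriv_le_of_lipschitz hwL
    have h2 : ((1 + L : NNReal) : ℝ) = 1 + L := NNReal.coe_add 1 L
    simp only [deriv_id, abs_one]
    exact mul_le_mul_of_nonneg_left ((add_le_add le_rfl h1).trans h2.ge) hB
  · have hvi := hF.intervalIntegrable_velocity hidL hwL.continuous hwU hyc (lipschitz_ac hwL 0 T)
    filter_upwards [ae_hasDerivAt_of_integral hvi hy] with t ht htI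
    have htI' := Ioo_subset_Icc_self htI
    have h1 := ht htI
    rw [sys.velocity_eq v (θ := id) (hyb t htI') htI', deriv_id, one_smul] at h1
    exact h1

/-- Variation is invariant under monotone reparametrization, and along a unit-speed control it
equals pseudo-time minus elapsed time. -/
theorem SpaceTimeControl.IsFeasible.gauge_comp {c : SpaceTimeControl m l} {U : Set (E m)}
    {V : Set (E l)} {T : ℝ} {u₀ : E m} (hc : c.IsFeasible U V T u₀) {κ : ℝ → ℝ} (hm : Monotone κ)
    (hκ : Continuous κ) (h0 : κ 0 = 0) {t : ℝ} (ht : 0 ≤ t) (hS : κ t ∈ pseudoTime c.S) :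
    gauge (fun t => c.φ (κ t)) t = t + (κ t - c.φ₀ (κ t)) := by
  have h1 : κ '' Icc 0 t = Icc 0 (κ t) := by
    refine Subset.antisymm ?_ ?_
    · rintro _ ⟨s, hs, rfl⟩
      exact ⟨h0 ▸ hm hs.1, hm hs.2⟩
    · have := intermediate_value_Icc ht hκ.continuousOn
      rwa [h0] at this
  have h2 := eVariationOn.comp_eq_of_monotoneOn c.φ κ (hm.monotoneOn (Icc 0 t))
  rw [h1] at h2
  rw [gauge, ← hc.eVariationOn_eq hS, ← h2]
  rfl

/-- A sequence of pseudo-times along which the final values are attained. -/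
theorem System.IsCompletionWitness.exists_seq {sys : System n m l} {x₀ : E n} {u₀ : E m} {T : ℝ}
    {u : ℝ → E m} {v : ℝ → E l} {x : ℝ → E n} {c : SpaceTimeControl m l} {σ : ℝ → ℝ} {ξ : ℝ → E n}
    (h : sys.IsCompletionWitness x₀ u₀ T u v x c σ ξ) :
    ∃ b : ℕ → ℝ, Tendsto b atTop (toEnd c.S) ∧ (c.S = ⊤ → StrictMono b) ∧
      Tendsto (fun j => ξ (b j)) atTop (𝓝 (x T)) ∧
      Tendsto (fun j => c.φ (b j)) atTop (𝓝 (u T)) := by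
  obtain ⟨hc, -, -, -, hfin, hinf⟩ := h
  rcases eq_or_lt_of_le (le_top : c.S ≤ ⊤) with hS | hS
  · obtain ⟨-, s, h1, -, h2, h3⟩ := hinf hS
    exact ⟨s, by rwa [hS, toEnd_top], fun _ => h1, h3.fst_nhds, h3.snd_nhds⟩
  · have := toEnd_neBot hc.isFeasible.isControl.pos_S
    obtain ⟨b, hb⟩ := exists_seq_tendsto (toEnd c.S)
    exact ⟨b, hb, fun e => absurd e hS.ne, (hfin hS).comp hb, (hc.final_of_finite hS).comp hb⟩

theorem System.IsCompletionWitness.exists_norm_le {sys : System n m l} {x₀ : E n} {u₀ : E m}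
    {T : ℝ} {u : ℝ → E m} {v : ℝ → E l} {x : ℝ → E n} {c : SpaceTimeControl m l} {σ : ℝ → ℝ}
    {ξ : ℝ → E n} (h : sys.IsCompletionWitness x₀ u₀ T u v x c σ ξ) :
    ∃ R, ∀ s ∈ pseudoTime c.S, ‖ξ s‖ ≤ R := by
  obtain ⟨hc, -, hξ, -, hfin, hinf⟩ := h
  rcases eq_or_lt_of_le (le_top : c.S ≤ ⊤) with hS | hS
  · exact (hinf hS).1
  · obtain ⟨r, e, hr, hE⟩ := toEnd_eq_of_lt_top hS hc.isFeasible.isControl.pos_S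
    have hlim := hfin hS
    rw [hE] at hlim
    exact hξ.exists_norm_le hr e hlim

/-- Increasingly fine interpolants converge pointwise. -/
theorem tendsto_of_interpolation {σ : ℝ → ℝ} {T : ℝ} {κ : ℕ → ℝ → ℝ} {T' ε : ℕ → ℝ} {e : ℕ → ℝ}
    (hε : ∀ k, 0 < ε k) (hεlim : Tendsto ε atTop (𝓝 0)) (hT' : Tendsto T' atTop (𝓝 T))
    (he : {t ∈ Ico 0 T | ¬ContinuousWithinAt σ (Ico 0 T) t} ⊆ range e)
    (h0 : ∀ k, κ k 0 = σ 0)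
    (hF : ∀ k, ∀ i ≤ k, e i ∈ Ico 0 (T' k) → κ k (e i) = σ (e i))
    (hlo : ∀ k, ∀ r ∈ Ico 0 (T' k), ∀ t ∈ Icc 0 (T' k), r + ε k ≤ t → σ r ≤ κ k t)
    (hhi : ∀ k, ∀ r ∈ Ico 0 (T' k), ∀ t ∈ Icc 0 (T' k), t + ε k ≤ r → κ k t ≤ σ r)
    {t : ℝ} (ht : t ∈ Ico 0 T) : Tendsto (fun k => κ k t) atTop (𝓝 (σ t)) := by
  -- At continuity points the interpolants are squeezed between σ(t - ε_k) and σ(t + ε_k). The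
  -- discontinuities of the monotone σ are countable, enumerated by e, and matched exactly from some
  -- index on.
  by_cases hcont : ContinuousWithinAt σ (Ico 0 T) t
  · rcases ht.1.eq_or_lt with rfl | hpos
    · simp only [h0]; exact tendsto_const_nhds
    have e1 : Tendsto (fun k => t - ε k) atTop (𝓝 t) := by
      simpa using (tendsto_const_nhds (x := t)).sub hεlim
    have e2 : Tendsto (fun k => t + ε k) atTop (𝓝 t) := by
      simpa using (tendsto_const_nhds (x := t)).add hεlim
    have p1 : ∀ᶠ k in atTop, 0 < t - ε k := e1.eventually (eventually_gt_nhds hpos)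
    have p2 : ∀ᶠ k in atTop, t + ε k < T := e2.eventually (eventually_lt_nhds ht.2)
    have p3 : ∀ᶠ k in atTop, t + ε k < T' k := e2.eventually_lt hT' ht.2
    have l1 : Tendsto (fun k => σ (t - ε k)) atTop (𝓝 (σ t)) :=
      hcont.tendsto.comp (tendsto_nhdsWithin_iff.2 ⟨e1, p1.mono fun k hk =>
        ⟨hk.le, by linarith [hε k, ht.2]⟩⟩)
    have l2 : Tendsto (fun k => σ (t + ε k)) atTop (𝓝 (σ t)) :=
      hcont.tendsto.comp (tendsto_nhdsWithin_iff.2 ⟨e2, p2.mono fun k hk =>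
        ⟨by linarith [hε k, ht.1], hk⟩⟩)
    refine tendsto_of_tendsto_of_tendsto_of_le_of_le' l1 l2 ?_ ?_
    · filter_upwards [p1, p3] with k h1 h3
      have := hε k
      exact hlo k _ ⟨h1.le, by linarith⟩ t ⟨ht.1, by linarith⟩ (by linarith)
    · filter_upwards [p1, p3] with k h1 h3
      have := hε k
      exact hhi k _ ⟨by linarith, h3⟩ t ⟨ht.1, by linarith⟩ le_rfl
  · obtain ⟨i, rfl⟩ := he ⟨ht, hcont⟩
    refine tendsto_const_nhds.congr' ?_
    filter_upwards [eventually_ge_atTop i, hT'.eventually (eventually_gt_nhds ht.2)] with k h1 h2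
    exact (hF k i h1 ⟨ht.1, h2⟩).symm

/-- The controls are φ ∘ κ_k for interpolants κ_k of the clock that stop at pseudo-times a_k tending
to S. Their gauge t + κ_k - φ₀(κ_k) stays bounded for fixed t < T because κ_k(t) converges; and in
the infinite case the a_j themselves serve as the levels of the endpoint condition. -/
theorem System.IsCompletionWitness.exists_limitSolution {sys : System n m l}
    (hsys : sys.Assumptions) {x₀ : E n} {u₀ : E m} {T : ℝ} (hT : 0 < T) {u : ℝ → E m} {v : ℝ → E l}
    (hv : IsOrdinaryControl sys.V T v) {x : ℝ → E n} {c : SpaceTimeControl m l} {σ : ℝ → ℝ}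
    {ξ : ℝ → E n} (h : sys.IsCompletionWitness x₀ u₀ T u v x c σ ξ) :
    ∃ uk xk, sys.IsSimpleApproximation x₀ u₀ T u v x uk xk ∧ LocallyEquiboundedVariation T uk ∧
      (c.S = ⊤ → EndpointCondition T uk xk) := by
  obtain ⟨R₀, hR⟩ := h.exists_norm_le
  obtain ⟨b, hb, hbm, hbξ, hbφ⟩ := h.exists_seq
  obtain ⟨hc, hσ, hξ, hx, -, -⟩ := h
  have hf := hc.isFeasible
  obtain ⟨B, K, hF⟩ := hsys.exists_isField hT.le hv (R₀ + 2)
  have hB := hF.nonneg_B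
  have hC : 0 ≤ K * (B + 1) := mul_nonneg hF.nonneg_K (by linarith)
  set ε : ℕ → ℝ := fun k => 1 / ((k : ℝ) + 1) with hεdef
  have hε : ∀ k, 0 < ε k := fun k => by positivity
  have hε1 : ∀ k, ε k ≤ 1 := fun k => by
    simp only [hεdef]; rw [div_le_one (by positivity)]; linarith [k.cast_nonneg (α := ℝ)]
  have hεlim : Tendsto ε atTop (𝓝 0) := tendsto_one_div_add_atTop_nhds_zero_nat
  have hεanti : ∀ j k : ℕ, j ≤ k → ε k ≤ ε j := fun j k hjk =>
    one_div_le_one_div_of_le (by positivity) (by have : (j : ℝ) ≤ k := by exact_mod_cast hjk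
                                                 linarith)
  have hφ₀b : Tendsto (fun i => c.φ₀ (b i)) atTop (𝓝 T) := hf.tendsto_φ₀.comp hb
  have h0S : (0 : ℝ) ∈ pseudoTime c.S := ⟨le_rfl, hf.isControl.pos_S⟩
  obtain ⟨ψ, hψ, hψP⟩ := extraction_forall_of_eventually
    (P := fun k i => b i ∈ pseudoTime c.S ∧ 0 < c.φ₀ (b i) ∧
      (B + K * (B + 1) + 1) * (T - c.φ₀ (b i)) ≤ ε k ∧ ‖ξ (b i) - x T‖ ≤ ε k ∧
      ‖c.φ (b i) - u T‖ ≤ ε k) (fun k => by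
    have h1 : Tendsto (fun i => (B + K * (B + 1) + 1) * (T - c.φ₀ (b i))) atTop (𝓝 0) := by
      simpa using (tendsto_const_nhds (x := T)).sub hφ₀b |>.const_mul (B + K * (B + 1) + 1)
    filter_upwards [hb.eventually (eventually_toEnd h0S), hφ₀b.eventually (eventually_gt_nhds hT),
      h1.eventually (eventually_lt_nhds (hε k)),
      (tendsto_iff_norm_sub_tendsto_zero.1 hbξ).eventually (eventually_lt_nhds (hε k)),
      (tendsto_iff_norm_sub_tendsto_zero.1 hbφ).eventually (eventually_lt_nhds (hε k))]
      with i e1 e2 e3 e4 e5 using ⟨e1.2, e2, e3.le, e4.le, e5.le⟩)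
  set a : ℕ → ℝ := fun k => b (ψ k) with ha
  choose haS hapos haT haξ haφ using hψP
  have hcount : {t ∈ Ico 0 T | ¬ContinuousWithinAt σ (Ico 0 T) t}.Countable :=
    hσ.monotone.countable_not_continuousWithinAt
  -- The point 0 is added only to have a nonempty set to enumerate.
  obtain ⟨e, he⟩ := (hcount.insert 0).exists_eq_range (insert_nonempty _ _)
  choose κ y hκm hκc hκ0 hκI hκT hκF hκlo hκhi hκφ hAC hsol hyξ using fun k =>
    hξ.exists_approximation hF hc hσ hR (haS k) (hapos k) (hε k) (hε1 k) (haT k)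
      ((Finset.range (k + 1)).image e)
  have hκS : ∀ k t, κ k t ∈ pseudoTime c.S := fun k t => Icc_subset_pseudoTime (haS k) (hκI k t)
  have hT'lim : Tendsto (fun k => c.φ₀ (a k)) atTop (𝓝 T) := hφ₀b.comp hψ.tendsto_atTop
  have hκlim : ∀ t ∈ Ico 0 T, Tendsto (fun k => κ k t) atTop (𝓝 (σ t)) := fun t ht =>
    tendsto_of_interpolation hε hεlim hT'lim ((subset_insert _ _).trans he.subset)
      (fun k => (hκ0 k).trans hσ.zero.symm) (fun k i hi hmem => hκF k _ (Finset.mem_image.2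
        ⟨i, Finset.mem_range.2 (Nat.lt_succ_of_le hi), rfl⟩) hmem) hκlo hκhi ht
  have hκTT : ∀ k, κ k T = a k := fun k => hκT k T (hf.le_T (haS k))
  have hTm : T ∈ Icc 0 T := ⟨hT.le, le_rfl⟩
  have h2ε : Tendsto (fun k => 2 * ε k) atTop (𝓝 0) := by simpa using hεlim.const_mul 2
  have hlimS : ∀ t ∈ Ico 0 T, Tendsto (fun k => κ k t) atTop (𝓝[pseudoTime c.S] (σ t)) :=
    fun t ht => tendsto_nhdsWithin_iff.2 ⟨hκlim t ht, Eventually.of_forall fun k => hκS k t⟩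
  have hξlim : ∀ t ∈ Icc 0 T, Tendsto (fun k => ξ (κ k t)) atTop (𝓝 (x t)) := by
    intro t ht
    rcases ht.2.lt_or_eq with hlt | rfl
    · rw [hx t ⟨ht.1, hlt⟩]
      exact (hξ.continuousOn _ (hσ.mem t ⟨ht.1, hlt⟩)).tendsto.comp (hlimS t ⟨ht.1, hlt⟩)
    · simp only [hκTT]
      exact hbξ.comp hψ.tendsto_atTop
  have hulim : ∀ t ∈ Icc 0 T, Tendsto (fun k => c.φ (κ k t)) atTop (𝓝 (u t)) := by
    intro t ht
    rcases ht.2.lt_or_eq with hlt | rfl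
    · rw [← (hσ.graph t ⟨ht.1, hlt⟩).2]
      exact (hf.continuousOn_φ _ (hσ.mem t ⟨ht.1, hlt⟩)).tendsto.comp (hlimS t ⟨ht.1, hlt⟩)
    · simp only [hκTT]
      exact hbφ.comp hψ.tendsto_atTop
  refine ⟨fun k t => c.φ (κ k t), y, ⟨hAC, fun k => by simp only [hκ0, hf.φ_zero], hulim, hsol,
    ⟨R₀ + 2, fun k t ht => ?_⟩, fun t ht => ?_⟩, fun t ht => ?_, fun hS => ?_⟩
  · have h1 := hyξ k t ht
    have h2 := hR _ (hκS k t)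
    have h3 := norm_sub_norm_le (y k t) (ξ (κ k t))
    linarith [hε1 k]
  · have h1 : Tendsto (fun k => y k t - ξ (κ k t)) atTop (𝓝 0) :=
      squeeze_zero_norm (fun k => hyξ k t ht) h2ε
    simpa using h1.add (hξlim t ht)
  · obtain ⟨M, hM⟩ := (hκlim t ⟨ht.1.le, ht.2⟩).bddAbove_range
    refine ⟨M.toNNReal, fun k => ?_⟩
    have hbv : eVariationOn (fun t => c.φ (κ k t)) (Icc 0 t) ≠ ⊤ := by
      have h1 := (hAC k).1.boundedVariationOn
      rw [uIcc_of_le hT.le] at h1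
      exact h1.mono (Icc_subset_Icc_right ht.2.le)
    rw [← ENNReal.ofReal_toReal hbv]
    refine ENNReal.ofReal_le_ofReal ?_
    have h1 := hf.gauge_comp (hκm k) (hκc k) (hκ0 k) ht.1.le (hκS k t)
    have h2 := hf.isControl.nonneg_φ₀ _ (hκS k t)
    have h3 := hM ⟨k, rfl⟩
    simp only [gauge] at h1 h3
    linarith
  · have ham : StrictMono a := (hbm hS).comp hψ
    -- The constant adds up the estimates below: B + K(B + 1) + 6 for the states and 3 for the
    -- controls, after replacing ε_k by the larger ε_j.
    set W : ℝ := B + K * (B + 1) + 9 with hW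
    have hW0 : 0 < W := by linarith
    refine ⟨fun r => W / (r + 1), a, id, fun r hr => by positivity, fun r hr q hq hrq => ?_, ?_,
      ham, fun j => (haS j).1, ?_, strictMono_id, fun j => le_rfl, fun j k hjk => ?_⟩
    · have : 0 ≤ r := hr
      exact div_le_div_of_nonneg_left hW0.le (by linarith) (by linarith)
    · exact tendsto_const_nhds.div_atTop (tendsto_id.atTop_add tendsto_const_nhds)
    · have := hb.comp hψ.tendsto_atTop
      rwa [hS, toEnd_top] at this
    have hjk' : j < k := hjk
    set T' := c.φ₀ (a k) with hT'
    have hT'T : T' ≤ T := hf.le_T (haS k)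
    have hT'0 : 0 < T' := hapos k
    have hgauge := fun t ht => hf.gauge_comp (hκm k) (hκc k) (hκ0 k) (t := t) ht (hκS k t)
    have hg' : gauge (fun t => c.φ (κ k t)) T' = a k := by
      rw [hgauge T' hT'0.le, hκT k T' le_rfl]; ring
    -- The gauge of u_k runs from 0 to a_k on [0,T'], so it takes the value a_j < a_k before T'.
    obtain ⟨τ, hτ, hτa⟩ := intermediate_value_Icc hT'0.le
      ((continuousOn_gauge hT.le (hAC k).1).mono (Icc_subset_Icc_right hT'T))
      (show a j ∈ Icc (gauge (fun t => c.φ (κ k t)) 0) (gauge (fun t => c.φ (κ k t)) T') by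
        rw [gauge_zero, hg']; exact ⟨(haS j).1, (ham hjk').le⟩)
    have hτT' : τ < T' := lt_of_le_of_ne hτ.2 fun e => by
      rw [e, hg'] at hτa
      exact (ham hjk').ne' hτa
    have hτT : τ ∈ Icc 0 T := ⟨hτ.1, hτ.2.trans hT'T⟩
    refine ⟨τ, ⟨hτ.1, hτT'.trans_le hT'T⟩, hτa, ?_⟩
    rw [hgauge τ hτ.1] at hτa
    -- By the gauge formula κ_k(τ) - a_j is the time mismatch φ₀(κ_k(τ)) - τ; so a_j is nearly the
    -- pseudo-time reached at τ.
    have hdist : |κ k τ - a j| ≤ ε k := by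
      have h1 := hκφ k τ hτ
      rwa [show κ k τ - a j = -(τ - c.φ₀ (κ k τ)) by linarith, abs_neg]
    have hinc := hf.abs_add_norm_le (hκS k τ) (haS j)
    have hφd : ‖c.φ (κ k τ) - c.φ (a j)‖ ≤ ε k := by
      have := abs_nonneg (c.φ₀ (κ k τ) - c.φ₀ (a j))
      linarith
    have hξd : ‖ξ (κ k τ) - ξ (a j)‖ ≤ (B + K * (B + 1)) * ε k := by
      have h1 := hξ.followsOn hF hc (fun s hs => (hR s hs).trans (by linarith)) (haS k) (a j)
        ⟨(haS j).1, (ham hjk').le⟩ (κ k τ) (hκI k τ)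
      have h2 := hF.norm_increment_le (θ := c.φ₀) (ξ (a j)) (hf.isControl.mem_U _ (haS j)) (κ k τ)
      have h3 := mul_le_mul_of_nonneg_left (hinc.trans hdist) hB
      have h4 : (κ k τ - a j) ^ 2 ≤ ε k := by
        rw [← sq_abs]
        have := abs_nonneg (κ k τ - a j)
        nlinarith [hε1 k]
      have h5 := mul_le_mul_of_nonneg_left h4 hC
      have h6 := norm_add_le (ξ (κ k τ) - ξ (a j) - increment (sys.drift T v (R₀ + 2))
        (sys.coupling (R₀ + 2)) c.φ₀ c.φ (ξ (a j)) (a j) (κ k τ)) (increment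
        (sys.drift T v (R₀ + 2)) (sys.coupling (R₀ + 2)) c.φ₀ c.φ (ξ (a j)) (a j) (κ k τ))
      rw [sub_add_cancel] at h6
      simp only [id] at h1
      linarith
    have hkj := hεanti j k hjk'.le
    have hxd : ‖y k τ - y k T‖ ≤ (B + K * (B + 1)) * ε k + 5 * ε k + ε j := by
      have h1 := hyξ k τ hτT
      have h2 := hyξ k T hTm
      rw [hκTT] at h2
      have h3 := haξ j
      have h4 := haξ k
      have h5 : y k τ - y k T = (y k τ - ξ (κ k τ)) + (ξ (κ k τ) - ξ (a j)) + (ξ (a j) - x T)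
        - (ξ (a k) - x T) - (y k T - ξ (a k)) := by abel
      rw [h5]
      refine (norm_sub_le _ _).trans ?_
      have h6 := norm_sub_le (y k τ - ξ (κ k τ) + (ξ (κ k τ) - ξ (a j)) + (ξ (a j) - x T))
        (ξ (a k) - x T)
      have h7 := norm_add₃_le (a := y k τ - ξ (κ k τ)) (b := ξ (κ k τ) - ξ (a j))
        (c := ξ (a j) - x T)
      linarith
    have hud : ‖c.φ (κ k τ) - c.φ (κ k T)‖ ≤ 2 * ε k + ε j := by
      rw [hκTT]
      have h3 := haφ j
      have h4 := haφ k
      have h5 : c.φ (κ k τ) - c.φ (a k) = (c.φ (κ k τ) - c.φ (a j)) + (c.φ (a j) - u T)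
        - (c.φ (a k) - u T) := by abel
      rw [h5]
      refine (norm_sub_le _ _).trans ?_
      have h6 := norm_add_le (c.φ (κ k τ) - c.φ (a j)) (c.φ (a j) - u T)
      linarith
    refine (pairNorm_le_add _ _).trans ?_
    have h8 : W / ((j : ℝ) + 1) = W * ε j := by simp only [hεdef]; ring
    beta_reduce
    rw [h8]
    have h9 : (B + K * (B + 1)) * ε k ≤ (B + K * (B + 1)) * ε j :=
      mul_le_mul_of_nonneg_left hkj (by linarith)
    have h10 : W * ε j = (B + K * (B + 1)) * ε j + 9 * ε j := by rw [hW]; ring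
    linarith

end WellPosedness

end Impulsive

/-! ### Assembly of the two implications -/

theorem mainTheorem1 {n m l : ℕ} (sys : Impulsive.System n m l) (hsys : sys.Assumptions)
    (hW : Impulsive.WhitneyProperty sys.U)
    (x₀ : Impulsive.E n) (u₀ : Impulsive.E m) (T : ℝ) (hT : 0 < T)
    (u : ℝ → Impulsive.E m) (v : ℝ → Impulsive.E l)
    (hu : Impulsive.IsBVLocControl sys.U T u) (hv : Impulsive.IsOrdinaryControl sys.V T v)
    (hu₀ : u 0 = u₀) (x : ℝ → Impulsive.E n) :
    (sys.IsGraphCompletionSolution x₀ u₀ T u v x →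
      sys.IsBVLocSLimitSolutionOpen x₀ u₀ T u v x ∧
      (sys.U.Nontrivial → sys.IsBVLocSLimitSolution x₀ u₀ T u v x)) ∧
    (sys.IsBVLocSLimitSolution x₀ u₀ T u v x →
      sys.IsGraphCompletionSolution x₀ u₀ T u v x) := by
  refine ⟨?_, fun h => h.isGraphCompletionSolution hsys hT hv⟩
  rintro ⟨c, σ, ξ, h⟩
  obtain ⟨uk, xk, happ, hvar, hend⟩ :=
    Impulsive.System.IsCompletionWitness.exists_limitSolution hsys hT hv h
  refine ⟨⟨uk, xk, happ, hvar⟩, fun hU => ?_⟩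
  have hbd : ∀ {uk xk}, sys.IsSimpleApproximation x₀ u₀ T u v x uk xk →
      ∃ R : ℝ, ∀ t ∈ Set.Icc 0 T, ‖x t‖ ≤ R := fun happ => by
    obtain ⟨R, hR⟩ := happ.equibounded
    exact ⟨R, fun t ht => le_of_tendsto (happ.tendsto_x t ht).norm
      (Filter.Eventually.of_forall fun k => hR k t ht)⟩
  -- The levels of the endpoint condition must diverge, which requires an infinite final
  -- pseudo-time; a finite completion is prolonged beforehand.
  rcases eq_or_lt_of_le (le_top : c.S ≤ ⊤) with hS | hS
  · exact ⟨uk, xk, happ, hvar, hbd happ, hend hS⟩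
  · obtain ⟨c', σ', ξ', h', hS'⟩ :=
      Impulsive.System.IsCompletionWitness.exists_infinite hsys hW hU hT hv
        (hu.1 T ⟨hT.le, le_rfl⟩) h hS
    obtain ⟨uk', xk', happ', hvar', hend'⟩ :=
      Impulsive.System.IsCompletionWitness.exists_limitSolution hsys hT hv h'
    exact ⟨uk', xk', happ', hvar', hbd happ', hend' hS'⟩
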